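/- Let $(D;A,E;M)$ be a $\mathcal{VB}$-algebroid: a double vector bundle, i.e. a manifold $D$ with vector bundle structures $p_D\colon D\to E$ and $p\colon D\to A$ over vector bundles $p_E\colon E\to M$ and $p_A\colon A\to M$, such that $p_D$ is a vector bundle morphism over $p_A$, $p$ one over $p_E$, and the addition of $D\to E$ is a vector bundle morphism over the addition of $A\to M$; together with Lie algebroid structures on $D\to E$ and on $A\to M$ such that the anchor $\rho_D\colon D\to TE$ is a vector bundle morphism from $D\to A$ to $TE\to TM$ over the anchor $\rho_A\colon A\to TM$, and such that on sections of $D\to E$ the bracket of two linear sections is linear, the bracket of a linear and a core section is a core section, and two core sections commute. Let $C=\ker p\cap\ker p_D$ be its core, a smooth vector bundle over $M$, and let $\partial\colon C\to E$, $c\mapsto\rho_D(c)\in\ker (dp_E)_{0_m}\cong E_m$ for $c\in C_m$, be its core anchor, a vector bundle morphism. Then the kernel $\mathcal K=\ker p\to E$ of the extension $p\colon D\to A$ is a Lie subalgebroid of $D\to E$, identified with $p_E^*C$ by $(c,e)\mapsto 0_e+_A c$ (where $0_e$ is the zero vector of the fibre $D_e$ of $D\to E$ and $+_A$ is the addition of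 $D\to A$), and it is integrated by a source-simply connected Lie groupoid whose underlying category is the $2$-vector bundle $C\oplus E\rightrightarrows E$ (a category internal to vector bundles over $M$) with source $(c,e)\mapsto e$, target $(c,e)\mapsto e+\partial c$, units $e\mapsto (0,e)$ and multiplication $(c_2,e+\partial c_1)\cdot(c_1,e)=(c_1+c_2,e)$. The $2$-term complex associated with this $2$-vector bundle, that is, the kernel of the source map with the restriction of the target map to it, is isomorphic to $\partial\colon C\to E$ by $c\mapsto (c,0)$. -/

import Mathlib

open Bundle Manifold ContDiff
open scoped Topology

noncomputable section

/-! ### Smooth vector bundle morphisms -/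

section BundleMorphisms

variable {B B' : Type*} {F₁ F₂ : Type*} {V₁ : B → Type*} {V₂ : B' → Type*}

/-- Fibrewise addition in a vector bundle, as a relation on its total space: `u` and `v` lie in the
same fibre and `w = u + v`. -/
def IsBundleSum {V : B → Type*} [∀ x, Add (V x)] (u v w : TotalSpace F₁ V) : Prop :=
  ∃ (b : B) (x y : V b), u = ⟨b, x⟩ ∧ v = ⟨b, y⟩ ∧ w = ⟨b, x + y⟩

/-- The map `f` between total spaces covers `g` and is linear on the fibres. -/
def IsFibrewiseLinear [∀ x, AddCommGroup (V₁ x)] [∀ x, Module ℝ (V₁ x)]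
    [∀ x, AddCommGroup (V₂ x)] [∀ x, Module ℝ (V₂ x)]
    (f : TotalSpace F₁ V₁ → TotalSpace F₂ V₂) (g : B → B') : Prop :=
  ∃ L : ∀ b, V₁ b →ₗ[ℝ] V₂ (g b), ∀ b v, f ⟨b, v⟩ = ⟨g b, L b v⟩

end BundleMorphisms

section BundleHom

variable {EB HB B : Type*} [NormedAddCommGroup EB] [NormedSpace ℝ EB] [TopologicalSpace HB]
  (I : ModelWithCorners ℝ EB HB) [TopologicalSpace B] [ChartedSpace HB B]
  (F₁ : Type*) [NormedAddCommGroup F₁] [NormedSpace ℝ F₁]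
  (V₁ : B → Type*) [TopologicalSpace (TotalSpace F₁ V₁)]
  [∀ x, TopologicalSpace (V₁ x)] [∀ x, AddCommGroup (V₁ x)] [∀ x, Module ℝ (V₁ x)]
  [FiberBundle F₁ V₁] [VectorBundle ℝ F₁ V₁]
  (F₂ : Type*) [NormedAddCommGroup F₂] [NormedSpace ℝ F₂]
  (V₂ : B → Type*) [TopologicalSpace (TotalSpace F₂ V₂)]
  [∀ x, TopologicalSpace (V₂ x)] [∀ x, AddCommGroup (V₂ x)] [∀ x, Module ℝ (V₂ x)]
  [FiberBundle F₂ V₂] [VectorBundle ℝ F₂ V₂]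

/-- The derivative of a real function in the direction of a tangent vector. -/
def dirDeriv (f : B → ℝ) (x : B) (v : TangentSpace I x) : ℝ := mfderiv I 𝓘(ℝ, ℝ) f x v

/-- A smooth vector bundle morphism covering the identity of the base. -/
structure SmoothBundleHom where
  /-- the linear maps between the fibres -/
  toFun : ∀ x, V₁ x →ₗ[ℝ] V₂ x
  contMDiff_toFun : ContMDiff (I.prod 𝓘(ℝ, F₁)) (I.prod 𝓘(ℝ, F₂)) ∞
    (fun v : TotalSpace F₁ V₁ => (⟨v.proj, toFun v.proj v.snd⟩ : TotalSpace F₂ V₂))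

namespace SmoothBundleHom

variable {I F₁ V₁ F₂ V₂}

instance : CoeFun (SmoothBundleHom I F₁ V₁ F₂ V₂) (fun _ => ∀ x, V₁ x →ₗ[ℝ] V₂ x) := ⟨toFun⟩

/-- The map induced on smooth sections. -/
def mapSection (φ : SmoothBundleHom I F₁ V₁ F₂ V₂) (X : Cₛ^∞⟮I; F₁, V₁⟯) : Cₛ^∞⟮I; F₂, V₂⟯ where
  toFun x := φ x (X x)
  contMDiff_toFun := φ.contMDiff_toFun.comp X.contMDiff

variable {F₃ : Type*} [NormedAddCommGroup F₃] [NormedSpace ℝ F₃]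
  {V₃ : B → Type*} [TopologicalSpace (TotalSpace F₃ V₃)]
  [∀ x, TopologicalSpace (V₃ x)] [∀ x, AddCommGroup (V₃ x)] [∀ x, Module ℝ (V₃ x)]
  [FiberBundle F₃ V₃] [VectorBundle ℝ F₃ V₃]

/-- The identity. -/
def id : SmoothBundleHom I F₁ V₁ F₁ V₁ := ⟨fun _ => LinearMap.id, contMDiff_id⟩

/-- The zero morphism. -/
def zero : SmoothBundleHom I F₁ V₁ F₂ V₂ :=
  ⟨fun _ => 0, (contMDiff_zeroSection ℝ V₂).comp (contMDiff_proj V₁)⟩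

/-- Composition. -/
def comp (ψ : SmoothBundleHom I F₂ V₂ F₃ V₃) (φ : SmoothBundleHom I F₁ V₁ F₂ V₂) :
    SmoothBundleHom I F₁ V₁ F₃ V₃ :=
  ⟨fun x => ψ x ∘ₗ φ x, ψ.contMDiff_toFun.comp φ.contMDiff_toFun⟩

/-- Pointwise sum. -/
def add (φ ψ : SmoothBundleHom I F₁ V₁ F₂ V₂) : SmoothBundleHom I F₁ V₁ F₂ V₂ where
  toFun x := φ x + ψ x
  contMDiff_toFun := fun v₀ => by
    have h₁ := (contMDiffAt_totalSpace.1 (φ.contMDiff_toFun v₀)).2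
    have h₂ := (contMDiffAt_totalSpace.1 (ψ.contMDiff_toFun v₀)).2
    refine contMDiffAt_totalSpace.2 ⟨(contMDiff_proj V₁) v₀, ?_⟩
    refine (h₁.add h₂).congr_of_eventuallyEq ?_
    have hb : ∀ᶠ v : TotalSpace F₁ V₁ in 𝓝 v₀,
        v.proj ∈ (trivializationAt F₂ V₂ v₀.proj).baseSet :=
      (FiberBundle.continuous_proj F₁ V₁).continuousAt.eventually
        ((trivializationAt F₂ V₂ v₀.proj).open_baseSet.mem_nhds
          (mem_baseSet_trivializationAt F₂ V₂ v₀.proj))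
    filter_upwards [hb] with v hv
    exact ((trivializationAt F₂ V₂ v₀.proj).linear ℝ hv).1 _ _

/-- First projection of a direct sum of vector bundles. -/
def fst : SmoothBundleHom I (F₁ × F₂) (V₁ ×ᵇ V₂) F₁ V₁ where
  toFun x := LinearMap.fst ℝ (V₁ x) (V₂ x)
  contMDiff_toFun := fun v₀ => by
    have h := (contMDiffAt_totalSpace.1 (contMDiff_id (I := I.prod 𝓘(ℝ, F₁ × F₂)) (n := ∞) v₀)).2
    have k := (contDiff_fst (𝕜 := ℝ) (E := F₁) (F := F₂) (n := ∞)).contMDiff.contMDiffAt.comp v₀ h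
    exact contMDiffAt_totalSpace.2 ⟨(contMDiff_proj (V₁ ×ᵇ V₂)) v₀, k⟩

/-- Second projection of a direct sum of vector bundles. -/
def snd : SmoothBundleHom I (F₁ × F₂) (V₁ ×ᵇ V₂) F₂ V₂ where
  toFun x := LinearMap.snd ℝ (V₁ x) (V₂ x)
  contMDiff_toFun := fun v₀ => by
    have h := (contMDiffAt_totalSpace.1 (contMDiff_id (I := I.prod 𝓘(ℝ, F₁ × F₂)) (n := ∞) v₀)).2
    have k := (contDiff_snd (𝕜 := ℝ) (E := F₁) (F := F₂) (n := ∞)).contMDiff.contMDiffAt.comp v₀ h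
    exact contMDiffAt_totalSpace.2 ⟨(contMDiff_proj (V₁ ×ᵇ V₂)) v₀, k⟩

/-- The morphism into a direct sum of vector bundles with given components. -/
def pair (φ : SmoothBundleHom I F₃ V₃ F₁ V₁) (ψ : SmoothBundleHom I F₃ V₃ F₂ V₂) :
    SmoothBundleHom I F₃ V₃ (F₁ × F₂) (V₁ ×ᵇ V₂) where
  toFun x := (φ x).prod (ψ x)
  contMDiff_toFun := fun v₀ => by
    have h₁ := (contMDiffAt_totalSpace.1 (φ.contMDiff_toFun v₀)).2
    have h₂ := (contMDiffAt_totalSpace.1 (ψ.contMDiff_toFun v₀)).2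
    exact contMDiffAt_totalSpace.2 ⟨(contMDiff_proj V₃) v₀, h₁.prodMk_space h₂⟩

end SmoothBundleHom

/-! ### Lie algebroids -/

variable [IsManifold I ∞ B]

/-- A Lie algebroid structure on a smooth vector bundle `V₁` over `B`: a smooth anchor to the
tangent bundle and a Lie bracket on smooth sections with the Leibniz rule. -/
structure LieAlgebroid where
  /-- the anchor -/
  anchor : ∀ x, V₁ x →ₗ[ℝ] TangentSpace I x
  contMDiff_anchor : ContMDiff (I.prod 𝓘(ℝ, F₁)) I.tangent ∞
    (fun v : TotalSpace F₁ V₁ => (⟨v.proj, anchor v.proj v.snd⟩ : TangentBundle I B))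
  /-- the bracket of sections -/
  bracket : Cₛ^∞⟮I; F₁, V₁⟯ →ₗ[ℝ] Cₛ^∞⟮I; F₁, V₁⟯ →ₗ[ℝ] Cₛ^∞⟮I; F₁, V₁⟯
  bracket_self : ∀ X, bracket X X = 0
  jacobi : ∀ X Y Z, bracket X (bracket Y Z) = bracket (bracket X Y) Z + bracket Y (bracket X Z)
  leibniz : ∀ (f : C^∞⟮I, B; 𝓘(ℝ, ℝ), ℝ⟯) (X Y fY : Cₛ^∞⟮I; F₁, V₁⟯),
    (∀ x, fY x = f x • Y x) → ∀ x, bracket X fY x =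
      f x • bracket X Y x + dirDeriv I f x (anchor x (X x)) • Y x

namespace LieAlgebroid

variable {I F₁ V₁ F₂ V₂}

/-- The anchor as a map of total spaces. -/
def anchorMap (𝒜 : LieAlgebroid I F₁ V₁) (v : TotalSpace F₁ V₁) : TangentBundle I B :=
  ⟨v.proj, 𝒜.anchor v.proj v.snd⟩

/-- Morphisms of Lie algebroids over the identity of the base: vector bundle morphisms that
preserve anchors and brackets. -/
def IsMorphism (𝒜 : LieAlgebroid I F₁ V₁) (𝒜' : LieAlgebroid I F₂ V₂)
    (φ : SmoothBundleHom I F₁ V₁ F₂ V₂) : Prop :=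
  (∀ x v, 𝒜'.anchor x (φ x v) = 𝒜.anchor x v) ∧
  ∀ X Y, φ.mapSection (𝒜.bracket X Y) = 𝒜'.bracket (φ.mapSection X) (φ.mapSection Y)

end LieAlgebroid

end BundleHom

/-! ### Lie groupoids and their Lie algebroids -/

section LieGroupoid

variable {EG HG : Type*} [NormedAddCommGroup EG] [NormedSpace ℝ EG] [TopologicalSpace HG]
  (IG : ModelWithCorners ℝ EG HG)
  {EB HB : Type*} [NormedAddCommGroup EB] [NormedSpace ℝ EB] [TopologicalSpace HB]
  (I : ModelWithCorners ℝ EB HB)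
  (G : Type*) [TopologicalSpace G] [ChartedSpace HG G] [IsManifold IG ∞ G]
  (B : Type*) [TopologicalSpace B] [ChartedSpace HB B] [IsManifold I ∞ B]

/-- A Lie groupoid `G ⇉ B` between (finite-dimensional, boundaryless) manifolds. The product
`mul g h` is meaningful only for composable pairs, that is, if `src g = tgt h`. -/
structure LieGroupoid where
  /-- source -/
  src : G → B
  /-- target -/
  tgt : G → B
  /-- units -/
  unit : B → G
  /-- inverses -/
  inv : G → G
  /-- multiplication -/
  mul : G → G → G
  src_unit : ∀ x, src (unit x) = x
  tgt_unit : ∀ x, tgt (unit x) = x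
  src_inv : ∀ g, src (inv g) = tgt g
  tgt_inv : ∀ g, tgt (inv g) = src g
  src_mul : ∀ g h, src g = tgt h → src (mul g h) = src h
  tgt_mul : ∀ g h, src g = tgt h → tgt (mul g h) = tgt g
  mul_assoc : ∀ g h k, src g = tgt h → src h = tgt k → mul (mul g h) k = mul g (mul h k)
  mul_unit : ∀ g, mul g (unit (src g)) = g
  unit_mul : ∀ g, mul (unit (tgt g)) g = g
  mul_inv : ∀ g, mul g (inv g) = unit (tgt g)
  inv_mul : ∀ g, mul (inv g) g = unit (src g)
  contMDiff_src : ContMDiff IG I ∞ src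
  contMDiff_tgt : ContMDiff IG I ∞ tgt
  contMDiff_unit : ContMDiff I IG ∞ unit
  contMDiff_inv : ContMDiff IG IG ∞ inv
  /-- the source is a submersion (hence so is the target) -/
  submersion_src : ∀ g, Function.Surjective (mfderiv IG I src g)
  submersion_tgt : ∀ g, Function.Surjective (mfderiv IG I tgt g)
  /-- multiplication is smooth on the submanifold of composable pairs -/
  contMDiffOn_mul : ContMDiffOn (IG.prod IG) IG ∞ (fun p : G × G => mul p.1 p.2)
    {p | src p.1 = tgt p.2}
  t2_sourceFibre : ∀ x, T2Space {g // src g = x}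

namespace LieGroupoid

variable {IG I G B} (𝒢 : LieGroupoid IG I G B)

/-- All source fibres are (connected and) simply connected. -/
def SourceSimplyConnected : Prop := ∀ x, SimplyConnectedSpace {g // 𝒢.src g = x}

variable {F : Type*} [NormedAddCommGroup F] [NormedSpace ℝ F]
  {V : B → Type*} [TopologicalSpace (TotalSpace F V)]
  [∀ x, TopologicalSpace (V x)] [∀ x, AddCommGroup (V x)] [∀ x, Module ℝ (V x)]
  [FiberBundle F V] [VectorBundle ℝ F V]

/-- The right-invariant vector field with `g ↦ dR_g (φ (X (t g)))`, for a section `X` of `V` and a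
map `φ` that identifies the fibres of `V` with the tangent spaces of the source fibres at the units.
Here `R_g : s⁻¹(t g) → s⁻¹(s g)` is right multiplication by `g`; on vectors tangent to the source
fibre its derivative within the source fibre is uniquely determined. -/
def rightInvariantField (φ : ∀ x, V x →ₗ[ℝ] TangentSpace IG (𝒢.unit x)) (X : Cₛ^∞⟮I; F, V⟯)
    (g : G) : TangentSpace IG g :=
  mfderivWithin IG IG (fun h => 𝒢.mul h g) {h | 𝒢.src h = 𝒢.tgt g} (𝒢.unit (𝒢.tgt g))
    (φ (𝒢.tgt g) (X (𝒢.tgt g)))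

/-- The Lie groupoid `𝒢` integrates the Lie algebroid `𝒜` on `V → B`: there is an isomorphism `φ`
of `V` onto the Lie algebroid of `𝒢`, that is, onto the bundle `ker ds` restricted to the units,
with anchor `dt` and with the bracket given by the Lie bracket of right-invariant vector fields. -/
def Integrates (𝒜 : LieAlgebroid I F V) : Prop :=
  ∃ φ : ∀ x, V x →ₗ[ℝ] TangentSpace IG (𝒢.unit x),
    ContMDiff (I.prod 𝓘(ℝ, F)) IG.tangent ∞
      (fun v : TotalSpace F V => (⟨𝒢.unit v.proj, φ v.proj v.snd⟩ : TangentBundle IG G)) ∧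
    (∀ x, Function.Injective (φ x)) ∧
    (∀ x, Set.range (φ x) = {w | mfderiv IG I 𝒢.src (𝒢.unit x) w = 0}) ∧
    (∀ x v, tangentMap IG I 𝒢.tgt ⟨𝒢.unit x, φ x v⟩ = ⟨x, 𝒜.anchor x v⟩) ∧
    ∀ (X Y : Cₛ^∞⟮I; F, V⟯) (g : G),
      VectorField.mlieBracket IG (𝒢.rightInvariantField φ X) (𝒢.rightInvariantField φ Y) g =
        𝒢.rightInvariantField φ (𝒜.bracket X Y) g

end LieGroupoid

end LieGroupoid

/-! ### 2-vector bundles -/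

section TwoVectorBundle

variable {EB HB B : Type*} [NormedAddCommGroup EB] [NormedSpace ℝ EB] [TopologicalSpace HB]
  (I : ModelWithCorners ℝ EB HB) [TopologicalSpace B] [ChartedSpace HB B]
  (F₁ : Type*) [NormedAddCommGroup F₁] [NormedSpace ℝ F₁]
  (V₁ : B → Type*) [TopologicalSpace (TotalSpace F₁ V₁)]
  [∀ x, TopologicalSpace (V₁ x)] [∀ x, AddCommGroup (V₁ x)] [∀ x, Module ℝ (V₁ x)]
  [FiberBundle F₁ V₁] [VectorBundle ℝ F₁ V₁]
  (F₀ : Type*) [NormedAddCommGroup F₀] [NormedSpace ℝ F₀]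
  (V₀ : B → Type*) [TopologicalSpace (TotalSpace F₀ V₀)]
  [∀ x, TopologicalSpace (V₀ x)] [∀ x, AddCommGroup (V₀ x)] [∀ x, Module ℝ (V₀ x)]
  [FiberBundle F₀ V₀] [VectorBundle ℝ F₀ V₀]

variable {V₁ V₀} in
/-- The pairs `(g, h)` of arrows over a point `x` with `src g = tgt h`. -/
def composablePairs (x : B) (src tgt : V₁ x →ₗ[ℝ] V₀ x) : Submodule ℝ (V₁ x × V₁ x) where
  carrier := {p | src p.1 = tgt p.2}
  add_mem' {p q} hp hq := by
    change src (p.1 + q.1) = tgt (p.2 + q.2)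
    rw [map_add, map_add, show src p.1 = tgt p.2 from hp, show src q.1 = tgt q.2 from hq]
  zero_mem' := by
    change src 0 = tgt 0
    rw [map_zero, map_zero]
  smul_mem' t p hp := by
    change src (t • p.1) = tgt (t • p.2)
    rw [map_smul, map_smul, show src p.1 = tgt p.2 from hp]

open Classical in
/-- A 2-vector bundle `V₁ ⇉ V₀` over `B`: a category internal to smooth vector bundles over `B`
(with vector bundle morphisms covering the identity). -/
structure TwoVectorBundle where
  /-- source -/
  src : SmoothBundleHom I F₁ V₁ F₀ V₀
  /-- target -/
  tgt : SmoothBundleHom I F₁ V₁ F₀ V₀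
  /-- units -/
  unit : SmoothBundleHom I F₀ V₀ F₁ V₁
  /-- composition `(g, h) ↦ g ∘ h`, defined on the fibre product `{(g, h) | src g = tgt h}` -/
  comp : ∀ x, composablePairs x (src x) (tgt x) →ₗ[ℝ] V₁ x
  contMDiffOn_comp : ContMDiffOn (I.prod 𝓘(ℝ, F₁ × F₁)) (I.prod 𝓘(ℝ, F₁)) ∞
    (fun p : TotalSpace (F₁ × F₁) (V₁ ×ᵇ V₁) => (⟨p.proj,
      if h : p.snd ∈ composablePairs p.proj (src p.proj) (tgt p.proj)
        then comp p.proj ⟨p.snd, h⟩ else 0⟩ : TotalSpace F₁ V₁))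
    {p | p.snd ∈ composablePairs p.proj (src p.proj) (tgt p.proj)}
  src_unit : ∀ x e, src x (unit x e) = e
  tgt_unit : ∀ x e, tgt x (unit x e) = e
  src_comp : ∀ x g h (H : src x g = tgt x h), src x (comp x ⟨(g, h), H⟩) = src x h
  tgt_comp : ∀ x g h (H : src x g = tgt x h), tgt x (comp x ⟨(g, h), H⟩) = tgt x g
  comp_unit : ∀ x g, comp x ⟨(g, unit x (src x g)), (tgt_unit x _).symm⟩ = g
  unit_comp : ∀ x g, comp x ⟨(unit x (tgt x g), g), src_unit x _⟩ = g
  assoc : ∀ x g h k (H : src x g = tgt x h) (K : src x h = tgt x k),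
    comp x ⟨(comp x ⟨(g, h), H⟩, k), (src_comp x g h H).trans K⟩ =
      comp x ⟨(g, comp x ⟨(h, k), K⟩), H.trans (tgt_comp x h k K).symm⟩

namespace TwoVectorBundle

variable {I F₁ V₁ F₀ V₀}

/-- The Lie groupoid `𝒢`, on the total spaces of `V₁` and `V₀`, has `𝒱` as underlying category. -/
def Underlies (𝒱 : TwoVectorBundle I F₁ V₁ F₀ V₀)
    (𝒢 : LieGroupoid (I.prod 𝓘(ℝ, F₁)) (I.prod 𝓘(ℝ, F₀)) (TotalSpace F₁ V₁) (TotalSpace F₀ V₀)) :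
    Prop :=
  (∀ x g, 𝒢.src ⟨x, g⟩ = ⟨x, 𝒱.src x g⟩) ∧
  (∀ x g, 𝒢.tgt ⟨x, g⟩ = ⟨x, 𝒱.tgt x g⟩) ∧
  (∀ x e, 𝒢.unit ⟨x, e⟩ = ⟨x, 𝒱.unit x e⟩) ∧
  ∀ x g h (H : 𝒱.src x g = 𝒱.tgt x h), 𝒢.mul ⟨x, g⟩ ⟨x, h⟩ = ⟨x, 𝒱.comp x ⟨(g, h), H⟩⟩

variable {FC : Type*} [NormedAddCommGroup FC] [NormedSpace ℝ FC]
  {C : B → Type*} [TopologicalSpace (TotalSpace FC C)]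
  [∀ x, TopologicalSpace (C x)] [∀ x, AddCommGroup (C x)] [∀ x, Module ℝ (C x)]
  [FiberBundle FC C] [VectorBundle ℝ FC C]

/-- The 2-term complex `ker(src) → V₀` given by the restriction of `tgt`, which is associated with
the 2-vector bundle `𝒱`, is identified with `∂ : C → V₀` by a vector bundle isomorphism
`C ≅ ker(src)`. -/
def HasComplex (𝒱 : TwoVectorBundle I F₁ V₁ F₀ V₀) (d : SmoothBundleHom I FC C F₀ V₀) : Prop :=
  ∃ κ : SmoothBundleHom I FC C F₁ V₁,
    (∀ x, Function.Injective (κ x)) ∧ (∀ x, LinearMap.range (κ x) = LinearMap.ker (𝒱.src x)) ∧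
    ∀ x c, 𝒱.tgt x (κ x c) = d x c

/-- The 2-vector bundle `C ⊕ V₀ ⇉ V₀` of a 2-term complex `∂ : C → V₀` of vector bundles:
`src (c, e) = e`, `tgt (c, e) = e + ∂ c`, the unit at `e` is `(0, e)`, and
`(c₂, e + ∂ c₁) ∘ (c₁, e) = (c₁ + c₂, e)`. -/
def ofComplex (d : SmoothBundleHom I FC C F₀ V₀) :
    TwoVectorBundle I (FC × F₀) (C ×ᵇ V₀) F₀ V₀ where
  src := SmoothBundleHom.snd
  tgt := SmoothBundleHom.snd.add (d.comp SmoothBundleHom.fst)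
  unit := SmoothBundleHom.zero.pair SmoothBundleHom.id
  comp x :=
    { toFun := fun p => (p.1.2.1 + p.1.1.1, p.1.2.2)
      map_add' := fun p q => by
        refine Prod.ext ?_ rfl
        change (p.1.2.1 + q.1.2.1) + (p.1.1.1 + q.1.1.1) = _ + _
        exact add_add_add_comm _ _ _ _
      map_smul' := fun t p => by
        refine Prod.ext ?_ rfl
        exact (smul_add t _ _).symm }
  contMDiffOn_comp := by
    let ψ : SmoothBundleHom I ((FC × F₀) × (FC × F₀)) ((C ×ᵇ V₀) ×ᵇ (C ×ᵇ V₀))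
        (FC × F₀) (C ×ᵇ V₀) :=
      SmoothBundleHom.pair
        (SmoothBundleHom.add (SmoothBundleHom.comp SmoothBundleHom.fst SmoothBundleHom.snd)
          (SmoothBundleHom.comp SmoothBundleHom.fst SmoothBundleHom.fst))
        (SmoothBundleHom.comp SmoothBundleHom.snd SmoothBundleHom.snd)
    refine ψ.contMDiff_toFun.contMDiffOn.congr fun p hp => ?_
    exact congrArg (TotalSpace.mk p.proj) (dif_pos hp)
  src_unit _ _ := rfl
  tgt_unit x e := by
    change e + d x 0 = e
    rw [map_zero, add_zero]
  src_comp _ _ _ _ := rfl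
  tgt_comp x g h H := by
    change h.2 + d x (h.1 + g.1) = g.2 + d x g.1
    have H' : g.2 = h.2 + d x h.1 := H
    rw [H', map_add, add_assoc]
  comp_unit x g := Prod.ext (zero_add g.1) rfl
  unit_comp x g := Prod.ext (add_zero g.1) rfl
  assoc x g h k H K := Prod.ext (add_assoc k.1 h.1 g.1).symm rfl

end TwoVectorBundle

end TwoVectorBundle

/-! ### Double vector bundles and VB-algebroids -/

section DoubleVectorBundle

variable {EM HM M : Type*} [NormedAddCommGroup EM] [NormedSpace ℝ EM] [TopologicalSpace HM]
  (IM : ModelWithCorners ℝ EM HM) [TopologicalSpace M] [ChartedSpace HM M] [IsManifold IM ∞ M]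
  (FA : Type*) [NormedAddCommGroup FA] [NormedSpace ℝ FA]
  (A : M → Type*) [TopologicalSpace (TotalSpace FA A)]
  [∀ x, TopologicalSpace (A x)] [∀ x, AddCommGroup (A x)] [∀ x, Module ℝ (A x)]
  [FiberBundle FA A] [VectorBundle ℝ FA A] [ContMDiffVectorBundle ∞ FA A IM]
  (FE : Type*) [NormedAddCommGroup FE] [NormedSpace ℝ FE]
  (E : M → Type*) [TopologicalSpace (TotalSpace FE E)]
  [∀ x, TopologicalSpace (E x)] [∀ x, AddCommGroup (E x)] [∀ x, Module ℝ (E x)]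
  [FiberBundle FE E] [VectorBundle ℝ FE E] [ContMDiffVectorBundle ∞ FE E IM]
  (FD : Type*) [NormedAddCommGroup FD] [NormedSpace ℝ FD]
  (D : TotalSpace FE E → Type*) [TopologicalSpace (TotalSpace FD D)]
  [∀ x, TopologicalSpace (D x)] [∀ x, AddCommGroup (D x)] [∀ x, Module ℝ (D x)]
  [FiberBundle FD D] [VectorBundle ℝ FD D]
  [ContMDiffVectorBundle ∞ FD D (IM.prod 𝓘(ℝ, FE))]
  (FD' : Type*) [NormedAddCommGroup FD'] [NormedSpace ℝ FD']
  (D' : TotalSpace FA A → Type*) [TopologicalSpace (TotalSpace FD' D')]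
  [∀ x, TopologicalSpace (D' x)] [∀ x, AddCommGroup (D' x)] [∀ x, Module ℝ (D' x)]
  [FiberBundle FD' D'] [VectorBundle ℝ FD' D']
  [ContMDiffVectorBundle ∞ FD' D' (IM.prod 𝓘(ℝ, FA))]

/-- A double vector bundle `(D; A, E; M)`. The manifold `D` is given as the total space of a vector
bundle `D → E` and as the total space of a vector bundle `D' → A`, which are identified by a
diffeomorphism `toA`. -/
structure DoubleVectorBundle where
  /-- the identification of the total spaces of the two vector bundles -/
  toA : Diffeomorph ((IM.prod 𝓘(ℝ, FE)).prod 𝓘(ℝ, FD)) ((IM.prod 𝓘(ℝ, FA)).prod 𝓘(ℝ, FD'))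
    (TotalSpace FD D) (TotalSpace FD' D') ∞
  /-- `p : D → A` is a vector bundle morphism from `D → E` to `A → M` over `p_E : E → M` -/
  linear_p : IsFibrewiseLinear (fun d : TotalSpace FD D => (toA d).proj)
    (fun e : TotalSpace FE E => e.proj)
  /-- `p_D : D → E` is a vector bundle morphism from `D → A` to `E → M` over `p_A : A → M` -/
  linear_pD : IsFibrewiseLinear (fun d : TotalSpace FD' D' => (toA.symm d).proj)
    (fun a : TotalSpace FA A => a.proj)
  /-- `+_E : D ×_E D → D` is additive for the vector bundle structures over `A ×_M A` and `A` -/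
  interchange : ∀ d₁ d₂ d₃ d₄ d₁₂ d₃₄ d₁₃ d₂₄ d : TotalSpace FD D,
    IsBundleSum d₁ d₂ d₁₂ → IsBundleSum d₃ d₄ d₃₄ →
    IsBundleSum (toA d₁) (toA d₃) (toA d₁₃) → IsBundleSum (toA d₂) (toA d₄) (toA d₂₄) →
    IsBundleSum d₁₃ d₂₄ d → IsBundleSum (toA d₁₂) (toA d₃₄) (toA d)
  /-- `+_E : D ×_E D → D` is homogeneous for the vector bundle structures over `A ×_M A`, `A` -/
  interchange_smul : ∀ (t : ℝ) (d₁ d₂ d : TotalSpace FD D), IsBundleSum d₁ d₂ d →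
    IsBundleSum (toA.symm ⟨(toA d₁).proj, t • (toA d₁).snd⟩)
      (toA.symm ⟨(toA d₂).proj, t • (toA d₂).snd⟩) (toA.symm ⟨(toA d).proj, t • (toA d).snd⟩)

namespace DoubleVectorBundle

variable {IM FA A FE E FD D FD' D'}
variable (𝒟 : DoubleVectorBundle IM FA A FE E FD D FD' D')

/-- The projection `p : D → A`. -/
def p (d : TotalSpace FD D) : TotalSpace FA A := (𝒟.toA d).proj

/-- Addition `d = d₁ +_A d₂` in the fibres of `p : D → A`. -/
def IsSumA (d₁ d₂ d : TotalSpace FD D) : Prop := IsBundleSum (𝒟.toA d₁) (𝒟.toA d₂) (𝒟.toA d)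

/-- Scalar multiplication in the fibres of `p : D → A`. -/
def smulA (t : ℝ) (d : TotalSpace FD D) : TotalSpace FD D :=
  𝒟.toA.symm ⟨(𝒟.toA d).proj, t • (𝒟.toA d).snd⟩

/-- The fibre at `e` of the kernel of the vector bundle morphism `p : D → A` over `E → M`. -/
def kernel (e : TotalSpace FE E) : Submodule ℝ (D e) where
  carrier := {x | 𝒟.p ⟨e, x⟩ = ⟨e.proj, 0⟩}
  add_mem' {x y} hx hy := by
    obtain ⟨L, hL⟩ := 𝒟.linear_p
    have key : ∀ z, 𝒟.p ⟨e, z⟩ = ⟨e.proj, 0⟩ ↔ L e z = 0 := fun z => by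
      rw [show 𝒟.p ⟨e, z⟩ = ⟨e.proj, L e z⟩ from hL e z, TotalSpace.mk_inj]
    exact (key _).2 (by rw [map_add, (key x).1 hx, (key y).1 hy, add_zero])
  zero_mem' := by
    obtain ⟨L, hL⟩ := 𝒟.linear_p
    exact (hL e 0).trans (by rw [map_zero])
  smul_mem' t x hx := by
    obtain ⟨L, hL⟩ := 𝒟.linear_p
    have key : ∀ z, 𝒟.p ⟨e, z⟩ = ⟨e.proj, 0⟩ ↔ L e z = 0 := fun z => by
      rw [show 𝒟.p ⟨e, z⟩ = ⟨e.proj, L e z⟩ from hL e z, TotalSpace.mk_inj]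
    exact (key _).2 (by rw [map_smul, (key x).1 hx, smul_zero])

/-- The core of a double vector bundle: the fibre at `m` consists of the elements of `D` that
are mapped to the zero vector `0_m` of `E` by `p_D` and to the zero vector `0_m` of `A` by `p`. -/
def Core (m : M) : Type _ := 𝒟.kernel ⟨m, 0⟩

instance (m : M) : AddCommGroup (𝒟.Core m) := inferInstanceAs (AddCommGroup (𝒟.kernel ⟨m, 0⟩))
instance (m : M) : Module ℝ (𝒟.Core m) := inferInstanceAs (Module ℝ (𝒟.kernel ⟨m, 0⟩))
instance (m : M) : TopologicalSpace (𝒟.Core m) :=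
  inferInstanceAs (TopologicalSpace (𝒟.kernel ⟨m, 0⟩))

/-- The inclusion of the core in `D`. -/
def coreIncl {m : M} (c : 𝒟.Core m) : TotalSpace FD D := ⟨⟨m, 0⟩, c.1⟩

/-- A smooth section `σ` of `D → E` is a core section if `σ(e) = 0_e +_A c(m)` for `e ∈ E_m`, with a
smooth section `c` of the core. -/
def IsCoreSection (σ : Cₛ^∞⟮IM.prod 𝓘(ℝ, FE); FD, D⟯) : Prop :=
  ∃ c : ∀ m, 𝒟.Core m,
    ContMDiff IM ((IM.prod 𝓘(ℝ, FE)).prod 𝓘(ℝ, FD)) ∞ (fun m => 𝒟.coreIncl (c m)) ∧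
    ∀ e : TotalSpace FE E, 𝒟.IsSumA ⟨e, 0⟩ (𝒟.coreIncl (c e.proj)) ⟨e, σ e⟩

/-- A smooth section of `D → E` is linear if it is a vector bundle morphism from `E → M` to `D → A`
that covers a smooth section of `A → M`. -/
def IsLinearSection (σ : Cₛ^∞⟮IM.prod 𝓘(ℝ, FE); FD, D⟯) : Prop :=
  ∃ a : Cₛ^∞⟮IM; FA, A⟯,
    IsFibrewiseLinear (fun e : TotalSpace FE E => 𝒟.toA ⟨e, σ e⟩)
      (fun m => (⟨m, a m⟩ : TotalSpace FA A))

/-- A smooth vector bundle structure on the core, for which the inclusion into `D` is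
smooth. (It is unique.) -/
structure CoreBundle where
  /-- the rank of the core -/
  rank : ℕ
  [topologicalSpace : TopologicalSpace (TotalSpace (EuclideanSpace ℝ (Fin rank)) 𝒟.Core)]
  [fiberBundle : FiberBundle (EuclideanSpace ℝ (Fin rank)) 𝒟.Core]
  [vectorBundle : VectorBundle ℝ (EuclideanSpace ℝ (Fin rank)) 𝒟.Core]
  [contMDiffVectorBundle : ContMDiffVectorBundle ∞ (EuclideanSpace ℝ (Fin rank)) 𝒟.Core IM]
  contMDiff_coreIncl : ContMDiff (IM.prod 𝓘(ℝ, EuclideanSpace ℝ (Fin rank)))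
    ((IM.prod 𝓘(ℝ, FE)).prod 𝓘(ℝ, FD)) ∞
    (fun c : TotalSpace (EuclideanSpace ℝ (Fin rank)) 𝒟.Core => 𝒟.coreIncl c.snd)

end DoubleVectorBundle

namespace DoubleVectorBundle.CoreBundle

variable {IM FA A FE E FD D FD' D'}
variable {𝒟 : DoubleVectorBundle IM FA A FE E FD D FD' D'} (𝒞 : 𝒟.CoreBundle)

/-- The model fibre of the core. -/
abbrev Model : Type := EuclideanSpace ℝ (Fin 𝒞.rank)

/-- The core, with the vector bundle structure `𝒞`. -/
def Fibre (_𝒞 : 𝒟.CoreBundle) (m : M) : Type _ := 𝒟.Core m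

instance (m : M) : AddCommGroup (𝒞.Fibre m) := inferInstanceAs (AddCommGroup (𝒟.Core m))
instance (m : M) : Module ℝ (𝒞.Fibre m) := inferInstanceAs (Module ℝ (𝒟.Core m))
instance (m : M) : TopologicalSpace (𝒞.Fibre m) := inferInstanceAs (TopologicalSpace (𝒟.Core m))
instance : TopologicalSpace (TotalSpace 𝒞.Model 𝒞.Fibre) := 𝒞.topologicalSpace
instance : FiberBundle 𝒞.Model 𝒞.Fibre := 𝒞.fiberBundle
instance : VectorBundle ℝ 𝒞.Model 𝒞.Fibre := 𝒞.vectorBundle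
instance : ContMDiffVectorBundle ∞ 𝒞.Model 𝒞.Fibre IM := 𝒞.contMDiffVectorBundle

variable (IM FE E) in
/-- The bundle projection `p_E : E → M` as a smooth map. -/
def _root_.smoothProj : C^∞⟮IM.prod 𝓘(ℝ, FE), TotalSpace FE E; IM, M⟯ :=
  ⟨fun e => e.proj, contMDiff_proj E⟩

/-- The pull-back bundle `p_E^* C` over `E`. -/
abbrev Pullback : TotalSpace FE E → Type _ := (⇑(smoothProj IM FE E)) *ᵖ 𝒞.Fibre

instance (e : TotalSpace FE E) : AddCommGroup (𝒞.Pullback e) :=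
  inferInstanceAs (AddCommGroup (𝒞.Fibre e.proj))

end DoubleVectorBundle.CoreBundle

variable {FE E} in
/-- The vertical lift of `v ∈ E_m` at `e ∈ E_m`: the velocity at `t = 0` of `t ↦ e + t v`. -/
def verticalLift {m : M} (e v : E m) : TangentBundle (IM.prod 𝓘(ℝ, FE)) (TotalSpace FE E) :=
  tangentMap 𝓘(ℝ, ℝ) (IM.prod 𝓘(ℝ, FE)) (fun t : ℝ => (⟨m, e + t • v⟩ : TotalSpace FE E)) ⟨0, 1⟩

variable {FE E} in
/-- Addition `v = v₁ + v₂` in the fibres of the vector bundle `TE → TM`, which is the tangent map of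
the addition `E ×_M E → E`. -/
def IsTangentSum (v₁ v₂ v : TangentBundle (IM.prod 𝓘(ℝ, FE)) (TotalSpace FE E)) : Prop :=
  ∃ w : TangentBundle (IM.prod 𝓘(ℝ, FE × FE)) (TotalSpace (FE × FE) (E ×ᵇ E)),
    tangentMap (IM.prod 𝓘(ℝ, FE × FE)) (IM.prod 𝓘(ℝ, FE))
      (fun u => (⟨u.proj, u.snd.1⟩ : TotalSpace FE E)) w = v₁ ∧
    tangentMap (IM.prod 𝓘(ℝ, FE × FE)) (IM.prod 𝓘(ℝ, FE))
      (fun u => (⟨u.proj, u.snd.2⟩ : TotalSpace FE E)) w = v₂ ∧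
    tangentMap (IM.prod 𝓘(ℝ, FE × FE)) (IM.prod 𝓘(ℝ, FE))
      (fun u => (⟨u.proj, u.snd.1 + u.snd.2⟩ : TotalSpace FE E)) w = v

/-- A VB-algebroid `(D; A, E; M)`: a double vector bundle with Lie algebroid structures on `D → E`
and `A → M`, such that the anchor `ρ_D : D → TE` is a bundle morphism (from `D → A` to `TE → TM`)
over `ρ_A : A → TM` and the bracket of `D → E` satisfies the conditions on linear and core
sections. -/
structure VBAlgebroid extends DoubleVectorBundle IM FA A FE E FD D FD' D' where
  /-- the Lie algebroid `D → E` -/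
  algD : LieAlgebroid (IM.prod 𝓘(ℝ, FE)) FD D
  /-- the Lie algebroid `A → M` -/
  algA : LieAlgebroid IM FA A
  anchor_proj : ∀ d : TotalSpace FD D,
    tangentMap (IM.prod 𝓘(ℝ, FE)) IM (fun e : TotalSpace FE E => e.proj) (algD.anchorMap d) =
      algA.anchorMap (toDoubleVectorBundle.p d)
  anchor_add : ∀ d₁ d₂ d : TotalSpace FD D, toDoubleVectorBundle.IsSumA d₁ d₂ d →
    IsTangentSum IM (algD.anchorMap d₁) (algD.anchorMap d₂) (algD.anchorMap d)
  anchor_smul : ∀ (t : ℝ) (d : TotalSpace FD D),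
    algD.anchorMap (toDoubleVectorBundle.smulA t d) =
      tangentMap (IM.prod 𝓘(ℝ, FE)) (IM.prod 𝓘(ℝ, FE))
        (fun e : TotalSpace FE E => (⟨e.proj, t • e.snd⟩ : TotalSpace FE E)) (algD.anchorMap d)
  bracket_linear_linear : ∀ σ τ, toDoubleVectorBundle.IsLinearSection σ →
    toDoubleVectorBundle.IsLinearSection τ →
    toDoubleVectorBundle.IsLinearSection (algD.bracket σ τ)
  bracket_linear_core : ∀ σ τ, toDoubleVectorBundle.IsLinearSection σ →
    toDoubleVectorBundle.IsCoreSection τ → toDoubleVectorBundle.IsCoreSection (algD.bracket σ τ)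
  bracket_core_core : ∀ σ τ, toDoubleVectorBundle.IsCoreSection σ →
    toDoubleVectorBundle.IsCoreSection τ → algD.bracket σ τ = 0

namespace VBAlgebroid

variable {IM FA A FE E FD D FD' D'}
variable (𝒟 : VBAlgebroid IM FA A FE E FD D FD' D') (𝒞 : 𝒟.CoreBundle)

/-- `∂ : C → E` is the core anchor: `ρ_D(c)`, a vertical tangent vector of `E` at `0_m`, is the
vertical lift of `∂ c ∈ E_m`. -/
def IsCoreAnchor (d : SmoothBundleHom IM 𝒞.Model 𝒞.Fibre FE E) : Prop :=
  ∀ (m : M) (c : 𝒞.Fibre m),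
    𝒟.algD.anchorMap (𝒟.coreIncl c) = verticalLift IM (0 : E m) (d m c)

/-- `𝒦` is the Lie algebroid structure on `p_E^* C → E` of the kernel of the extension `p : D → A`:
the canonical map `(c, e) ↦ 0_e +_A c` is an isomorphism of the vector bundle `p_E^* C` onto the
kernel of `p`, and it is a Lie algebroid morphism to `D`. -/
def IsKernelAlgebroid
    (𝒦 : LieAlgebroid (IM.prod 𝓘(ℝ, FE)) 𝒞.Model 𝒞.Pullback) : Prop :=
  ∃ j : SmoothBundleHom (IM.prod 𝓘(ℝ, FE)) 𝒞.Model 𝒞.Pullback FD D,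
    (∀ (e : TotalSpace FE E) (c : 𝒞.Pullback e),
      𝒟.IsSumA ⟨e, 0⟩ (𝒟.coreIncl (show 𝒟.Core e.proj from c)) ⟨e, j e c⟩) ∧
    (∀ e, Function.Injective (j e)) ∧ (∀ e, LinearMap.range (j e) = 𝒟.kernel e) ∧
    𝒦.IsMorphism 𝒟.algD j

end VBAlgebroid

end DoubleVectorBundle

end

/-! The map (c, e) ↦ 0_e +_A c embeds p_E^*C in D with image ker p. Since p_D is linear on the
fibres of D → A, the sum lies in D_e (`exists_isSumA`), and an element of ker p over e differs from
0_e, in the sense of D → A, by an element of the core (`exists_core_of_mem_kernel`). The interchange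
law makes this map additive in c, and continuity makes it linear (`addCore_smul`). The core is a
smooth bundle because it is the kernel of p restricted to the zero section of E, where p is
surjective (`exists_kernelBundle`).

Two facts determine the Lie algebroid on the kernel. Since ρ_D is additive over TE → TM, the anchor
of 0_e +_A c is the vertical lift of ∂c at e (`anchor_inclusion`). Pull-backs of sections of C are
core sections, hence they commute, and near each point they generate the sections of p_E^*C over the
functions on E. A skew-symmetric expression that is tensorial at a point and vanishes on pull-backs
is therefore zero (`tensor_eq_zero`). Applied to p of a bracket, this shows that ker p is a
subalgebroid: it is the action algebroid of C acting on E by translations along ∂.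

Accordingly C ⊕ E ⇉ E is the action groupoid of the bundle of additive groups C. Its source fibres
are homeomorphic to vector spaces, hence simply connected. The right-invariant field of a section X
has the vertical value (X(e + ∂c), 0) at (c, e) (`mfderivWithin_mul_unitVertical`). The bracket of
two such fields minus the field of the bracket is again tensorial, because the derivative of the
target on these fields is the anchor. On pull-backs of sections of C the fields are constant along
the fibres and commute (`mlieBracket_vertical`), as do the sections, so a second use of
`tensor_eq_zero` gives the integration. -/

noncomputable section

/-! ### Smooth maps into total spaces of vector bundles -/

section FibreAdd

variable {B F : Type*} {V : B → Type*} [∀ x, AddCommGroup (V x)]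

open Classical in
/-- Fibrewise addition on a total space as a total function: `u + v` over the base point of `u`,
and `u` if `v` lies over another point. -/
def fibreAdd (u v : TotalSpace F V) : TotalSpace F V :=
  ⟨u.proj, u.snd + if h : v.proj = u.proj then h ▸ v.snd else 0⟩

@[simp] lemma fibreAdd_mk (x : B) (v w : V x) :
    fibreAdd (⟨x, v⟩ : TotalSpace F V) ⟨x, w⟩ = ⟨x, v + w⟩ := by
  simp [fibreAdd]

end FibreAdd

section TotalSpaceMaps

set_option linter.unusedSectionVars false

variable {EB HB B : Type*} [NormedAddCommGroup EB] [NormedSpace ℝ EB] [TopologicalSpace HB]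
  {I : ModelWithCorners ℝ EB HB} [TopologicalSpace B] [ChartedSpace HB B]
  {F₁ : Type*} [NormedAddCommGroup F₁] [NormedSpace ℝ F₁]
  {V₁ : B → Type*} [TopologicalSpace (TotalSpace F₁ V₁)]
  [∀ x, TopologicalSpace (V₁ x)] [∀ x, AddCommGroup (V₁ x)] [∀ x, Module ℝ (V₁ x)]
  [FiberBundle F₁ V₁] [VectorBundle ℝ F₁ V₁]
  {F₂ : Type*} [NormedAddCommGroup F₂] [NormedSpace ℝ F₂]
  {V₂ : B → Type*} [TopologicalSpace (TotalSpace F₂ V₂)]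
  [∀ x, TopologicalSpace (V₂ x)] [∀ x, AddCommGroup (V₂ x)] [∀ x, Module ℝ (V₂ x)]
  [FiberBundle F₂ V₂] [VectorBundle ℝ F₂ V₂]
  {EN HN N : Type*} [NormedAddCommGroup EN] [NormedSpace ℝ EN] [TopologicalSpace HN]
  {IN : ModelWithCorners ℝ EN HN} [TopologicalSpace N] [ChartedSpace HN N]

/-- A map into the continuous linear maps from a finite-dimensional space is smooth if it is so
pointwise. -/
lemma contMDiffOn_clm_of_apply {F G : Type*} [NormedAddCommGroup F] [NormedSpace ℝ F]
    [NormedAddCommGroup G] [NormedSpace ℝ G] [FiniteDimensional ℝ F] {f : N → F →L[ℝ] G} {s : Set N}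
    (h : ∀ v, ContMDiffOn IN 𝓘(ℝ, G) ∞ (fun n => f n v) s) :
    ContMDiffOn IN 𝓘(ℝ, F →L[ℝ] G) ∞ f s := by
  let b := Module.finBasis ℝ F
  have key : ∀ n, f n = ∑ i, ContinuousLinearMap.smulRightL ℝ F G
      (LinearMap.toContinuousLinearMap (b.coord i)) (f n (b i)) := by
    intro n
    ext v
    conv_lhs => rw [← b.sum_repr v, map_sum]
    simp
  rw [show f = _ from funext key]
  refine contMDiffOn_finsetSum fun i _ => ?_
  exact (ContinuousLinearMap.contMDiff _).comp_contMDiffOn (h (b i))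

/-- In a trivialization fibrewise addition is addition in `F₁`. The common base point is required on
`s` only, as multiplication of arrows is to be smooth just on the composable pairs. -/
lemma ContMDiffWithinAt.fibreAdd [ContMDiffVectorBundle ∞ F₁ V₁ I] {f g : N → TotalSpace F₁ V₁}
    {s : Set N} {n₀ : N}
    (hf : ContMDiffWithinAt IN (I.prod 𝓘(ℝ, F₁)) ∞ f s n₀)
    (hg : ContMDiffWithinAt IN (I.prod 𝓘(ℝ, F₁)) ∞ g s n₀)
    (h : ∀ n ∈ s, (g n).proj = (f n).proj) (h₀ : n₀ ∈ s) :
    ContMDiffWithinAt IN (I.prod 𝓘(ℝ, F₁)) ∞ (fun n => fibreAdd (f n) (g n)) s n₀ := by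
  have hf' := contMDiffWithinAt_totalSpace.1 hf
  have hg' := contMDiffWithinAt_totalSpace.1 hg
  refine contMDiffWithinAt_totalSpace.2 ⟨hf'.1, ?_⟩
  rw [h n₀ h₀] at hg'
  have key : ∀ n ∈ s, (f n).proj ∈ (trivializationAt F₁ V₁ (f n₀).proj).baseSet →
      (trivializationAt F₁ V₁ (f n₀).proj (_root_.fibreAdd (f n) (g n))).2 =
      (trivializationAt F₁ V₁ (f n₀).proj (f n)).2 +
        (trivializationAt F₁ V₁ (f n₀).proj (g n)).2 := by
    intro n hn hb
    have hgn := h n hn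
    generalize f n = u at hb hgn ⊢
    generalize g n = v at hgn ⊢
    obtain ⟨x, u⟩ := u
    obtain ⟨y, v⟩ := v
    obtain rfl : y = x := hgn
    rw [fibreAdd_mk]
    exact ((trivializationAt F₁ V₁ (f n₀).proj).linear ℝ hb).1 _ _
  refine (hf'.2.add hg'.2).congr_of_eventuallyEq ?_ (key _ h₀ (mem_baseSet_trivializationAt _ _ _))
  have hb : ∀ᶠ n in 𝓝[s] n₀, (f n).proj ∈ (trivializationAt F₁ V₁ (f n₀).proj).baseSet :=
    hf'.1.continuousWithinAt.eventually
        ((trivializationAt F₁ V₁ (f n₀).proj).open_baseSet.mem_nhds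
          (mem_baseSet_trivializationAt F₁ V₁ (f n₀).proj))
  filter_upwards [hb, self_mem_nhdsWithin] with n hn hs using key n hs hn

lemma ContMDiff.fibreAdd [ContMDiffVectorBundle ∞ F₁ V₁ I] {f g : N → TotalSpace F₁ V₁}
    (hf : ContMDiff IN (I.prod 𝓘(ℝ, F₁)) ∞ f) (hg : ContMDiff IN (I.prod 𝓘(ℝ, F₁)) ∞ g)
    (h : ∀ n, (g n).proj = (f n).proj) :
    ContMDiff IN (I.prod 𝓘(ℝ, F₁)) ∞ (fun n => fibreAdd (f n) (g n)) := fun n =>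
  contMDiffWithinAt_univ.1 <| (hf n).contMDiffWithinAt.fibreAdd (hg n).contMDiffWithinAt
    (fun n _ => h n) (Set.mem_univ n)

lemma ContMDiff.fibreSMul [ContMDiffVectorBundle ∞ F₁ V₁ I] {t : N → ℝ} {f : N → TotalSpace F₁ V₁}
    (ht : ContMDiff IN 𝓘(ℝ, ℝ) ∞ t) (hf : ContMDiff IN (I.prod 𝓘(ℝ, F₁)) ∞ f) :
    ContMDiff IN (I.prod 𝓘(ℝ, F₁)) ∞
      (fun n => (⟨(f n).proj, t n • (f n).snd⟩ : TotalSpace F₁ V₁)) := fun n₀ => by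
  have hf' := contMDiffAt_totalSpace.1 (hf n₀)
  refine contMDiffAt_totalSpace.2 ⟨hf'.1, ?_⟩
  refine ((ht n₀).smul hf'.2).congr_of_eventuallyEq ?_
  have hb : ∀ᶠ n in 𝓝 n₀, (f n).proj ∈ (trivializationAt F₁ V₁ (f n₀).proj).baseSet :=
    hf'.1.continuousAt.eventually
        ((trivializationAt F₁ V₁ (f n₀).proj).open_baseSet.mem_nhds
          (mem_baseSet_trivializationAt F₁ V₁ (f n₀).proj))
  filter_upwards [hb] with n hn
  exact ((trivializationAt F₁ V₁ (f n₀).proj).linear ℝ hn).2 _ _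

lemma contMDiffOn_trivializationAt_symm [ContMDiffVectorBundle ∞ F₁ V₁ I] (x₀ : B) (v : F₁) :
    ContMDiffOn I (I.prod 𝓘(ℝ, F₁)) ∞
      (fun x => (⟨x, (trivializationAt F₁ V₁ x₀).symm x v⟩ : TotalSpace F₁ V₁))
      (trivializationAt F₁ V₁ x₀).baseSet := by
  have h₀ : ContMDiffOn I (I.prod 𝓘(ℝ, F₁)) ∞ (fun x : B => (x, v))
      (trivializationAt F₁ V₁ x₀).baseSet := contMDiffOn_id.prodMk contMDiffOn_const
  refine ((trivializationAt F₁ V₁ x₀).contMDiffOn_symm.comp h₀ ?_).congr ?_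
  · intro x hx
    exact (Trivialization.mem_target _).2 hx
  · intro x hx
    exact (Trivialization.mk_symm _ hx v)

/-! ### Vector bundle morphisms in local coordinates. -/

namespace SmoothBundleHom

/-- A vector bundle morphism as a map of total spaces. -/
def toMap (φ : SmoothBundleHom I F₁ V₁ F₂ V₂) (v : TotalSpace F₁ V₁) : TotalSpace F₂ V₂ :=
  ⟨v.proj, φ v.proj v.snd⟩

/-- A vector bundle morphism in local trivializations. -/
def inCoord [FiniteDimensional ℝ F₁] (φ : SmoothBundleHom I F₁ V₁ F₂ V₂) (x₀ x : B) :
    F₁ →L[ℝ] F₂ :=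
  LinearMap.toContinuousLinearMap ((trivializationAt F₂ V₂ x₀).linearMapAt ℝ x ∘ₗ φ x ∘ₗ
    (trivializationAt F₁ V₁ x₀).symmₗ ℝ x)

lemma inCoord_apply [FiniteDimensional ℝ F₁] (φ : SmoothBundleHom I F₁ V₁ F₂ V₂) {x₀ x : B}
    (h₁ : x ∈ (trivializationAt F₁ V₁ x₀).baseSet)
    (h₂ : x ∈ (trivializationAt F₂ V₂ x₀).baseSet) (v : F₁) :
    φ.inCoord x₀ x v =
      (trivializationAt F₂ V₂ x₀ ⟨x, φ x ((trivializationAt F₁ V₁ x₀).symm x v)⟩).2 := by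
  simp only [inCoord, LinearMap.coe_toContinuousLinearMap', LinearMap.comp_apply,
    Trivialization.linearMapAt_apply, h₂, if_true]
  rw [Trivialization.coe_symmₗ _ h₁]

lemma inCoord_trivialization [FiniteDimensional ℝ F₁] (φ : SmoothBundleHom I F₁ V₁ F₂ V₂) {x₀ x : B}
    (h₁ : x ∈ (trivializationAt F₁ V₁ x₀).baseSet)
    (h₂ : x ∈ (trivializationAt F₂ V₂ x₀).baseSet) (v : V₁ x) :
    φ.inCoord x₀ x (trivializationAt F₁ V₁ x₀ ⟨x, v⟩).2 =
      (trivializationAt F₂ V₂ x₀ ⟨x, φ x v⟩).2 := by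
  rw [inCoord_apply φ h₁ h₂, Trivialization.symm_apply_apply_mk _ h₁]

/-- By finite dimension it suffices to fix `v`, and then φ is applied to the smooth local section
with constant coordinate `v`. -/
lemma contMDiffOn_inCoord [FiniteDimensional ℝ F₁] [ContMDiffVectorBundle ∞ F₁ V₁ I]
    [ContMDiffVectorBundle ∞ F₂ V₂ I] (φ : SmoothBundleHom I F₁ V₁ F₂ V₂) (x₀ : B) :
    ContMDiffOn I 𝓘(ℝ, F₁ →L[ℝ] F₂) ∞ (φ.inCoord x₀)
      ((trivializationAt F₁ V₁ x₀).baseSet ∩ (trivializationAt F₂ V₂ x₀).baseSet) := by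
  refine contMDiffOn_clm_of_apply fun v => ?_
  have h₁ := (contMDiffOn_trivializationAt_symm (I := I) (V₁ := V₁) x₀ v).mono
    (Set.inter_subset_left (t := (trivializationAt F₂ V₂ x₀).baseSet))
  have h₂ := φ.contMDiff_toFun.comp_contMDiffOn h₁
  rw [Trivialization.contMDiffOn_iff (e := trivializationAt F₂ V₂ x₀)] at h₂
  · refine h₂.2.congr ?_
    intro x hx
    exact φ.inCoord_apply hx.1 hx.2 v
  · intro x hx
    exact (Trivialization.mem_source _).2 hx.2

/-- A map into a vector bundle is smooth if its composition with a fibrewise injective vector bundle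
morphism is so. -/
theorem contMDiff_of_injective [FiniteDimensional ℝ F₁] [FiniteDimensional ℝ F₂]
    [ContMDiffVectorBundle ∞ F₁ V₁ I]
    [ContMDiffVectorBundle ∞ F₂ V₂ I] (φ : SmoothBundleHom I F₁ V₁ F₂ V₂)
    (hφ : ∀ x, Function.Injective (φ x)) {f : N → TotalSpace F₁ V₁}
    (hf : ContMDiff IN (I.prod 𝓘(ℝ, F₂)) ∞ (fun n => φ.toMap (f n))) :
    ContMDiff IN (I.prod 𝓘(ℝ, F₁)) ∞ f := by
  intro n₀
  have hf' := contMDiffAt_totalSpace.1 (hf n₀)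
  refine contMDiffAt_totalSpace.2 ⟨hf'.1, ?_⟩
  set x₀ : B := (f n₀).proj with hx₀
  set e₁ := trivializationAt F₁ V₁ x₀
  set e₂ := trivializationAt F₂ V₂ x₀
  have m₁ : x₀ ∈ e₁.baseSet := mem_baseSet_trivializationAt _ _ _
  have m₂ : x₀ ∈ e₂.baseSet := mem_baseSet_trivializationAt _ _ _
  have inj : Function.Injective (φ.inCoord x₀ x₀) := by
    intro v w h
    rw [φ.inCoord_apply m₁ m₂, φ.inCoord_apply m₁ m₂] at h
    have h' := (e₂.continuousLinearEquivAt ℝ x₀ m₂).injective (a₁ := φ x₀ (e₁.symm x₀ v))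
      (a₂ := φ x₀ (e₁.symm x₀ w)) h
    exact (e₁.continuousLinearEquivAt ℝ x₀ m₁).symm.injective (hφ _ h')
  -- `R` inverts on the left the matrix of φ at `x₀` only. The product `Q` of `R` with the matrix at
  -- a nearby point is the identity at `n₀`, hence invertible close by, and `Q⁻¹ R` recovers the
  -- `F₁`-coordinate smoothly from the `F₂`-coordinate.
  obtain ⟨R, hR⟩ := LinearMap.exists_leftInverse_of_injective
    (φ.inCoord x₀ x₀).toLinearMap (LinearMap.ker_eq_bot.2 inj)
  let R' := LinearMap.toContinuousLinearMap R
  let Q : N → F₁ →L[ℝ] F₁ := fun n => R' ∘L φ.inCoord x₀ (f n).proj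
  have hU : ∀ᶠ n in 𝓝 n₀, (f n).proj ∈ e₁.baseSet ∩ e₂.baseSet :=
    hf'.1.continuousAt.eventually ((e₁.open_baseSet.inter e₂.open_baseSet).mem_nhds ⟨m₁, m₂⟩)
  have hA : ContMDiffAt IN 𝓘(ℝ, F₁ →L[ℝ] F₂) ∞ (fun n => φ.inCoord x₀ (f n).proj) n₀ :=
    ContMDiffAt.comp (g := φ.inCoord x₀) (f := fun n => (f n).proj) n₀
      ((φ.contMDiffOn_inCoord x₀).contMDiffAt
        ((e₁.open_baseSet.inter e₂.open_baseSet).mem_nhds ⟨m₁, m₂⟩)) hf'.1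
  have hQ : ContMDiffAt IN 𝓘(ℝ, F₁ →L[ℝ] F₁) ∞ Q n₀ :=
    (contMDiffAt_const (c := R')).clm_comp hA
  have hQ₀ : Q n₀ = ContinuousLinearEquiv.refl ℝ F₁ := by
    ext v
    exact LinearMap.congr_fun hR v
  have hinv : ContMDiffAt IN 𝓘(ℝ, F₁ →L[ℝ] F₁) ∞ (fun n => (Q n).inverse) n₀ := by
    have hi : ContDiffAt ℝ ∞ (ContinuousLinearMap.inverse : (F₁ →L[ℝ] F₁) → F₁ →L[ℝ] F₁)
        (Q n₀) := by
      rw [hQ₀]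
      exact contDiffAt_map_inverse _
    exact hi.contMDiffAt.comp n₀ hQ
  have hw : ContMDiffAt IN 𝓘(ℝ, F₂) ∞ (fun n => (e₂ (φ.toMap (f n))).2) n₀ := hf'.2
  have hRw : ContMDiffAt IN 𝓘(ℝ, F₁) ∞ (fun n => R' (e₂ (φ.toMap (f n))).2) n₀ :=
    R'.contMDiff.contMDiffAt.comp n₀ hw
  refine (hinv.clm_apply hRw).congr_of_eventuallyEq ?_
  have hI : ∀ᶠ n in 𝓝 n₀, Q n ∈ Set.range ((↑) : (F₁ ≃L[ℝ] F₁) → F₁ →L[ℝ] F₁) := by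
    refine hQ.continuousAt.eventually ?_
    rw [hQ₀]
    exact ContinuousLinearEquiv.nhds _
  filter_upwards [hU, hI] with n hn ⟨q, hq⟩
  have : R' (e₂ (φ.toMap (f n))).2 = Q n (e₁ (f n)).2 := by
    change _ = R' (φ.inCoord x₀ (f n).proj (e₁ ⟨(f n).proj, (f n).snd⟩).2)
    rw [φ.inCoord_trivialization hn.1 hn.2]
    rfl
  rw [this, ← hq, ContinuousLinearMap.inverse_equiv]
  exact (q.symm_apply_apply _).symm

end SmoothBundleHom

variable {EB' HB' B' : Type*} [NormedAddCommGroup EB'] [NormedSpace ℝ EB'] [TopologicalSpace HB']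
  {I' : ModelWithCorners ℝ EB' HB'} [TopologicalSpace B'] [ChartedSpace HB' B']

/-- The trivializations of the pull-back are those of `V₁`, so the fibre coordinates on both sides
coincide. -/
lemma contMDiff_pullback_iff (p : C^∞⟮I', B'; I, B⟯) {f : N → TotalSpace F₁ (p *ᵖ V₁)} :
    ContMDiff IN (I'.prod 𝓘(ℝ, F₁)) ∞ f ↔
      ContMDiff IN I' ∞ (fun n => (f n).proj) ∧
      ContMDiff IN (I.prod 𝓘(ℝ, F₁)) ∞
        (fun n => (⟨p (f n).proj, (f n).snd⟩ : TotalSpace F₁ V₁)) := by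
  constructor
  · intro h
    refine ⟨fun n => (contMDiffAt_totalSpace.1 (h n)).1, fun n => contMDiffAt_totalSpace.2 ⟨?_, ?_⟩⟩
    · exact (p.contMDiff _).comp n (contMDiffAt_totalSpace.1 (h n)).1
    · exact (contMDiffAt_totalSpace.1 (h n)).2
  · rintro ⟨h₁, h₂⟩ n
    exact contMDiffAt_totalSpace.2 ⟨h₁ n, (contMDiffAt_totalSpace.1 (h₂ n)).2⟩

end TotalSpaceMaps

/-! ### Vertical tangent vectors of vector bundles -/

section VerticalLift

set_option linter.unusedSectionVars false

variable {EB HB B : Type*} [NormedAddCommGroup EB] [NormedSpace ℝ EB] [TopologicalSpace HB]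
  {I : ModelWithCorners ℝ EB HB} [TopologicalSpace B] [ChartedSpace HB B] [IsManifold I ∞ B]
  {F : Type*} [NormedAddCommGroup F] [NormedSpace ℝ F]
  {V : B → Type*} [TopologicalSpace (TotalSpace F V)]
  [∀ x, TopologicalSpace (V x)] [∀ x, AddCommGroup (V x)] [∀ x, Module ℝ (V x)]
  [FiberBundle F V] [VectorBundle ℝ F V] [ContMDiffVectorBundle ∞ F V I]
  {F₂ : Type*} [NormedAddCommGroup F₂] [NormedSpace ℝ F₂]
  {V₂ : B → Type*} [TopologicalSpace (TotalSpace F₂ V₂)]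
  [∀ x, TopologicalSpace (V₂ x)] [∀ x, AddCommGroup (V₂ x)] [∀ x, Module ℝ (V₂ x)]
  [FiberBundle F₂ V₂] [VectorBundle ℝ F₂ V₂] [ContMDiffVectorBundle ∞ F₂ V₂ I]
  {EN HN N : Type*} [NormedAddCommGroup EN] [NormedSpace ℝ EN] [TopologicalSpace HN]
  {IN : ModelWithCorners ℝ EN HN} [TopologicalSpace N] [ChartedSpace HN N]

/-- All tangent spaces are definitionally `EN`, so the same `u` is a tangent vector at both points.
-/
lemma tangentBundle_mk_congr {y y' : N} (h : y = y') (u : EN) :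
    (⟨y, u⟩ : TangentBundle IN N) = ⟨y', u⟩ := by
  subst h
  rfl

lemma tangentBundle_trivializationAt_snd [IsManifold IN 1 N] {y₀ y : N}
    (hy : y ∈ (chartAt HN y₀).source) (u : TangentSpace IN y) :
    (trivializationAt EN (TangentSpace IN) y₀ (⟨y, u⟩ : TangentBundle IN N)).2 =
      mfderiv IN 𝓘(ℝ, EN) (extChartAt IN y₀) y u := by
  have hb : y ∈ (trivializationAt EN (TangentSpace IN) y₀).baseSet := by
    rwa [TangentBundle.trivializationAt_baseSet]
  have h₁ := congrArg (fun L : EN →L[ℝ] EN => L u)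
    (TangentBundle.continuousLinearMapAt_trivializationAt (𝕜 := ℝ) (I := IN) hy)
  have h₂ : (trivializationAt EN (TangentSpace IN) y₀).continuousLinearMapAt ℝ y u =
      (trivializationAt EN (TangentSpace IN) y₀ (⟨y, u⟩ : TangentBundle IN N)).2 := by
    rw [Trivialization.continuousLinearMapAt_apply, Trivialization.linearMapAt_apply, if_pos hb]
  exact h₂.symm.trans h₁

lemma mfderiv_extChartAt_injective [IsManifold IN 1 N] {y₀ y : N}
    (hy : y ∈ (chartAt HN y₀).source) :
    Function.Injective (mfderiv IN 𝓘(ℝ, EN) (extChartAt IN y₀) y) := by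
  obtain ⟨L, hL⟩ := isInvertible_mfderiv_extChartAt (I := IN) (x := y₀) (y := y)
    (by rwa [extChartAt_source])
  rw [← hL]
  exact L.injective

lemma mem_chart_source_totalSpace {v₀ v : TotalSpace F V}
    (h₁ : v.proj ∈ (chartAt HB v₀.proj).source)
    (h₂ : v.proj ∈ (trivializationAt F V v₀.proj).baseSet) :
    v ∈ (chartAt (ModelProd HB F) v₀).source := by
  rw [FiberBundle.chartedSpace_chartAt]
  simp only [mfld_simps]
  refine ⟨(Trivialization.mem_source _).2 h₂, ?_⟩
  rwa [Trivialization.coe_fst' _ h₂]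

lemma mem_of_mem_chart_source_totalSpace {v₀ v : TotalSpace F V}
    (h : v ∈ (chartAt (ModelProd HB F) v₀).source) :
    v.proj ∈ (chartAt HB v₀.proj).source ∧ v.proj ∈ (trivializationAt F V v₀.proj).baseSet := by
  rw [FiberBundle.chartedSpace_chartAt] at h
  simp only [mfld_simps] at h
  have h₁ := (Trivialization.mem_source _).1 h.1
  refine ⟨?_, h₁⟩
  have := h.2
  rwa [Trivialization.coe_fst' _ h₁] at this

/-- The chart of a total space combines a chart of the base with a trivialization; vertical vectors
are computed through this form. -/
lemma extChartAt_totalSpace_apply {v₀ v : TotalSpace F V}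
    (h₂ : v.proj ∈ (trivializationAt F V v₀.proj).baseSet) :
    extChartAt (I.prod 𝓘(ℝ, F)) v₀ v =
      (extChartAt I v₀.proj v.proj, (trivializationAt F V v₀.proj v).2) := by
  rw [FiberBundle.extChartAt]
  simp only [PartialEquiv.coe_trans, Function.comp_apply, PartialEquiv.prod_coe,
    PartialEquiv.refl_coe, id]
  congr 2
  exact Trivialization.coe_fst' _ h₂

lemma contMDiff_line (x : B) (v w : V x) :
    ContMDiff 𝓘(ℝ, ℝ) (I.prod 𝓘(ℝ, F)) ∞ (fun t : ℝ => (⟨x, v + t • w⟩ : TotalSpace F V)) := by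
  have h₁ : ContMDiff 𝓘(ℝ, ℝ) (I.prod 𝓘(ℝ, F)) ∞ (fun t : ℝ => (⟨x, t • w⟩ : TotalSpace F V)) :=
    contMDiff_id.fibreSMul (f := fun _ => ⟨x, w⟩) contMDiff_const
  have h₂ := ContMDiff.fibreAdd (f := fun _ : ℝ => (⟨x, v⟩ : TotalSpace F V)) contMDiff_const h₁
    (fun _ => rfl)
  simpa using h₂

variable (I F) in
/-- The velocity at `t = 0` of `t ↦ v + t w`, as a tangent vector at `v`. -/
def vertical {x : B} (v w : V x) : TangentSpace (I.prod 𝓘(ℝ, F)) (⟨x, v⟩ : TotalSpace F V) :=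
  mfderiv 𝓘(ℝ, ℝ) (I.prod 𝓘(ℝ, F)) (fun t : ℝ => (⟨x, v + t • w⟩ : TotalSpace F V)) 0 (1 : ℝ)

/-- The velocity in `verticalLift` sits over `v + 0 • w`, so only the base point has to be
rewritten. -/
lemma verticalLift_eq {x : B} (v w : V x) :
    verticalLift I v w = (⟨⟨x, v⟩, vertical I F v w⟩ :
      TangentBundle (I.prod 𝓘(ℝ, F)) (TotalSpace F V)) :=
  tangentBundle_mk_congr (IN := I.prod 𝓘(ℝ, F)) (by simp) _

/-- The image of a vertical vector under the derivative of a map is the velocity of the image of a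
line. -/
lemma mfderiv_vertical {x : B} (v w : V x) {f : TotalSpace F V → N}
    (hf : MDifferentiableAt (I.prod 𝓘(ℝ, F)) IN f ⟨x, v⟩) :
    mfderiv (I.prod 𝓘(ℝ, F)) IN f ⟨x, v⟩ (vertical I F v w) =
      mfderiv 𝓘(ℝ, ℝ) IN (fun t : ℝ => f ⟨x, v + t • w⟩) 0 (1 : ℝ) :=
  (mfderiv_comp_apply_of_eq (0 : ℝ) hf ((contMDiff_line x v w).mdifferentiable (by simp) 0)
    (by simp) (1 : ℝ)).symm

/-- In the chart the line `v + t w` becomes an affine line with constant base coordinate. Linearity,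
injectivity and smoothness of vertical lifts are all read off from its velocity. -/
lemma mfderiv_extChartAt_vertical {v₀ : TotalSpace F V} {x : B}
    (h₁ : x ∈ (chartAt HB v₀.proj).source)
    (h₂ : x ∈ (trivializationAt F V v₀.proj).baseSet) (v w : V x) :
    mfderiv (I.prod 𝓘(ℝ, F)) 𝓘(ℝ, EB × F) (extChartAt (I.prod 𝓘(ℝ, F)) v₀) ⟨x, v⟩
      (vertical I F v w) = ((0, (trivializationAt F V v₀.proj ⟨x, w⟩).2) : EB × F) := by
  rw [mfderiv_vertical v w (mdifferentiableAt_extChartAt (mem_chart_source_totalSpace h₁ h₂))]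
  have key : (fun t : ℝ => extChartAt (I.prod 𝓘(ℝ, F)) v₀ (⟨x, v + t • w⟩ : TotalSpace F V)) =
      fun t : ℝ => (extChartAt I v₀.proj x, (trivializationAt F V v₀.proj ⟨x, v⟩).2 +
        t • (trivializationAt F V v₀.proj ⟨x, w⟩).2) := by
    funext t
    rw [extChartAt_totalSpace_apply h₂]
    have hl := (trivializationAt F V v₀.proj).linear ℝ h₂
    rw [hl.1, hl.2]
  have hd : HasDerivAt (fun t : ℝ => (extChartAt I v₀.proj x,
      (trivializationAt F V v₀.proj ⟨x, v⟩).2 + t • (trivializationAt F V v₀.proj ⟨x, w⟩).2))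
      ((0 : EB), (1 : ℝ) • (trivializationAt F V v₀.proj ⟨x, w⟩).2) (0 : ℝ) :=
    (hasDerivAt_const _ _).prodMk (((hasDerivAt_id (0 : ℝ)).smul_const _).const_add _)
  rw [one_smul] at hd
  rw [key, mfderiv_eq_fderiv]
  exact congrArg (fun L : ℝ →L[ℝ] EB × F => L 1) hd.hasFDerivAt.fderiv |>.trans
    (one_smul ℝ ((0, (trivializationAt F V v₀.proj ⟨x, w⟩).2) : EB × F))

lemma vertical_unique {x : B} {v : V x}
    {u u' : TangentSpace (I.prod 𝓘(ℝ, F)) (⟨x, v⟩ : TotalSpace F V)}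
    (h : mfderiv (I.prod 𝓘(ℝ, F)) 𝓘(ℝ, EB × F) (extChartAt (I.prod 𝓘(ℝ, F)) (⟨x, v⟩ :
      TotalSpace F V)) ⟨x, v⟩ u = mfderiv (I.prod 𝓘(ℝ, F)) 𝓘(ℝ, EB × F)
        (extChartAt (I.prod 𝓘(ℝ, F)) (⟨x, v⟩ : TotalSpace F V)) ⟨x, v⟩ u') : u = u' :=
  mfderiv_extChartAt_injective (IN := I.prod 𝓘(ℝ, F)) (mem_chart_source _ _) h

variable (I F) in
/-- Vertical vectors at `v` depend linearly on the direction. -/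
def verticalₗ {x : B} (v : V x) :
    V x →ₗ[ℝ] TangentSpace (I.prod 𝓘(ℝ, F)) (⟨x, v⟩ : TotalSpace F V) where
  toFun := vertical I F v
  map_add' w w' := by
    refine vertical_unique ?_
    have h₂ := mem_baseSet_trivializationAt F V x
    have hl := (trivializationAt F V x).linear ℝ h₂
    rw [map_add]
    have hm := fun w => mfderiv_extChartAt_vertical (I := I) (v₀ := ⟨x, v⟩)
      (mem_chart_source HB x) h₂ v w
    refine (hm _).trans (Eq.trans ?_ (congrArg₂ (fun a b : EB × F => a + b) (hm w) (hm w')).symm)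
    exact Prod.ext (add_zero (0 : EB)).symm (hl.1 w w')
  map_smul' t w := by
    refine vertical_unique ?_
    have h₂ := mem_baseSet_trivializationAt F V x
    have hl := (trivializationAt F V x).linear ℝ h₂
    rw [map_smul]
    have hm := fun w => mfderiv_extChartAt_vertical (I := I) (v₀ := ⟨x, v⟩)
      (mem_chart_source HB x) h₂ v w
    refine (hm _).trans (Eq.trans ?_ (congrArg (fun a : EB × F => t • a) (hm w)).symm)
    exact Prod.ext (smul_zero t).symm (hl.2 t w)

lemma vertical_injective {x : B} (v : V x) : Function.Injective (vertical I F v) := by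
  intro w w' h
  have h₂ := mem_baseSet_trivializationAt F V x
  have h' := congrArg (mfderiv (I.prod 𝓘(ℝ, F)) 𝓘(ℝ, EB × F)
    (extChartAt (I.prod 𝓘(ℝ, F)) (⟨x, v⟩ : TotalSpace F V)) ⟨x, v⟩) h
  rw [mfderiv_extChartAt_vertical (v₀ := ⟨x, v⟩) (mem_chart_source _ x) h₂,
    mfderiv_extChartAt_vertical (v₀ := ⟨x, v⟩) (mem_chart_source _ x) h₂] at h'
  exact ((trivializationAt F V x).continuousLinearEquivAt ℝ x h₂).injective (Prod.ext_iff.1 h').2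

/-- Near `v` the first component of the chart is the base chart after the projection; the chain rule
is applied to both factorizations. -/
lemma mfderiv_extChartAt_fst {v₀ v : TotalSpace F V}
    (hv : v ∈ (chartAt (ModelProd HB F) v₀).source)
    (u : TangentSpace (I.prod 𝓘(ℝ, F)) v) :
    (mfderiv (I.prod 𝓘(ℝ, F)) 𝓘(ℝ, EB × F) (extChartAt (I.prod 𝓘(ℝ, F)) v₀) v u : EB × F).1 =
      mfderiv I 𝓘(ℝ, EB) (extChartAt I v₀.proj) v.proj
        (mfderiv (I.prod 𝓘(ℝ, F)) I (fun u : TotalSpace F V => u.proj) v u) := by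
  have hv' := mem_of_mem_chart_source_totalSpace hv
  have h₁ := mfderiv_comp_apply v (I' := 𝓘(ℝ, EB × F)) (I'' := 𝓘(ℝ, EB))
    (g := (Prod.fst : EB × F → EB)) (ContinuousLinearMap.fst ℝ EB F).differentiableAt.mdifferentiableAt
    (mdifferentiableAt_extChartAt (I := I.prod 𝓘(ℝ, F)) hv) u
  have h₂ := mfderiv_comp_apply v (I'' := 𝓘(ℝ, EB)) (mdifferentiableAt_extChartAt (I := I) hv'.1)
    ((contMDiff_proj V (n := 1) (IB := I)).mdifferentiable (by simp) v) u
  have h₃ : (Prod.fst ∘ extChartAt (I.prod 𝓘(ℝ, F)) v₀) =ᶠ[𝓝 v]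
      (extChartAt I v₀.proj ∘ fun u : TotalSpace F V => u.proj) := by
    have := (FiberBundle.continuous_proj F V).continuousAt.eventually
      ((trivializationAt F V v₀.proj).open_baseSet.mem_nhds hv'.2)
    filter_upwards [this] with z hz
    exact congrArg Prod.fst (extChartAt_totalSpace_apply hz)
  rw [h₃.mfderiv_eq] at h₁
  rw [mfderiv_eq_fderiv, fderiv_fst] at h₁
  exact h₁.symm.trans h₂

/-- A vector killed by the projection has chart coordinates (0, ξ), and the witness is the element
of the fibre with coordinate ξ. -/
lemma exists_vertical {x : B} {v : V x} {u : TangentSpace (I.prod 𝓘(ℝ, F)) (⟨x, v⟩ : TotalSpace F V)}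
    (hu : mfderiv (I.prod 𝓘(ℝ, F)) I (fun u : TotalSpace F V => u.proj) ⟨x, v⟩ u = 0) :
    ∃ w, u = vertical I F v w := by
  have h₂ := mem_baseSet_trivializationAt F V x
  refine ⟨(trivializationAt F V x).symm x
    (mfderiv (I.prod 𝓘(ℝ, F)) 𝓘(ℝ, EB × F) (extChartAt (I.prod 𝓘(ℝ, F)) (⟨x, v⟩ : TotalSpace F V))
      ⟨x, v⟩ u : EB × F).2, vertical_unique ?_⟩
  rw [mfderiv_extChartAt_vertical (v₀ := ⟨x, v⟩) (mem_chart_source _ x) h₂]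
  refine Prod.ext ?_ ?_
  · refine (mfderiv_extChartAt_fst (mem_chart_source _ _) u).trans ?_
    rw [hu, map_zero]
    rfl
  · rw [Trivialization.apply_mk_symm _ h₂]

lemma SmoothBundleHom.mfderiv_toMap_vertical (φ : SmoothBundleHom I F V F₂ V₂) {x : B} (v w : V x) :
    mfderiv (I.prod 𝓘(ℝ, F)) (I.prod 𝓘(ℝ, F₂)) φ.toMap ⟨x, v⟩ (vertical I F v w) =
      vertical I F₂ (φ x v) (φ x w) := by
  refine (mfderiv_vertical (f := φ.toMap) v w
    (φ.contMDiff_toFun.mdifferentiable (by simp) _)).trans ?_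
  have : (fun t : ℝ => φ.toMap ⟨x, v + t • w⟩) = fun t : ℝ => ⟨x, φ x v + t • φ x w⟩ := by
    funext t
    simp [SmoothBundleHom.toMap]
  rw [this]
  rfl

/-- The chart coordinates of the vertical vectors are 0 and the coordinate of `w`. The forward
direction yields the smoothness of the core anchor, the backward one that of the fields on the
groupoid. -/
lemma contMDiff_vertical_iff {b : N → B} {v w : ∀ n, V (b n)}
    (hv : ContMDiff IN (I.prod 𝓘(ℝ, F)) ∞ (fun n => (⟨b n, v n⟩ : TotalSpace F V))) :
    ContMDiff IN (I.prod 𝓘(ℝ, F)).tangent ∞ (fun n => (⟨⟨b n, v n⟩, vertical I F (v n) (w n)⟩ :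
      TangentBundle (I.prod 𝓘(ℝ, F)) (TotalSpace F V))) ↔
    ContMDiff IN (I.prod 𝓘(ℝ, F)) ∞ (fun n => (⟨b n, w n⟩ : TotalSpace F V)) := by
  have hb : ContMDiff IN I ∞ b := fun n => (contMDiffAt_totalSpace.1 (hv n)).1
  have key : ∀ n₀, (fun n => (trivializationAt (EB × F) (TangentSpace (I.prod 𝓘(ℝ, F)))
      (⟨b n₀, v n₀⟩ : TotalSpace F V) (⟨⟨b n, v n⟩, vertical I F (v n) (w n)⟩ :
      TangentBundle (I.prod 𝓘(ℝ, F)) (TotalSpace F V))).2) =ᶠ[𝓝 n₀]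
      fun n => ((0 : EB), (trivializationAt F V (b n₀) ⟨b n, w n⟩).2) := by
    intro n₀
    have e₁ := (hb n₀).continuousAt.eventually ((chartAt HB (b n₀)).open_source.mem_nhds
      (mem_chart_source _ _))
    have e₂ := (hb n₀).continuousAt.eventually ((trivializationAt F V (b n₀)).open_baseSet.mem_nhds
      (mem_baseSet_trivializationAt _ _ _))
    filter_upwards [e₁, e₂] with n h₁ h₂
    refine (tangentBundle_trivializationAt_snd (IN := I.prod 𝓘(ℝ, F)) (y₀ := (⟨b n₀, v n₀⟩ :
      TotalSpace F V)) (y := ⟨b n, v n⟩) (mem_chart_source_totalSpace h₁ h₂) _).trans ?_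
    exact mfderiv_extChartAt_vertical (v₀ := ⟨b n₀, v n₀⟩) h₁ h₂ _ _
  constructor
  · intro h n₀
    refine contMDiffAt_totalSpace.2 ⟨hb n₀, ?_⟩
    have h' := ((contMDiffAt_totalSpace.1 (h n₀)).2).congr_of_eventuallyEq (key n₀).symm
    exact (ContinuousLinearMap.snd ℝ EB F).contMDiff.contMDiffAt.comp n₀ h'
  · intro h n₀
    refine contMDiffAt_totalSpace.2 ⟨hv n₀, ?_⟩
    refine ContMDiffAt.congr_of_eventuallyEq ?_ (key n₀)
    exact contMDiffAt_const.prodMk_space (contMDiffAt_totalSpace.1 (h n₀)).2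

end VerticalLift

/-! ### Lie subalgebroids -/

section Subalgebroid

set_option linter.unusedSectionVars false

variable {EB HB B : Type*} [NormedAddCommGroup EB] [NormedSpace ℝ EB] [TopologicalSpace HB]
  {I : ModelWithCorners ℝ EB HB} [TopologicalSpace B] [ChartedSpace HB B] [IsManifold I ∞ B]
  {F₁ : Type*} [NormedAddCommGroup F₁] [NormedSpace ℝ F₁] [FiniteDimensional ℝ F₁]
  {V₁ : B → Type*} [TopologicalSpace (TotalSpace F₁ V₁)]
  [∀ x, TopologicalSpace (V₁ x)] [∀ x, AddCommGroup (V₁ x)] [∀ x, Module ℝ (V₁ x)]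
  [FiberBundle F₁ V₁] [VectorBundle ℝ F₁ V₁] [ContMDiffVectorBundle ∞ F₁ V₁ I]
  {F₂ : Type*} [NormedAddCommGroup F₂] [NormedSpace ℝ F₂] [FiniteDimensional ℝ F₂]
  {V₂ : B → Type*} [TopologicalSpace (TotalSpace F₂ V₂)]
  [∀ x, TopologicalSpace (V₂ x)] [∀ x, AddCommGroup (V₂ x)] [∀ x, Module ℝ (V₂ x)]
  [FiberBundle F₂ V₂] [VectorBundle ℝ F₂ V₂] [ContMDiffVectorBundle ∞ F₂ V₂ I]

namespace SmoothBundleHom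

lemma mapSection_apply (j : SmoothBundleHom I F₁ V₁ F₂ V₂) (X : Cₛ^∞⟮I; F₁, V₁⟯) (x : B) :
    j.mapSection X x = j x (X x) := rfl

lemma mapSection_injective {j : SmoothBundleHom I F₁ V₁ F₂ V₂}
    (hj : ∀ x, Function.Injective (j x)) : Function.Injective j.mapSection := by
  intro X Y h
  ext x
  exact hj x (DFunLike.congr_fun h x)

lemma mapSection_add (j : SmoothBundleHom I F₁ V₁ F₂ V₂) (X Y : Cₛ^∞⟮I; F₁, V₁⟯) :
    j.mapSection (X + Y) = j.mapSection X + j.mapSection Y := by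
  ext x
  exact map_add (j x) _ _

lemma mapSection_smul (j : SmoothBundleHom I F₁ V₁ F₂ V₂) (t : ℝ) (X : Cₛ^∞⟮I; F₁, V₁⟯) :
    j.mapSection (t • X) = t • j.mapSection X := by
  ext x
  exact map_smul (j x) _ _

lemma exists_mapSection_eq {j : SmoothBundleHom I F₁ V₁ F₂ V₂}
    (hj : ∀ x, Function.Injective (j x)) (Z : Cₛ^∞⟮I; F₂, V₂⟯)
    (hZ : ∀ x, Z x ∈ LinearMap.range (j x)) : ∃ X, j.mapSection X = Z := by
  choose f hf using hZ
  refine ⟨⟨f, j.contMDiff_of_injective hj ?_⟩, ?_⟩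
  · refine Z.contMDiff.congr fun x => ?_
    exact congrArg (TotalSpace.mk x) (hf x)
  · ext x
    exact hf x

end SmoothBundleHom

/-- A subbundle whose sections are closed under the bracket is a Lie algebroid. -/
theorem LieAlgebroid.exists_of_injective (𝒜 : LieAlgebroid I F₂ V₂)
    {j : SmoothBundleHom I F₁ V₁ F₂ V₂} (hj : ∀ x, Function.Injective (j x))
    (hb : ∀ X Y x, 𝒜.bracket (j.mapSection X) (j.mapSection Y) x ∈ LinearMap.range (j x)) :
    ∃ 𝒦 : LieAlgebroid I F₁ V₁, 𝒦.IsMorphism 𝒜 j := by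
  -- The preimage of the bracket is unique, so every identity for it is checked after the injective
  -- map of sections induced by `j`.
  choose b hb' using fun X Y => SmoothBundleHom.exists_mapSection_eq hj _ (hb X Y)
  have inj := SmoothBundleHom.mapSection_injective hj
  let br : Cₛ^∞⟮I; F₁, V₁⟯ →ₗ[ℝ] Cₛ^∞⟮I; F₁, V₁⟯ →ₗ[ℝ] Cₛ^∞⟮I; F₁, V₁⟯ :=
    LinearMap.mk₂ ℝ b
      (fun X X' Y => inj (by simp only [hb', j.mapSection_add, map_add, LinearMap.add_apply]))
      (fun t X Y => inj (by simp only [hb', j.mapSection_smul, map_smul, LinearMap.smul_apply]))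
      (fun X Y Y' => inj (by simp only [hb', j.mapSection_add, map_add]))
      (fun t X Y => inj (by simp only [hb', j.mapSection_smul, map_smul]))
  have hbr : ∀ X Y, j.mapSection (br X Y) = 𝒜.bracket (j.mapSection X) (j.mapSection Y) := hb'
  refine ⟨{ anchor := fun x => 𝒜.anchor x ∘ₗ j x
            contMDiff_anchor := 𝒜.contMDiff_anchor.comp j.contMDiff_toFun
            bracket := br
            bracket_self := fun X => inj ?_
            jacobi := fun X Y Z => inj ?_
            leibniz := fun f X Y fY h x => hj x ?_ }, fun x v => rfl, hbr⟩
  · rw [hbr, 𝒜.bracket_self]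
    ext x
    exact (map_zero (j x)).symm
  · simp only [hbr, j.mapSection_add]
    exact 𝒜.jacobi _ _ _
  · have key := 𝒜.leibniz f (j.mapSection X) (j.mapSection Y) (j.mapSection fY)
      (fun x => by rw [j.mapSection_apply, h, map_smul, j.mapSection_apply]) x
    rw [← hbr, ← hbr] at key
    simp only [j.mapSection_apply] at key
    rw [key, map_add, map_smul, map_smul]
    rfl

lemma LieAlgebroid.bracket_swap (𝒜 : LieAlgebroid I F₁ V₁) (X Y) :
    𝒜.bracket X Y = -𝒜.bracket Y X := by
  have h := 𝒜.bracket_self (X + Y)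
  simp only [map_add, LinearMap.add_apply, 𝒜.bracket_self, zero_add, add_zero] at h
  exact eq_neg_of_add_eq_zero_right h

end Subalgebroid

/-! ### The kernel of a surjective vector bundle morphism -/

section KernelBundle

set_option linter.unusedSectionVars false

variable {EB HB B : Type*} [NormedAddCommGroup EB] [NormedSpace ℝ EB] [TopologicalSpace HB]
  {I : ModelWithCorners ℝ EB HB} [TopologicalSpace B] [ChartedSpace HB B]
  {F₁ : Type*} [NormedAddCommGroup F₁] [NormedSpace ℝ F₁] [FiniteDimensional ℝ F₁]
  {V₁ : B → Type*} [TopologicalSpace (TotalSpace F₁ V₁)]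
  [∀ x, TopologicalSpace (V₁ x)] [∀ x, AddCommGroup (V₁ x)] [∀ x, Module ℝ (V₁ x)]
  [FiberBundle F₁ V₁] [VectorBundle ℝ F₁ V₁] [ContMDiffVectorBundle ∞ F₁ V₁ I]
  {F₂ : Type*} [NormedAddCommGroup F₂] [NormedSpace ℝ F₂] [FiniteDimensional ℝ F₂]
  {V₂ : B → Type*} [TopologicalSpace (TotalSpace F₂ V₂)]
  [∀ x, TopologicalSpace (V₂ x)] [∀ x, AddCommGroup (V₂ x)] [∀ x, Module ℝ (V₂ x)]
  [FiberBundle F₂ V₂] [VectorBundle ℝ F₂ V₂] [ContMDiffVectorBundle ∞ F₂ V₂ I]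
  {K : B → Type*} [∀ x, AddCommGroup (K x)] [∀ x, Module ℝ (K x)]

variable (F₁) in
/-- Local frames of the kernel of a surjective vector bundle morphism. -/
structure KernelFrame (ι : ∀ x, K x →ₗ[ℝ] V₁ x) (I : ModelWithCorners ℝ EB HB)
    (F : Type*) [NormedAddCommGroup F] [NormedSpace ℝ F] (x₀ : B) where
  /-- the domain -/
  dom : Set B
  isOpen_dom : IsOpen dom
  mem_dom : x₀ ∈ dom
  dom_subset : dom ⊆ (trivializationAt F₁ V₁ x₀).baseSet
  /-- the local trivialization -/
  coord : ∀ x, K x →ₗ[ℝ] F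
  /-- its inverse -/
  frame : ∀ x, F →ₗ[ℝ] K x
  /-- the frame in the local trivialization of the ambient bundle -/
  incl : B → F →L[ℝ] F₁
  /-- a projection that inverts `incl` -/
  proj : F₁ →L[ℝ] F
  coord_frame : ∀ x ∈ dom, ∀ v, coord x (frame x v) = v
  frame_coord : ∀ x ∈ dom, ∀ k, frame x (coord x k) = k
  contMDiffOn_incl : ContMDiffOn I 𝓘(ℝ, F →L[ℝ] F₁) ∞ incl dom
  incl_apply : ∀ x ∈ dom, ∀ v, (trivializationAt F₁ V₁ x₀ ⟨x, ι x (frame x v)⟩).2 = incl x v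
  coord_apply : ∀ x ∈ dom, ∀ k, coord x k = proj (trivializationAt F₁ V₁ x₀ ⟨x, ι x k⟩).2

/-- The matrix `P` of φ is completed by a fixed projection `pr` onto the kernel of `P x₀`. The map
`Θ = (P, pr)` is invertible at `x₀`, hence on a neighbourhood `U`, and there its inverse restricted
to the second factor parametrizes the kernels smoothly. -/
theorem nonempty_kernelFrame (φ : SmoothBundleHom I F₁ V₁ F₂ V₂)
    (hφ : ∀ x, Function.Surjective (φ x)) (ι : ∀ x, K x →ₗ[ℝ] V₁ x)
    (hι : ∀ x, Function.Injective (ι x)) (hr : ∀ x, LinearMap.range (ι x) = LinearMap.ker (φ x))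
    (x₀ : B) : Nonempty (KernelFrame F₁ ι I
      (EuclideanSpace ℝ (Fin (Module.finrank ℝ F₁ - Module.finrank ℝ F₂))) x₀) := by
  set r := Module.finrank ℝ F₁ - Module.finrank ℝ F₂ with hrdef
  set e₁ := trivializationAt F₁ V₁ x₀
  set e₂ := trivializationAt F₂ V₂ x₀
  have m₁ : x₀ ∈ e₁.baseSet := mem_baseSet_trivializationAt _ _ _
  have m₂ : x₀ ∈ e₂.baseSet := mem_baseSet_trivializationAt _ _ _
  let P := φ.inCoord x₀
  have hP₀ : Function.Surjective (P x₀).toLinearMap := by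
    intro w
    obtain ⟨v, hv⟩ := hφ x₀ (e₂.symm x₀ w)
    refine ⟨(e₁ ⟨x₀, v⟩).2, ?_⟩
    refine (φ.inCoord_trivialization m₁ m₂ v).trans ?_
    rw [hv, Trivialization.apply_mk_symm _ m₂]
  have hdim := LinearMap.finrank_range_add_finrank_ker (P x₀).toLinearMap
  rw [LinearMap.range_eq_top.2 hP₀, finrank_top] at hdim
  -- Rank-nullity: as φ is surjective, the subtraction of natural numbers in `r` is not truncated.
  have hker : Module.finrank ℝ (LinearMap.ker (P x₀).toLinearMap) =
      Module.finrank ℝ (EuclideanSpace ℝ (Fin r)) := by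
    rw [finrank_euclideanSpace_fin]
    omega
  let q := LinearEquiv.ofFinrankEq _ _ hker
  obtain ⟨g, hg⟩ := LinearMap.exists_leftInverse_of_injective
    (LinearMap.ker (P x₀).toLinearMap).subtype (Submodule.ker_subtype _)
  let pr : F₁ →L[ℝ] EuclideanSpace ℝ (Fin r) := LinearMap.toContinuousLinearMap (q.toLinearMap ∘ₗ g)
  let Θ : B → F₁ →L[ℝ] F₂ × EuclideanSpace ℝ (Fin r) := fun x => (P x).prod pr
  have inj₀ : Function.Injective (Θ x₀).toLinearMap := by
    rw [← LinearMap.ker_eq_bot, LinearMap.ker_eq_bot']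
    intro v hv
    have hv₁ : P x₀ v = 0 := congrArg Prod.fst hv
    have hv₂ : q (g v) = 0 := congrArg Prod.snd hv
    have hgv : g v = ⟨v, hv₁⟩ := LinearMap.congr_fun hg ⟨v, hv₁⟩
    rw [hgv] at hv₂
    exact congrArg Subtype.val (q.map_eq_zero_iff.1 hv₂)
  have hfr : Module.finrank ℝ F₁ = Module.finrank ℝ (F₂ × EuclideanSpace ℝ (Fin r)) := by
    rw [Module.finrank_prod, ← hker, hdim]
  let Θ₀ : F₁ ≃L[ℝ] F₂ × EuclideanSpace ℝ (Fin r) := (LinearEquiv.ofBijective (Θ x₀).toLinearMap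
    ⟨inj₀, (LinearMap.injective_iff_surjective_of_finrank_eq_finrank hfr).1 inj₀⟩
    ).toContinuousLinearEquiv
  have hΘ₀ : (Θ₀ : F₁ →L[ℝ] F₂ × EuclideanSpace ℝ (Fin r)) = Θ x₀ := by
    ext v <;> rfl
  have hU₀ : IsOpen (e₁.baseSet ∩ e₂.baseSet) := e₁.open_baseSet.inter e₂.open_baseSet
  have hΘ : ContMDiffOn I 𝓘(ℝ, F₁ →L[ℝ] F₂ × EuclideanSpace ℝ (Fin r)) ∞ Θ
      (e₁.baseSet ∩ e₂.baseSet) := by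
    have h₁ := φ.contMDiffOn_inCoord x₀
    refine contMDiffOn_clm_of_apply fun v => ?_
    exact (h₁.clm_apply contMDiffOn_const).prodMk_space contMDiffOn_const
  let U : Set B := (e₁.baseSet ∩ e₂.baseSet) ∩ Θ ⁻¹'
    (Set.range ((↑) : (F₁ ≃L[ℝ] F₂ × EuclideanSpace ℝ (Fin r)) → _))
  have hU : IsOpen U := hΘ.continuousOn.isOpen_inter_preimage hU₀ (ContinuousLinearEquiv.isOpen)
  have hx₀ : x₀ ∈ U := ⟨⟨m₁, m₂⟩, Θ₀, hΘ₀⟩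
  let Ψ : B → EuclideanSpace ℝ (Fin r) →L[ℝ] F₁ := fun x =>
    (Θ x).inverse ∘L ContinuousLinearMap.inr ℝ F₂ (EuclideanSpace ℝ (Fin r))
  have hΨ : ContMDiffOn I 𝓘(ℝ, EuclideanSpace ℝ (Fin r) →L[ℝ] F₁) ∞ Ψ U := by
    have hi : ContMDiffOn I 𝓘(ℝ, (F₂ × EuclideanSpace ℝ (Fin r)) →L[ℝ] F₁) ∞
        (fun x => (Θ x).inverse) U := by
      intro x hx
      obtain ⟨θ, hθ⟩ := hx.2
      have hinv : ContDiffAt ℝ ∞ (ContinuousLinearMap.inverse :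
          (F₁ →L[ℝ] F₂ × EuclideanSpace ℝ (Fin r)) → _) (Θ x) := by
        rw [← hθ]
        exact contDiffAt_map_inverse _
      exact hinv.contMDiffAt.comp_contMDiffWithinAt x ((hΘ x hx.1).mono Set.inter_subset_left)
    exact hi.clm_comp contMDiffOn_const
  let a : ∀ x, K x →ₗ[ℝ] EuclideanSpace ℝ (Fin r) := fun x =>
    pr.toLinearMap ∘ₗ e₁.linearMapAt ℝ x ∘ₗ ι x
  have ha : ∀ x ∈ U, ∀ k, a x k = pr (e₁ ⟨x, ι x k⟩).2 := by
    intro x hx k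
    simp only [a, LinearMap.comp_apply, Trivialization.linearMapAt_apply, if_pos hx.1.1]
    rfl
  have hΘa : ∀ x ∈ U, ∀ k, Θ x (e₁ ⟨x, ι x k⟩).2 = (0, a x k) := by
    intro x hx k
    refine Prod.ext ?_ (ha x hx k).symm
    refine (φ.inCoord_trivialization hx.1.1 hx.1.2 _).trans ?_
    have : φ x (ι x k) = 0 := by
      rw [← LinearMap.mem_ker, ← hr x]
      exact ⟨k, rfl⟩
    rw [this]
    exact map_zero (e₂.continuousLinearEquivAt ℝ x hx.1.2)
  have hΨa : ∀ x ∈ U, ∀ k, Ψ x (a x k) = (e₁ ⟨x, ι x k⟩).2 := by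
    intro x hx k
    change (Θ x).inverse (0, a x k) = _
    rw [← hΘa x hx k]
    obtain ⟨θ, hθ⟩ := hx.2
    rw [← hθ, ContinuousLinearMap.inverse_equiv]
    exact θ.symm_apply_apply _
  have bij : ∀ x ∈ U, Function.Bijective (a x) := by
    intro x hx
    constructor
    · intro k k' h
      have h' := hΨa x hx k
      rw [h, hΨa x hx k'] at h'
      exact (hι x ((e₁.continuousLinearEquivAt ℝ x hx.1.1).injective h')).symm
    · intro v
      obtain ⟨θ, hθ⟩ := hx.2
      have hΘΨ : Θ x (Ψ x v) = (0, v) := by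
        change Θ x ((Θ x).inverse (0, v)) = _
        rw [← hθ, ContinuousLinearMap.inverse_equiv]
        exact θ.apply_symm_apply _
      -- The first component of `Θ` is φ in coordinates, so a vector with `Θ`-image `(0, v)` lies in
      -- the kernel of φ.
      have hk : e₁.symm x (Ψ x v) ∈ LinearMap.range (ι x) := by
        rw [hr x, LinearMap.mem_ker]
        refine (e₂.continuousLinearEquivAt ℝ x hx.1.2).map_eq_zero_iff.1 ?_
        exact (φ.inCoord_apply hx.1.1 hx.1.2 _).symm.trans (congrArg Prod.fst hΘΨ)
      obtain ⟨k, hk⟩ := hk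
      refine ⟨k, ?_⟩
      rw [ha x hx, hk, Trivialization.apply_mk_symm _ hx.1.1]
      exact congrArg Prod.snd hΘΨ
  classical
  let s : ∀ x, EuclideanSpace ℝ (Fin r) →ₗ[ℝ] K x := fun x =>
    if h : x ∈ U then (LinearEquiv.ofBijective (a x) (bij x h)).symm.toLinearMap else 0
  have hs : ∀ x (h : x ∈ U) v, s x v = (LinearEquiv.ofBijective (a x) (bij x h)).symm v := by
    intro x h v
    simp only [s, dif_pos h]
    rfl
  have has : ∀ x ∈ U, ∀ v, a x (s x v) = v := by
    intro x hx v
    rw [hs x hx]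
    exact LinearEquiv.apply_symm_apply (LinearEquiv.ofBijective (a x) (bij x hx)) v
  exact ⟨{ dom := U, isOpen_dom := hU, mem_dom := hx₀, dom_subset := fun x hx => hx.1.1
           coord := a, frame := s, incl := Ψ, proj := pr
           coord_frame := has
           frame_coord := fun x hx k => by
             rw [hs x hx]
             exact LinearEquiv.symm_apply_apply (LinearEquiv.ofBijective (a x) (bij x hx)) k
           contMDiffOn_incl := hΨ
           incl_apply := fun x hx v => by rw [← hΨa x hx, has x hx]
           coord_apply := ha }⟩

/-! ### Gluing local frames of the kernel to a vector bundle. -/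

namespace KernelFrame

variable {ι : ∀ x, K x →ₗ[ℝ] V₁ x} {F : Type*} [NormedAddCommGroup F] [NormedSpace ℝ F]

/-- The pretrivialization of the kernel given by a frame. -/
def pretrivialization {x₀ : B} (Φ : KernelFrame F₁ ι I F x₀) :
    Pretrivialization F (π F K) where
  toFun v := (v.proj, Φ.coord v.proj v.snd)
  invFun w := ⟨w.1, Φ.frame w.1 w.2⟩
  source := π F K ⁻¹' Φ.dom
  target := Φ.dom ×ˢ Set.univ
  map_source' v hv := ⟨hv, Set.mem_univ _⟩
  map_target' w hw := hw.1
  left_inv' v hv := by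
    obtain ⟨x, k⟩ := v
    exact congrArg (TotalSpace.mk x) (Φ.frame_coord x hv k)
  right_inv' w hw := Prod.ext rfl (Φ.coord_frame w.1 hw.1 w.2)
  open_target := Φ.isOpen_dom.prod isOpen_univ
  baseSet := Φ.dom
  open_baseSet := Φ.isOpen_dom
  source_eq := rfl
  target_eq := rfl
  proj_toFun v hv := rfl

lemma pretrivialization_symm {x₀ : B} (Φ : KernelFrame F₁ ι I F x₀) {x : B} (hx : x ∈ Φ.dom) (v : F) :
    Φ.pretrivialization.symm x v = Φ.frame x v :=
  TotalSpace.mk_inj.1 (Φ.pretrivialization.mk_symm hx v)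

/-- Coordinate changes between frames. -/
def coordChange [FiniteDimensional ℝ F] {x₀ x₁ : B} (Φ : KernelFrame F₁ ι I F x₀)
    (Φ' : KernelFrame F₁ ι I F x₁) (x : B) : F →L[ℝ] F :=
  LinearMap.toContinuousLinearMap (Φ'.coord x ∘ₗ Φ.frame x)

/-- The first frame consists of smooth sections of the ambient bundle, and the second coordinate is
a fixed linear function of the ambient coordinate. -/
lemma contMDiffOn_coordChange [FiniteDimensional ℝ F] {x₀ x₁ : B} (Φ : KernelFrame F₁ ι I F x₀)
    (Φ' : KernelFrame F₁ ι I F x₁) :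
    ContMDiffOn I 𝓘(ℝ, F →L[ℝ] F) ∞ (Φ.coordChange Φ') (Φ.dom ∩ Φ'.dom) := by
  refine contMDiffOn_clm_of_apply fun v => ?_
  have h₁ : ContMDiffOn I (I.prod 𝓘(ℝ, F₁)) ∞
      (fun x => (⟨x, ι x (Φ.frame x v)⟩ : TotalSpace F₁ V₁)) (Φ.dom ∩ Φ'.dom) := by
    refine (Trivialization.contMDiffOn_iff (e := trivializationAt F₁ V₁ x₀)
      fun x hx => (Trivialization.mem_source _).2 (Φ.dom_subset hx.1)).2 ⟨contMDiffOn_id, ?_⟩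
    exact ((Φ.contMDiffOn_incl.mono Set.inter_subset_left).clm_apply
      contMDiffOn_const).congr fun x hx => Φ.incl_apply x hx.1 v
  have h₂ := ((Trivialization.contMDiffOn_iff (e := trivializationAt F₁ V₁ x₁)
      fun x hx => (Trivialization.mem_source _).2 (Φ'.dom_subset hx.2)).1 h₁).2
  exact (Φ'.proj.contMDiff.comp_contMDiffOn h₂).congr fun x hx => Φ'.coord_apply x hx.2 _

lemma coordChange_apply [FiniteDimensional ℝ F] {x₀ x₁ : B} (Φ : KernelFrame F₁ ι I F x₀)
    (Φ' : KernelFrame F₁ ι I F x₁) {x : B} (hx : x ∈ Φ.dom ∩ Φ'.dom) (v : F) :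
    Φ.coordChange Φ' x v = (Φ'.pretrivialization ⟨x, Φ.pretrivialization.symm x v⟩).2 := by
  rw [Φ.pretrivialization_symm hx.1]
  rfl

/-- The composite of `coord` with the continuous map `incl x₀` is the ambient coordinate restricted
to the kernel, which is inducing; `coord` is continuous since it factors through that coordinate. -/
lemma isInducing_coord [∀ x, TopologicalSpace (K x)] [FiniteDimensional ℝ F]
    (hι : ∀ x, Topology.IsInducing (ι x)) {x₀ : B} (Φ : KernelFrame F₁ ι I F x₀) :
    Topology.IsInducing (Φ.coord x₀) := by
  have m₁ : x₀ ∈ (trivializationAt F₁ V₁ x₀).baseSet := mem_baseSet_trivializationAt _ _ _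
  have h₁ : Topology.IsInducing (fun k : K x₀ => (trivializationAt F₁ V₁ x₀ ⟨x₀, ι x₀ k⟩).2) :=
    (((trivializationAt F₁ V₁ x₀).continuousLinearEquivAt ℝ x₀ m₁).toHomeomorph.isInducing).comp
      (hι x₀)
  have h₂ : (Φ.coord x₀ : K x₀ → F) = Φ.proj ∘
      (fun k : K x₀ => (trivializationAt F₁ V₁ x₀ ⟨x₀, ι x₀ k⟩).2) :=
    funext fun k => Φ.coord_apply x₀ Φ.mem_dom k
  have h₃ : (fun k : K x₀ => (trivializationAt F₁ V₁ x₀ ⟨x₀, ι x₀ k⟩).2) =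
      Φ.incl x₀ ∘ Φ.coord x₀ := by
    funext k
    rw [Function.comp_apply, ← Φ.incl_apply x₀ Φ.mem_dom, Φ.frame_coord x₀ Φ.mem_dom]
  refine Topology.IsInducing.of_comp (g := Φ.incl x₀) ?_ (Φ.incl x₀).continuous (h₃ ▸ h₁)
  rw [h₂]
  exact Φ.proj.continuous.comp h₁.continuous

/-- A family of frames makes the kernel a vector prebundle. -/
def vectorPrebundle [∀ x, TopologicalSpace (K x)] [FiniteDimensional ℝ F]
    (hι : ∀ x, Topology.IsInducing (ι x)) (Φ : ∀ x₀, KernelFrame F₁ ι I F x₀) : VectorPrebundle ℝ F K where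
  pretrivializationAtlas := Set.range fun x₀ => (Φ x₀).pretrivialization
  pretrivialization_linear' := by
    rintro _ ⟨x₀, rfl⟩
    exact ⟨fun x hx => ((Φ x₀).coord x).isLinear⟩
  pretrivializationAt x₀ := (Φ x₀).pretrivialization
  mem_base_pretrivializationAt x₀ := (Φ x₀).mem_dom
  pretrivialization_mem_atlas x₀ := ⟨x₀, rfl⟩
  exists_coordChange := by
    rintro _ ⟨x₀, rfl⟩ _ ⟨x₁, rfl⟩
    exact ⟨_, ((Φ x₀).contMDiffOn_coordChange (Φ x₁)).continuousOn,
      fun x hx v => (Φ x₀).coordChange_apply (Φ x₁) hx v⟩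
  totalSpaceMk_isInducing x₀ := by
    have h₁ := (Φ x₀).isInducing_coord hι
    exact Topology.isInducing_const_prod.2 h₁

instance [∀ x, TopologicalSpace (K x)] [FiniteDimensional ℝ F]
    (hι : ∀ x, Topology.IsInducing (ι x)) (Φ : ∀ x₀, KernelFrame F₁ ι I F x₀) :
    (vectorPrebundle hι Φ).IsContMDiff I ∞ where
  exists_contMDiffCoordChange := by
    rintro _ ⟨x₀, rfl⟩ _ ⟨x₁, rfl⟩
    exact ⟨_, (Φ x₀).contMDiffOn_coordChange (Φ x₁),
      fun x hx v => (Φ x₀).coordChange_apply (Φ x₁) hx v⟩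

end KernelFrame

/-- The kernel of a surjective morphism of smooth vector bundles is a smooth vector bundle, and its
inclusion is smooth. -/
theorem exists_kernelBundle [∀ x, TopologicalSpace (K x)] (φ : SmoothBundleHom I F₁ V₁ F₂ V₂)
    (hφ : ∀ x, Function.Surjective (φ x)) (ι : ∀ x, K x →ₗ[ℝ] V₁ x)
    (hι : ∀ x, Function.Injective (ι x)) (hι' : ∀ x, Topology.IsInducing (ι x))
    (hr : ∀ x, LinearMap.range (ι x) = LinearMap.ker (φ x)) :
    ∃ (r : ℕ) (_ : TopologicalSpace (TotalSpace (EuclideanSpace ℝ (Fin r)) K))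
      (_ : FiberBundle (EuclideanSpace ℝ (Fin r)) K)
      (_ : VectorBundle ℝ (EuclideanSpace ℝ (Fin r)) K),
      ContMDiffVectorBundle ∞ (EuclideanSpace ℝ (Fin r)) K I ∧
      ContMDiff (I.prod 𝓘(ℝ, EuclideanSpace ℝ (Fin r))) (I.prod 𝓘(ℝ, F₁)) ∞
        (fun v : TotalSpace (EuclideanSpace ℝ (Fin r)) K =>
          (⟨v.proj, ι v.proj v.snd⟩ : TotalSpace F₁ V₁)) := by
  let Φ := fun x₀ => (nonempty_kernelFrame φ hφ ι hι hr x₀).some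
  let a := KernelFrame.vectorPrebundle hι' Φ
  let _ := a.totalSpaceTopology
  let _ := a.toFiberBundle
  let _ := a.toVectorBundle
  refine ⟨_, a.totalSpaceTopology, a.toFiberBundle, a.toVectorBundle,
    a.contMDiffVectorBundle I, ?_⟩
  intro v₀
  have h₀ := contMDiffAt_totalSpace.1 (contMDiffAt_id (n := ∞)
    (I := I.prod 𝓘(ℝ, EuclideanSpace ℝ (Fin (Module.finrank ℝ F₁ - Module.finrank ℝ F₂))))
    (x := v₀))
  refine contMDiffAt_totalSpace.2 ⟨h₀.1, ?_⟩
  -- In the two trivializations the inclusion reads `(x, v) ↦ (x, incl x v)`.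
  have hΨ := (((Φ v₀.proj).contMDiffOn_incl.contMDiffAt
    ((Φ v₀.proj).isOpen_dom.mem_nhds (Φ v₀.proj).mem_dom)).comp v₀ h₀.1).clm_apply h₀.2
  refine hΨ.congr_of_eventuallyEq ?_
  filter_upwards [h₀.1.continuousAt.eventually
    ((Φ v₀.proj).isOpen_dom.mem_nhds (Φ v₀.proj).mem_dom)] with v hv
  have key := (Φ v₀.proj).incl_apply v.proj hv ((Φ v₀.proj).coord v.proj v.snd)
  rw [(Φ v₀.proj).frame_coord v.proj hv] at key
  exact key

end KernelBundle

/-! ### The Lie groupoid of a 2-term complex -/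

section ComplexGroupoid

set_option linter.unusedSectionVars false

variable {EB HB B : Type*} [NormedAddCommGroup EB] [NormedSpace ℝ EB] [TopologicalSpace HB]
  {I : ModelWithCorners ℝ EB HB} [TopologicalSpace B] [ChartedSpace HB B] [IsManifold I ∞ B]
  {FC : Type*} [NormedAddCommGroup FC] [NormedSpace ℝ FC]
  {C : B → Type*} [TopologicalSpace (TotalSpace FC C)]
  [∀ x, TopologicalSpace (C x)] [∀ x, AddCommGroup (C x)] [∀ x, Module ℝ (C x)]
  [FiberBundle FC C] [VectorBundle ℝ FC C] [ContMDiffVectorBundle ∞ FC C I]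
  {F : Type*} [NormedAddCommGroup F] [NormedSpace ℝ F]
  {V : B → Type*} [TopologicalSpace (TotalSpace F V)]
  [∀ x, TopologicalSpace (V x)] [∀ x, AddCommGroup (V x)] [∀ x, Module ℝ (V x)]
  [FiberBundle F V] [VectorBundle ℝ F V] [ContMDiffVectorBundle ∞ F V I]
  {EN HN N : Type*} [NormedAddCommGroup EN] [NormedSpace ℝ EN] [TopologicalSpace HN]
  {IN : ModelWithCorners ℝ EN HN} [TopologicalSpace N] [ChartedSpace HN N]
  {EN' HN' N' : Type*} [NormedAddCommGroup EN'] [NormedSpace ℝ EN'] [TopologicalSpace HN']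
  {IN' : ModelWithCorners ℝ EN' HN'} [TopologicalSpace N'] [ChartedSpace HN' N']

/-- The derivative of a local section through `n₀` is a right inverse of the derivative of `f`. -/
lemma mfderiv_surjective_of_rightInverse {f : N → N'} {s : N' → N} {n₀ : N}
    (hf : MDifferentiableAt IN IN' f n₀) (hs : MDifferentiableAt IN' IN s (f n₀))
    (hn : s (f n₀) = n₀) (h : ∀ᶠ y in 𝓝 (f n₀), f (s y) = y) :
    Function.Surjective (mfderiv IN IN' f n₀) := by
  intro v
  refine ⟨mfderiv IN' IN s (f n₀) v, ?_⟩
  have h₁ := mfderiv_comp_apply_of_eq (f n₀) hf hs hn v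
  refine h₁.symm.trans ?_
  have h₂ : f ∘ s =ᶠ[𝓝 (f n₀)] id := h
  exact congrArg (fun L : EN' →L[ℝ] EN' => L v) (h₂.mfderiv_eq.trans mfderiv_id)

namespace SmoothBundleHom

variable (d : SmoothBundleHom I FC C F V)

/-- The target map `(c, e) ↦ e + ∂ c`. -/
def complexTgt : SmoothBundleHom I (FC × F) (C ×ᵇ V) F V := snd.add (d.comp fst)

/-- The inverse `(c, e) ↦ (-c, e + ∂ c)`. -/
def complexInv : SmoothBundleHom I (FC × F) (C ×ᵇ V) (FC × F) (C ×ᵇ V) where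
  toFun x := (-LinearMap.fst ℝ (C x) (V x)).prod (d.complexTgt x)
  contMDiff_toFun := by
    have h₁ : ContMDiff (I.prod 𝓘(ℝ, FC × F)) (I.prod 𝓘(ℝ, FC)) ∞
        (fun v : TotalSpace (FC × F) (C ×ᵇ V) => (⟨v.proj, (-1 : ℝ) • v.snd.1⟩ : TotalSpace FC C)) :=
      contMDiff_const.fibreSMul (f := fun v : TotalSpace (FC × F) (C ×ᵇ V) =>
        (⟨v.proj, v.snd.1⟩ : TotalSpace FC C)) fst.contMDiff_toFun
    let n : SmoothBundleHom I (FC × F) (C ×ᵇ V) FC C :=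
      ⟨fun x => -LinearMap.fst ℝ (C x) (V x), h₁.congr fun v =>
        congrArg (TotalSpace.mk v.proj) (neg_one_smul ℝ _).symm⟩
    exact (n.pair d.complexTgt).contMDiff_toFun

variable (I FC C F V) in
/-- The inclusion `c ↦ (c, 0)`. -/
def inl : SmoothBundleHom I FC C (FC × F) (C ×ᵇ V) := id.pair zero

variable (I FC C F V) in
/-- The inclusion `e ↦ (0, e)`. -/
def inr : SmoothBundleHom I F V (FC × F) (C ×ᵇ V) := zero.pair id

variable (I FC C F V) in
/-- The projection `(c, e) ↦ (c, 0)`. -/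
def inlFst : SmoothBundleHom I (FC × F) (C ×ᵇ V) (FC × F) (C ×ᵇ V) := (inl I FC C F V).comp fst

/-- Multiplication `(c₂, e + ∂ c₁) (c₁, e) = (c₁ + c₂, e)`. -/
def complexMul (g h : TotalSpace (FC × F) (C ×ᵇ V)) : TotalSpace (FC × F) (C ×ᵇ V) :=
  fibreAdd h ((inlFst I FC C F V).toMap g)

lemma complexMul_mk (x : B) (a b : C x) (v w : V x) :
    complexMul (I := I) (⟨x, a, v⟩ : TotalSpace (FC × F) (C ×ᵇ V)) ⟨x, b, w⟩ = ⟨x, b + a, w⟩ := by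
  refine (fibreAdd_mk x (V := C ×ᵇ V) (b, w) (a, 0)).trans ?_
  exact congrArg (TotalSpace.mk x) (Prod.ext rfl (add_zero w))

lemma exists_rightInverse_snd (g : TotalSpace (FC × F) (C ×ᵇ V)) :
    ∃ s : TotalSpace F V → TotalSpace (FC × F) (C ×ᵇ V),
      MDifferentiableAt (I.prod 𝓘(ℝ, F)) (I.prod 𝓘(ℝ, FC × F)) s
        ((snd (I := I) (V₁ := C) (V₂ := V)).toMap g) ∧
      s ((snd (I := I) (V₁ := C) (V₂ := V)).toMap g) = g ∧
      ∀ᶠ u in 𝓝 ((snd (I := I) (V₁ := C) (V₂ := V)).toMap g),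
        (snd (I := I) (V₁ := C) (V₂ := V)).toMap (s u) = u := by
  obtain ⟨x, c, e⟩ := g
  set t := trivializationAt FC C x
  have hx : x ∈ t.baseSet := mem_baseSet_trivializationAt FC C x
  -- The section of `C` through `c` with constant coordinate; it is smooth near `x`, which is all
  -- that a derivative needs.
  let σ : ∀ y, C y := fun y => t.symm y (t ⟨x, c⟩).2
  refine ⟨fun u => ⟨u.proj, σ u.proj, u.snd⟩, ?_, ?_, ?_⟩
  · have hσ : ContMDiffAt I (I.prod 𝓘(ℝ, FC)) ∞ (fun y => (⟨y, σ y⟩ : TotalSpace FC C)) x :=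
      (contMDiffOn_trivializationAt_symm x _).contMDiffAt (t.open_baseSet.mem_nhds hx)
    have h₁ : ContMDiffAt (I.prod 𝓘(ℝ, F)) (I.prod 𝓘(ℝ, FC × F)) ∞
        (fun u : TotalSpace F V => (inl I FC C F V).toMap ⟨u.proj, σ u.proj⟩) ⟨x, e⟩ :=
      (inl I FC C F V).contMDiff_toFun.contMDiffAt.comp _
        (hσ.comp (⟨x, e⟩ : TotalSpace F V) (contMDiff_proj V _))
    have h₂ := (contMDiffWithinAt_univ.2 h₁).fibreAdd
      (contMDiffWithinAt_univ.2 ((inr I FC C F V).contMDiff_toFun _)) (fun _ _ => rfl)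
      (Set.mem_univ _)
    rw [contMDiffWithinAt_univ] at h₂
    refine (h₂.congr_of_eventuallyEq (Filter.Eventually.of_forall fun u => ?_)).mdifferentiableAt
      (by simp)
    refine Eq.symm <| (fibreAdd_mk u.proj (V := C ×ᵇ V) (σ u.proj, 0) (0, u.snd)).trans ?_
    exact congrArg (TotalSpace.mk u.proj) (Prod.ext (add_zero _) (zero_add _))
  · have : σ x = c := t.symm_apply_apply_mk hx c
    exact congrArg (fun a => (⟨x, a, e⟩ : TotalSpace (FC × F) (C ×ᵇ V))) this
  · exact Filter.Eventually.of_forall fun u => rfl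

/-- The source fibre over `e ∈ V_x` is `C_x`. -/
def sourceFibreHomeomorph (u : TotalSpace F V) :
    C u.proj ≃ₜ {g : TotalSpace (FC × F) (C ×ᵇ V) //
      (snd (I := I) (V₁ := C) (V₂ := V)).toMap g = u} :=
  (Equiv.ofBijective (fun c => ⟨⟨u.proj, c, u.snd⟩, rfl⟩) <| by
    constructor
    · intro c c' h
      have h' : (⟨u.proj, c, u.snd⟩ : TotalSpace (FC × F) (C ×ᵇ V)) = ⟨u.proj, c', u.snd⟩ :=
        congrArg (Subtype.val (p := fun g => (snd (I := I) (V₁ := C) (V₂ := V)).toMap g = u)) h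
      exact (Prod.ext_iff.1 ((TotalSpace.mk_inj (E := C ×ᵇ V)).1 h')).1
    · rintro ⟨⟨x, c, e⟩, rfl⟩
      exact ⟨c, rfl⟩).toHomeomorphOfIsInducing <| by
    have h₁ := FiberBundle.totalSpaceMk_isInducing (FC × F) (C ×ᵇ V) u.proj
    have h₂ : Topology.IsInducing (fun c : C u.proj => ((c, u.snd) : (C ×ᵇ V) u.proj)) :=
      (isEmbedding_prodMkLeft u.snd).isInducing
    exact Topology.IsInducing.codRestrict
      (s := {g | (snd (I := I) (V₁ := C) (V₂ := V)).toMap g = u}) (h₁.comp h₂) fun _ => rfl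

/-- The Lie groupoid `C ⊕ V ⇉ V` of a 2-term complex `∂ : C → V` of vector bundles. -/
def complexGroupoid : LieGroupoid (I.prod 𝓘(ℝ, FC × F)) (I.prod 𝓘(ℝ, F))
    (TotalSpace (FC × F) (C ×ᵇ V)) (TotalSpace F V) where
  src := (snd (V₁ := C) (V₂ := V)).toMap
  tgt := d.complexTgt.toMap
  unit := (inr I FC C F V).toMap
  inv := d.complexInv.toMap
  mul := complexMul (I := I)
  src_unit _ := rfl
  tgt_unit u := by
    refine congrArg (TotalSpace.mk u.proj) ?_
    change u.snd + d u.proj 0 = u.snd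
    rw [map_zero, add_zero]
  src_inv _ := rfl
  tgt_inv g := by
    refine congrArg (TotalSpace.mk g.proj) ?_
    change (g.snd.2 + d _ g.snd.1) + d _ (-g.snd.1) = g.snd.2
    rw [map_neg, add_neg_cancel_right]
  src_mul := by
    rintro ⟨x, a, v⟩ ⟨y, b, w⟩ h
    obtain rfl : x = y := congrArg TotalSpace.proj h
    rw [complexMul_mk]
    rfl
  tgt_mul := by
    rintro ⟨x, a, v⟩ ⟨y, b, w⟩ h
    obtain rfl : x = y := congrArg TotalSpace.proj h
    obtain rfl : v = w + d x b := TotalSpace.mk_inj.1 h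
    rw [complexMul_mk]
    refine congrArg (TotalSpace.mk x) ?_
    change w + d x (b + a) = w + d x b + d x a
    rw [map_add, add_assoc]
  mul_assoc := by
    rintro ⟨x, a, v⟩ ⟨y, b, w⟩ ⟨z, c, u⟩ h h'
    obtain rfl : x = y := congrArg TotalSpace.proj h
    obtain rfl : x = z := congrArg TotalSpace.proj h'
    simp only [complexMul_mk, add_assoc]
  mul_unit := by
    rintro ⟨x, a, v⟩
    refine (complexMul_mk x a 0 v v).trans ?_
    rw [zero_add]
  unit_mul := by
    rintro ⟨x, a, v⟩
    refine (complexMul_mk x 0 a (v + d x a) v).trans ?_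
    rw [add_zero]
  mul_inv := by
    rintro ⟨x, a, v⟩
    refine (complexMul_mk x a (-a) v (v + d x a)).trans ?_
    rw [neg_add_cancel]
    rfl
  inv_mul := by
    rintro ⟨x, a, v⟩
    refine (complexMul_mk x (-a) a (v + d x a) v).trans ?_
    rw [add_neg_cancel]
    rfl
  contMDiff_src := snd.contMDiff_toFun
  contMDiff_tgt := d.complexTgt.contMDiff_toFun
  contMDiff_unit := (inr I FC C F V).contMDiff_toFun
  contMDiff_inv := d.complexInv.contMDiff_toFun
  submersion_src g := by
    obtain ⟨s, h₁, h₂, h₃⟩ := exists_rightInverse_snd (I := I) g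
    exact mfderiv_surjective_of_rightInverse (snd.contMDiff_toFun.mdifferentiable (by simp) g)
      h₁ h₂ h₃
  submersion_tgt g := by
    -- Inversion exchanges source and target: a section of the source through the inverse of `g`,
    -- followed by inversion, is a section of the target through `g`.
    obtain ⟨s, h₁, h₂, h₃⟩ := exists_rightInverse_snd (I := I) (d.complexInv.toMap g)
    have hinv : ∀ u : TotalSpace F V, d.complexTgt.toMap (d.complexInv.toMap (s u)) =
        (snd (I := I) (V₁ := C) (V₂ := V)).toMap (s u) := by
      intro u
      generalize s u = g
      refine congrArg (TotalSpace.mk g.proj) ?_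
      change (g.snd.2 + d _ g.snd.1) + d _ (-g.snd.1) = g.snd.2
      rw [map_neg, add_neg_cancel_right]
    refine mfderiv_surjective_of_rightInverse (s := fun u => d.complexInv.toMap (s u))
      (d.complexTgt.contMDiff_toFun.mdifferentiable (by simp) g)
      ((d.complexInv.contMDiff_toFun.mdifferentiable (by simp) _).comp _ h₁) ?_ ?_
    · refine (congrArg d.complexInv.toMap h₂).trans ?_
      refine congrArg (TotalSpace.mk g.proj) (Prod.ext (neg_neg _) ?_)
      change (g.snd.2 + d _ g.snd.1) + d _ (-g.snd.1) = g.snd.2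
      rw [map_neg, add_neg_cancel_right]
    · exact h₃.mono fun u hu => (hinv u).trans hu
  -- The product is a fibrewise sum of smooth maps; composability serves only to put both summands
  -- over the same point of the base.
  contMDiffOn_mul := fun p hp =>
    (contMDiff_snd p).contMDiffWithinAt.fibreAdd
      (((inlFst I FC C F V).contMDiff_toFun.comp contMDiff_fst) p).contMDiffWithinAt
      (fun q (hq : snd.toMap q.1 = d.complexTgt.toMap q.2) => by
        exact congrArg (TotalSpace.proj (F := F) (E := V)) hq) hp
  t2_sourceFibre u := by
    have : T2Space (C u.proj) := ((trivializationAt FC C u.proj).continuousLinearEquivAt ℝ u.proj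
      (mem_baseSet_trivializationAt FC C u.proj)).symm.toHomeomorph.t2Space
    exact (sourceFibreHomeomorph u).t2Space

/-- Each source fibre is homeomorphic to the model space `FC`, which is contractible. -/
lemma complexGroupoid_sourceSimplyConnected : d.complexGroupoid.SourceSimplyConnected := by
  intro u
  let H := ((trivializationAt FC C u.proj).continuousLinearEquivAt ℝ u.proj
      (mem_baseSet_trivializationAt FC C u.proj)).symm.toHomeomorph.trans
      (sourceFibreHomeomorph (I := I) (FC := FC) (C := C) u)
  have : ContractibleSpace {g // d.complexGroupoid.src g = u} := H.symm.contractibleSpace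
  infer_instance

lemma underlies_complexGroupoid : (TwoVectorBundle.ofComplex d).Underlies d.complexGroupoid :=
  ⟨fun _ _ => rfl, fun _ _ => rfl, fun _ _ => rfl, fun x g h _ => complexMul_mk x g.1 h.1 g.2 h.2⟩

lemma hasComplex_ofComplex : (TwoVectorBundle.ofComplex d).HasComplex d := by
  refine ⟨inl I FC C F V, fun x c c' h => (Prod.ext_iff.1 h).1, fun x => ?_, fun x c => ?_⟩
  · ext ⟨c, e⟩
    constructor
    · rintro ⟨c', h⟩
      exact (Prod.ext_iff.1 h).2.symm
    · intro h
      exact ⟨c, Prod.ext rfl (Eq.symm h)⟩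
  · exact zero_add (d x c)

end SmoothBundleHom

end ComplexGroupoid

/-! ### Lie brackets of vertical vector fields -/

section VerticalBracket

set_option linter.unusedSectionVars false

variable {EB HB B : Type*} [NormedAddCommGroup EB] [NormedSpace ℝ EB] [TopologicalSpace HB]
  {I : ModelWithCorners ℝ EB HB} [TopologicalSpace B] [ChartedSpace HB B] [IsManifold I ∞ B]
  {F : Type*} [NormedAddCommGroup F] [NormedSpace ℝ F]
  {V : B → Type*} [TopologicalSpace (TotalSpace F V)]
  [∀ x, TopologicalSpace (V x)] [∀ x, AddCommGroup (V x)] [∀ x, Module ℝ (V x)]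
  [FiberBundle F V] [VectorBundle ℝ F V] [ContMDiffVectorBundle ∞ F V I]

/-- The function is constant along the line in the direction `(0, ξ)`. No regularity of `k` is
needed, since `fderiv` is 0 where the derivative does not exist. -/
lemma fderiv_comp_fst_apply_zero {X Y Z : Type*} [NormedAddCommGroup X] [NormedSpace ℝ X]
    [NormedAddCommGroup Y] [NormedSpace ℝ Y] [NormedAddCommGroup Z] [NormedSpace ℝ Z]
    (k : X → Z) (p : X × Y) (ξ : Y) : fderiv ℝ (fun q : X × Y => k q.1) p (0, ξ) = 0 := by
  by_cases h : DifferentiableAt ℝ (fun q : X × Y => k q.1) p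
  · have hl : HasDerivAt (fun t : ℝ => p + t • ((0, ξ) : X × Y)) ((1 : ℝ) • ((0, ξ) : X × Y)) 0 :=
      ((hasDerivAt_id (0 : ℝ)).smul_const _).const_add p
    have h₀ : HasFDerivAt (fun q : X × Y => k q.1) (fderiv ℝ (fun q : X × Y => k q.1) p)
        (p + (0 : ℝ) • ((0, ξ) : X × Y)) := by
      rw [zero_smul, add_zero]
      exact h.hasFDerivAt
    have h₁ := h₀.comp_hasDerivAt (0 : ℝ) hl
    have h₂ : ((fun q : X × Y => k q.1) ∘ fun t : ℝ => p + t • ((0, ξ) : X × Y)) =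
        fun _ => k p.1 := by
      funext t
      simp
    rw [h₂, one_smul] at h₁
    exact h₁.unique (hasDerivAt_const _ _)
  · rw [fderiv_zero_of_not_differentiableAt h]
    rfl

/-- The coordinate expression of a vertical vector field that is constant along the fibres. -/
lemma mpullbackWithin_vertical {v₀ : TotalSpace F V} (W : ∀ x, V x) {y : EB × F}
    (hy : y ∈ (extChartAt (I.prod 𝓘(ℝ, F)) v₀).target) :
    VectorField.mpullbackWithin 𝓘(ℝ, EB × F) (I.prod 𝓘(ℝ, F))
      (extChartAt (I.prod 𝓘(ℝ, F)) v₀).symm (fun v => vertical I F v.snd (W v.proj))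
      (Set.range (I.prod 𝓘(ℝ, F))) y =
    ((0, (trivializationAt F V v₀.proj ⟨(extChartAt I v₀.proj).symm y.1, W _⟩).2) : EB × F) := by
  set v := (extChartAt (I.prod 𝓘(ℝ, F)) v₀).symm y with hv
  have hvs : v ∈ (extChartAt (I.prod 𝓘(ℝ, F)) v₀).source := PartialEquiv.map_target _ hy
  rw [extChartAt_source] at hvs
  obtain ⟨h₁, h₂⟩ := mem_of_mem_chart_source_totalSpace hvs
  have hy₁ : (extChartAt I v₀.proj).symm y.1 = v.proj := by
    have h₃ : extChartAt (I.prod 𝓘(ℝ, F)) v₀ v = y := PartialEquiv.right_inv _ hy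
    rw [extChartAt_totalSpace_apply h₂] at h₃
    rw [← h₃]
    exact PartialEquiv.left_inv _ (by rwa [extChartAt_source])
  rw [hy₁]
  have h₄ := mfderiv_extChartAt_vertical (I := I) (v₀ := v₀) h₁ h₂ v.snd (W v.proj)
  rw [← h₄]
  -- The pull-back inverts the derivative of the inverse chart, and this inverse is the derivative
  -- of the chart.
  have h₅ : (mfderivWithin 𝓘(ℝ, EB × F) (I.prod 𝓘(ℝ, F)) (extChartAt (I.prod 𝓘(ℝ, F)) v₀).symm
      (Set.range (I.prod 𝓘(ℝ, F))) y).inverse =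
      mfderiv (I.prod 𝓘(ℝ, F)) 𝓘(ℝ, EB × F) (extChartAt (I.prod 𝓘(ℝ, F)) v₀) v :=
    ContinuousLinearMap.inverse_eq
      (mfderivWithin_extChartAt_symm_comp_mfderiv_extChartAt hy)
      (mfderiv_extChartAt_comp_mfderivWithin_extChartAt_symm hy)
  exact congrArg (fun L => L (vertical I F v.snd (W v.proj))) h₅

/-- Vertical vector fields that are constant along the fibres commute. -/
theorem mlieBracket_vertical [I.Boundaryless] (W W' : ∀ x, V x) (v₀ : TotalSpace F V) :
    VectorField.mlieBracket (I.prod 𝓘(ℝ, F)) (fun v => vertical I F v.snd (W v.proj))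
      (fun v => vertical I F v.snd (W' v.proj)) v₀ = 0 := by
  -- In the chart the field points along the fibre and depends on the base coordinate only. Both
  -- terms of the bracket thus differentiate in directions along which the field is constant,
  -- whatever the regularity of `W` and `W'`.
  let k : (∀ x, V x) → EB → EB × F := fun W z =>
    (0, (trivializationAt F V v₀.proj ⟨(extChartAt I v₀.proj).symm z, W _⟩).2)
  have hk : ∀ W : ∀ x, V x, (VectorField.mpullbackWithin 𝓘(ℝ, EB × F) (I.prod 𝓘(ℝ, F))
      (extChartAt (I.prod 𝓘(ℝ, F)) v₀).symm (fun v => vertical I F v.snd (W v.proj))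
      (Set.range (I.prod 𝓘(ℝ, F))) : EB × F → EB × F) =ᶠ[𝓝 (extChartAt (I.prod 𝓘(ℝ, F)) v₀ v₀)]
      fun y => k W y.1 := by
    intro W
    filter_upwards [extChartAt_target_mem_nhds (I := I.prod 𝓘(ℝ, F)) v₀] with y hy
    exact mpullbackWithin_vertical W hy
  rw [← VectorField.mlieBracketWithin_univ, VectorField.mlieBracketWithin_apply]
  have key : VectorField.lieBracket ℝ (VectorField.mpullbackWithin 𝓘(ℝ, EB × F) (I.prod 𝓘(ℝ, F))
      (extChartAt (I.prod 𝓘(ℝ, F)) v₀).symm (fun v => vertical I F v.snd (W v.proj))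
      (Set.range (I.prod 𝓘(ℝ, F)))) (VectorField.mpullbackWithin 𝓘(ℝ, EB × F) (I.prod 𝓘(ℝ, F))
      (extChartAt (I.prod 𝓘(ℝ, F)) v₀).symm (fun v => vertical I F v.snd (W' v.proj))
      (Set.range (I.prod 𝓘(ℝ, F)))) (extChartAt (I.prod 𝓘(ℝ, F)) v₀ v₀) = 0 := by
    refine ((hk W).lieBracket_vectorField_eq (hk W')).trans ?_
    have hz : ∀ W W' : ∀ x, V x, ∀ p : EB × F,
        fderiv ℝ (fun y : EB × F => k W y.1) p (k W' p.1) = 0 := fun W W' p =>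
      fderiv_comp_fst_apply_zero (k W) p _
    rw [VectorField.lieBracket_eq]
    change fderiv ℝ (fun y : EB × F => k W' y.1) _ (k W _) -
      fderiv ℝ (fun y : EB × F => k W y.1) _ (k W' _) = 0
    rw [hz, hz, sub_zero]
  -- Without boundary the model has full range, and the bracket within it is the ordinary one.
  have hs : (extChartAt (I.prod 𝓘(ℝ, F)) v₀).symm ⁻¹' Set.univ ∩ Set.range (I.prod 𝓘(ℝ, F)) =
      Set.univ := by
    rw [ModelWithCorners.range_eq_univ, Set.preimage_univ, Set.inter_univ]
  have hs' := congrArg (fun s : Set (EB × F) => VectorField.lieBracketWithin ℝ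
    (VectorField.mpullbackWithin 𝓘(ℝ, EB × F) (I.prod 𝓘(ℝ, F))
      (extChartAt (I.prod 𝓘(ℝ, F)) v₀).symm (fun v => vertical I F v.snd (W v.proj))
      (Set.range (I.prod 𝓘(ℝ, F)))) (VectorField.mpullbackWithin 𝓘(ℝ, EB × F) (I.prod 𝓘(ℝ, F))
      (extChartAt (I.prod 𝓘(ℝ, F)) v₀).symm (fun v => vertical I F v.snd (W' v.proj))
      (Set.range (I.prod 𝓘(ℝ, F)))) s (extChartAt (I.prod 𝓘(ℝ, F)) v₀ v₀)) hs
  have hs'' := (hs'.trans (congrFun VectorField.lieBracketWithin_univ _)).trans key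
  exact (congrArg (mfderiv (I.prod 𝓘(ℝ, F)) 𝓘(ℝ, EB × F) (extChartAt (I.prod 𝓘(ℝ, F)) v₀)
    v₀).inverse hs'').trans (map_zero _)

end VerticalBracket

/-! ### Right-invariant vector fields of the groupoid of a 2-term complex -/

section ComplexGroupoidAlgebroid

set_option linter.unusedSectionVars false

variable {EB HB B : Type*} [NormedAddCommGroup EB] [NormedSpace ℝ EB] [TopologicalSpace HB]
  {I : ModelWithCorners ℝ EB HB} [TopologicalSpace B] [ChartedSpace HB B] [IsManifold I ∞ B]
  {FC : Type*} [NormedAddCommGroup FC] [NormedSpace ℝ FC]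
  {C : B → Type*} [TopologicalSpace (TotalSpace FC C)]
  [∀ x, TopologicalSpace (C x)] [∀ x, AddCommGroup (C x)] [∀ x, Module ℝ (C x)]
  [FiberBundle FC C] [VectorBundle ℝ FC C] [ContMDiffVectorBundle ∞ FC C I]
  {F : Type*} [NormedAddCommGroup F] [NormedSpace ℝ F]
  {V : B → Type*} [TopologicalSpace (TotalSpace F V)]
  [∀ x, TopologicalSpace (V x)] [∀ x, AddCommGroup (V x)] [∀ x, Module ℝ (V x)]
  [FiberBundle F V] [VectorBundle ℝ F V] [ContMDiffVectorBundle ∞ F V I]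

namespace SmoothBundleHom

variable (d : SmoothBundleHom I FC C F V)

/-- The tangent vector of the source fibre at the unit over `e` in the direction of `c`. -/
def unitVertical (e : TotalSpace F V) :
    C e.proj →ₗ[ℝ] TangentSpace (I.prod 𝓘(ℝ, FC × F)) (d.complexGroupoid.unit e) :=
  verticalₗ I (FC × F) (V := C ×ᵇ V) (x := e.proj) (0, e.snd) ∘ₗ inl I FC C F V e.proj

lemma mfderiv_snd_vertical {x : B} (v w : (C ×ᵇ V) x) :
    mfderiv (I.prod 𝓘(ℝ, FC × F)) (I.prod 𝓘(ℝ, F)) d.complexGroupoid.src ⟨x, v⟩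
      (vertical I (FC × F) (V := C ×ᵇ V) v w) = vertical I F v.2 w.2 :=
  SmoothBundleHom.mfderiv_toMap_vertical (V := C ×ᵇ V) snd v w

lemma unitVertical_injective (e : TotalSpace F V) : Function.Injective (d.unitVertical e) := by
  intro c c' h
  exact (Prod.ext_iff.1 (vertical_injective (I := I) (F := FC × F) (V := C ×ᵇ V) _ h)).1

/-- The projection to `B` factors through the source, so a vector killed by ds is vertical, of some
direction (c, v). Its image under ds is the vertical vector of `v`, which forces `v = 0`. -/
lemma range_unitVertical (e : TotalSpace F V) : Set.range (d.unitVertical e) =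
    {w | mfderiv (I.prod 𝓘(ℝ, FC × F)) (I.prod 𝓘(ℝ, F)) d.complexGroupoid.src
      (d.complexGroupoid.unit e) w = 0} := by
  ext w
  constructor
  · rintro ⟨c, rfl⟩
    exact (d.mfderiv_snd_vertical (x := e.proj) (0, e.snd) (c, 0)).trans
      (map_zero (verticalₗ I F e.snd))
  · intro h
    have h₀ : mfderiv (I.prod 𝓘(ℝ, FC × F)) I
        (fun u : TotalSpace (FC × F) (C ×ᵇ V) => u.proj) (d.complexGroupoid.unit e) w = 0 := by
      have h₁ := mfderiv_comp_apply (I' := I.prod 𝓘(ℝ, F)) (I'' := I)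
        (d.complexGroupoid.unit e) (g := fun u : TotalSpace F V => u.proj)
        (f := d.complexGroupoid.src) ((contMDiff_proj V (n := 1)).mdifferentiable (by simp) _)
        (d.complexGroupoid.contMDiff_src.mdifferentiable (by simp) _) w
      exact h₁.trans ((congrArg _ h).trans (map_zero _))
    obtain ⟨⟨c, v⟩, rfl⟩ := exists_vertical (V := C ×ᵇ V) (x := e.proj) h₀
    have h₂ := Eq.trans (d.mfderiv_snd_vertical (x := e.proj) (0, e.snd) (c, v)).symm h
    obtain rfl : v = 0 := vertical_injective (I := I) (F := F) e.snd
      (h₂.trans (map_zero (verticalₗ I F e.snd)).symm)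
    exact ⟨c, rfl⟩

lemma mfderiv_complexTgt_vertical {x : B} (v : (C ×ᵇ V) x) (c : C x) :
    mfderiv (I.prod 𝓘(ℝ, FC × F)) (I.prod 𝓘(ℝ, F)) d.complexTgt.toMap ⟨x, v⟩
      (vertical I (FC × F) (V := C ×ᵇ V) v (c, 0)) = vertical I F (d.complexTgt x v) (d x c) := by
  refine (d.complexTgt.mfderiv_toMap_vertical v (c, 0)).trans ?_
  exact congrArg (vertical I F (d.complexTgt x v)) (zero_add (d x c))

/-- The target is linear on the fibres and sends `(c, 0)` to ∂c, so the groupoid has as anchor the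
vertical lift of ∂c. The image sits over e + ∂0, which has to be rewritten to `e`. -/
lemma tangentMap_tgt_unitVertical (e : TotalSpace F V) (c : C e.proj) :
    tangentMap (I.prod 𝓘(ℝ, FC × F)) (I.prod 𝓘(ℝ, F)) d.complexGroupoid.tgt
      ⟨d.complexGroupoid.unit e, d.unitVertical e c⟩ = ⟨e, vertical I F e.snd (d e.proj c)⟩ := by
  have h : d.complexTgt e.proj (0, e.snd) = e.snd := by
    change e.snd + d e.proj 0 = e.snd
    rw [map_zero, add_zero]
  refine (congrArg (TotalSpace.mk _)
    (d.mfderiv_complexTgt_vertical (x := e.proj) (0, e.snd) c)).trans ?_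
  change (⟨⟨e.proj, d.complexTgt e.proj (0, e.snd)⟩, vertical I F (d.complexTgt e.proj (0, e.snd))
    (d e.proj c)⟩ : TangentBundle (I.prod 𝓘(ℝ, F)) (TotalSpace F V)) = _
  rw [h]

lemma contMDiff_unitVertical {EN HN N : Type*} [NormedAddCommGroup EN] [NormedSpace ℝ EN]
    [TopologicalSpace HN] {IN : ModelWithCorners ℝ EN HN} [TopologicalSpace N] [ChartedSpace HN N]
    {e : N → TotalSpace F V} {c : ∀ n, C (e n).proj} (he : ContMDiff IN (I.prod 𝓘(ℝ, F)) ∞ e)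
    (hc : ContMDiff IN (I.prod 𝓘(ℝ, FC)) ∞ (fun n => (⟨(e n).proj, c n⟩ : TotalSpace FC C))) :
    ContMDiff IN (I.prod 𝓘(ℝ, FC × F)).tangent ∞ (fun n =>
      (⟨d.complexGroupoid.unit (e n), d.unitVertical (e n) (c n)⟩ :
        TangentBundle (I.prod 𝓘(ℝ, FC × F)) (TotalSpace (FC × F) (C ×ᵇ V)))) :=
  (contMDiff_vertical_iff (V := C ×ᵇ V) (F := FC × F) (b := fun n => (e n).proj)
    (v := fun n => (0, (e n).snd)) (w := fun n => (c n, 0))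
    (d.complexGroupoid.contMDiff_unit.comp he)).2 ((inl I FC C F V).contMDiff_toFun.comp hc)

/-- The vector field on `C ⊕ V` with value `(X(e + ∂c), 0)` at `(c, e)`. -/
def rightLift (X : ∀ e : TotalSpace F V, C e.proj) (g : TotalSpace (FC × F) (C ×ᵇ V)) :
    TangentSpace (I.prod 𝓘(ℝ, FC × F)) g :=
  vertical I (FC × F) (V := C ×ᵇ V) (x := g.proj) g.snd (X (d.complexTgt.toMap g), 0)

/-- Right multiplication by `(a, v)` carries the line `(t c, e)` in the source fibre to the line `(a
+ t c, v)`, and the velocities are compared at `t = 0`. -/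
lemma mfderivWithin_mul_unitVertical (g : TotalSpace (FC × F) (C ×ᵇ V))
    (c : C g.proj) :
    mfderivWithin (I.prod 𝓘(ℝ, FC × F)) (I.prod 𝓘(ℝ, FC × F))
      (fun h => d.complexGroupoid.mul h g) {h | d.complexGroupoid.src h = d.complexGroupoid.tgt g}
      (d.complexGroupoid.unit (d.complexGroupoid.tgt g))
      (d.unitVertical (d.complexGroupoid.tgt g) c) =
    vertical I (FC × F) (V := C ×ᵇ V) (x := g.proj) g.snd (c, 0) := by
  obtain ⟨x, a, v⟩ := g
  let e : V x := d.complexTgt x (a, v)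
  let f : TotalSpace (FC × F) (C ×ᵇ V) → TotalSpace (FC × F) (C ×ᵇ V) :=
    fun h => d.complexGroupoid.mul h ⟨x, a, v⟩
  let S : Set (TotalSpace (FC × F) (C ×ᵇ V)) :=
    {h | d.complexGroupoid.src h = d.complexGroupoid.tgt ⟨x, a, v⟩}
  let γ : ℝ → TotalSpace (FC × F) (C ×ᵇ V) := fun t =>
    ⟨x, ((0, e) : (C ×ᵇ V) x) + t • ((c, 0) : (C ×ᵇ V) x)⟩
  have hγ : ContMDiff 𝓘(ℝ, ℝ) (I.prod 𝓘(ℝ, FC × F)) ∞ γ := contMDiff_line x _ _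
  have hγS : ∀ t, γ t ∈ S := by
    intro t
    refine congrArg (TotalSpace.mk x) ?_
    change e + t • (0 : V x) = e
    rw [smul_zero, add_zero]
  have hγ₀ : γ 0 = d.complexGroupoid.unit (d.complexGroupoid.tgt ⟨x, a, v⟩) := by
    refine congrArg (TotalSpace.mk x) ?_
    rw [zero_smul, add_zero]
    rfl
  have hf : MDifferentiableWithinAt (I.prod 𝓘(ℝ, FC × F)) (I.prod 𝓘(ℝ, FC × F)) f S (γ 0) := by
    have hm := d.complexGroupoid.contMDiffOn_mul (γ 0, ⟨x, a, v⟩) (hγS 0)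
    have hp : ContMDiffWithinAt (I.prod 𝓘(ℝ, FC × F))
        ((I.prod 𝓘(ℝ, FC × F)).prod (I.prod 𝓘(ℝ, FC × F))) ∞
        (fun h : TotalSpace (FC × F) (C ×ᵇ V) =>
          (h, (⟨x, a, v⟩ : TotalSpace (FC × F) (C ×ᵇ V)))) S (γ 0) :=
      contMDiffWithinAt_id.prodMk contMDiffWithinAt_const
    exact (hm.comp (γ 0) hp fun h hh => hh).mdifferentiableWithinAt (by simp)
  have hfγ : f ∘ γ = fun t : ℝ => ⟨x, ((a, v) : (C ×ᵇ V) x) + t • ((c, 0) : (C ×ᵇ V) x)⟩ := by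
    funext t
    refine (complexMul_mk x _ a _ v).trans (congrArg (TotalSpace.mk x) (Prod.ext ?_ ?_))
    · change a + (0 + t • c) = a + t • c
      rw [zero_add]
    · change v = v + t • (0 : V x)
      rw [smul_zero, add_zero]
  -- A derivative within the source fibre need not be unique, but its value on the velocity of a
  -- curve in the fibre is: it is the velocity of the image curve.
  have h₁ := hf.hasMFDerivWithinAt.comp (0 : ℝ)
    (hγ.mdifferentiable (by simp) 0).hasMFDerivAt.hasMFDerivWithinAt
    (s := Set.univ) (fun t _ => hγS t)
  have h₂ := (hasMFDerivWithinAt_univ.1 h₁).mfderiv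
  rw [hγ₀, hfγ] at h₂
  exact (congrArg (fun L => L (1 : ℝ)) h₂).symm

lemma rightLift_add (X Y : ∀ e : TotalSpace F V, C e.proj) :
    d.rightLift (fun e => X e + Y e) = d.rightLift X + d.rightLift Y := by
  funext g
  refine Eq.trans ?_ (map_add (verticalₗ I (FC × F) (V := C ×ᵇ V) (x := g.proj) g.snd)
    (X (d.complexTgt.toMap g), 0) (Y (d.complexTgt.toMap g), 0))
  exact congrArg (vertical I (FC × F) (V := C ×ᵇ V) (x := g.proj) g.snd)
    (Prod.ext rfl (add_zero (0 : V g.proj)).symm)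

lemma rightLift_zero : d.rightLift (fun _ => 0) = 0 := by
  funext g
  exact map_zero (verticalₗ I (FC × F) (V := C ×ᵇ V) (x := g.proj) g.snd)

/-- Functions on `V` act on right-invariant fields through pull-back by the target, since the field
at `g` evaluates the section there. -/
lemma rightLift_smul (f : TotalSpace F V → ℝ) (X : ∀ e : TotalSpace F V, C e.proj) :
    d.rightLift (fun e => f e • X e) = (f ∘ d.complexTgt.toMap) • d.rightLift X := by
  funext g
  refine Eq.trans ?_ (map_smul (verticalₗ I (FC × F) (V := C ×ᵇ V) (x := g.proj) g.snd)
    (f (d.complexTgt.toMap g)) (X (d.complexTgt.toMap g), 0))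
  exact congrArg (vertical I (FC × F) (V := C ×ᵇ V) (x := g.proj) g.snd)
    (Prod.ext rfl (smul_zero (A := V g.proj) (f (d.complexTgt.toMap g))).symm)

lemma contMDiff_rightLift {X : ∀ e : TotalSpace F V, C e.proj}
    (hX : ContMDiff (I.prod 𝓘(ℝ, F)) (I.prod 𝓘(ℝ, FC)) ∞
      (fun e => (⟨e.proj, X e⟩ : TotalSpace FC C))) :
    ContMDiff (I.prod 𝓘(ℝ, FC × F)) (I.prod 𝓘(ℝ, FC × F)).tangent ∞ (fun g =>
      (⟨g, d.rightLift X g⟩ :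
        TangentBundle (I.prod 𝓘(ℝ, FC × F)) (TotalSpace (FC × F) (C ×ᵇ V)))) :=
  (contMDiff_vertical_iff (V := C ×ᵇ V) (F := FC × F)
    (b := fun g : TotalSpace (FC × F) (C ×ᵇ V) => g.proj) (v := fun g => g.snd)
    (w := fun g => (X (d.complexTgt.toMap g), 0)) contMDiff_id).2
    ((inl I FC C F V).contMDiff_toFun.comp (hX.comp d.complexTgt.contMDiff_toFun))

lemma mlieBracket_rightLift_add [FiniteDimensional ℝ EB] [FiniteDimensional ℝ FC]
    [FiniteDimensional ℝ F] (Z : ∀ g : TotalSpace (FC × F) (C ×ᵇ V),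
      TangentSpace (I.prod 𝓘(ℝ, FC × F)) g) {X Y : ∀ e : TotalSpace F V, C e.proj}
    (hX : ContMDiff (I.prod 𝓘(ℝ, F)) (I.prod 𝓘(ℝ, FC)) ∞
      (fun e => (⟨e.proj, X e⟩ : TotalSpace FC C)))
    (hY : ContMDiff (I.prod 𝓘(ℝ, F)) (I.prod 𝓘(ℝ, FC)) ∞
      (fun e => (⟨e.proj, Y e⟩ : TotalSpace FC C))) (g : TotalSpace (FC × F) (C ×ᵇ V)) :
    VectorField.mlieBracket (I.prod 𝓘(ℝ, FC × F)) Z (d.rightLift fun e => X e + Y e) g =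
      VectorField.mlieBracket (I.prod 𝓘(ℝ, FC × F)) Z (d.rightLift X) g +
      VectorField.mlieBracket (I.prod 𝓘(ℝ, FC × F)) Z (d.rightLift Y) g := by
  have : CompleteSpace (EB × FC × F) := FiniteDimensional.complete ℝ _
  have : IsManifold (I.prod 𝓘(ℝ, FC × F)) 2 (TotalSpace (FC × F) (C ×ᵇ V)) :=
    inferInstance
  rw [rightLift_add]
  exact VectorField.mlieBracket_add_right ((d.contMDiff_rightLift hX).mdifferentiable (by simp) g)
    ((d.contMDiff_rightLift hY).mdifferentiable (by simp) g)

/-- The Leibniz rule for vector fields differentiates `f` composed with the target; by the chain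
rule this is the derivative of `f` along the vertical lift of ∂X, the same term as in the Leibniz
rule of the kernel algebroid. -/
lemma mlieBracket_rightLift_smul [FiniteDimensional ℝ EB] [FiniteDimensional ℝ FC]
    [FiniteDimensional ℝ F] {f : TotalSpace F V → ℝ} (hf : ContMDiff (I.prod 𝓘(ℝ, F)) 𝓘(ℝ, ℝ) ∞ f)
    (X : ∀ e : TotalSpace F V, C e.proj) {Y : ∀ e : TotalSpace F V, C e.proj}
    (hY : ContMDiff (I.prod 𝓘(ℝ, F)) (I.prod 𝓘(ℝ, FC)) ∞
      (fun e => (⟨e.proj, Y e⟩ : TotalSpace FC C))) (g : TotalSpace (FC × F) (C ×ᵇ V)) :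
    VectorField.mlieBracket (I.prod 𝓘(ℝ, FC × F)) (d.rightLift X)
      (d.rightLift fun e => f e • Y e) g =
    dirDeriv (I.prod 𝓘(ℝ, F)) f (d.complexTgt.toMap g)
      (vertical I F (d.complexTgt.toMap g).snd (d g.proj (X (d.complexTgt.toMap g)))) •
        d.rightLift Y g +
    f (d.complexTgt.toMap g) •
      VectorField.mlieBracket (I.prod 𝓘(ℝ, FC × F)) (d.rightLift X) (d.rightLift Y) g := by
  have : CompleteSpace (EB × FC × F) := FiniteDimensional.complete ℝ _
  have : IsManifold (I.prod 𝓘(ℝ, FC × F)) 2 (TotalSpace (FC × F) (C ×ᵇ V)) :=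
    inferInstance
  have hfd := hf.mdifferentiable (by simp) (d.complexTgt.toMap g)
  have htd := d.complexTgt.contMDiff_toFun.mdifferentiable (by simp) g
  rw [rightLift_smul]
  have h := VectorField.mlieBracket_smul_right (I := I.prod 𝓘(ℝ, FC × F)) (V := d.rightLift X)
    (W := d.rightLift Y) (f := f ∘ d.complexTgt.toMap) (x := g) (hfd.comp g htd)
    ((d.contMDiff_rightLift hY).mdifferentiable (by simp) g)
  refine h.trans (congrArg (fun r : ℝ => r • d.rightLift Y g + _) ?_)
  refine (mfderiv_comp_apply g hfd htd (d.rightLift X g)).trans ?_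
  exact congrArg (mfderiv (I.prod 𝓘(ℝ, F)) 𝓘(ℝ, ℝ) f (d.complexTgt.toMap g))
    (d.mfderiv_complexTgt_vertical (x := g.proj) g.snd (X (d.complexTgt.toMap g)))

lemma mlieBracket_rightLift_proj [I.Boundaryless] (c c' : ∀ x, C x)
    (g : TotalSpace (FC × F) (C ×ᵇ V)) :
    VectorField.mlieBracket (I.prod 𝓘(ℝ, FC × F)) (d.rightLift fun e => c e.proj)
      (d.rightLift fun e => c' e.proj) g = 0 :=
  mlieBracket_vertical (V := C ×ᵇ V) (fun x => (c x, 0)) (fun x => (c' x, 0)) g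

end SmoothBundleHom

end ComplexGroupoidAlgebroid

/-! ### The core and the kernel of a double vector bundle -/

section BundleSum

variable {B F : Type*} {V : B → Type*} [∀ x, AddCommGroup (V x)]

lemma isBundleSum_mk {b : B} (x y : V b) :
    IsBundleSum (⟨b, x⟩ : TotalSpace F V) ⟨b, y⟩ ⟨b, x + y⟩ := ⟨b, x, y, rfl, rfl, rfl⟩

lemma IsBundleSum.eq_fibreAdd {u v w : TotalSpace F V} (h : IsBundleSum u v w) :
    w = fibreAdd u v := by
  obtain ⟨b, x, y, rfl, rfl, rfl⟩ := h
  exact (fibreAdd_mk b x y).symm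

lemma IsBundleSum.unique {u v w w' : TotalSpace F V} (h : IsBundleSum u v w)
    (h' : IsBundleSum u v w') : w = w' := h.eq_fibreAdd.trans h'.eq_fibreAdd.symm

lemma IsBundleSum.cancel {u v v' w : TotalSpace F V} (h : IsBundleSum u v w)
    (h' : IsBundleSum u v' w) : v = v' := by
  obtain ⟨b, x, y, rfl, rfl, rfl⟩ := h
  obtain ⟨b', x', y', h₁, rfl, h₃⟩ := h'
  obtain rfl : b = b' := congrArg TotalSpace.proj h₁
  obtain rfl : x = x' := TotalSpace.mk_inj.1 h₁
  obtain rfl : y = y' := add_left_cancel (TotalSpace.mk_inj.1 h₃)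
  rfl

lemma exists_mk_of_proj_eq {V : B → Type*} {u : TotalSpace F V} {b : B} (h : u.proj = b) :
    ∃ x, u = ⟨b, x⟩ := by
  subst h
  exact ⟨u.snd, rfl⟩

end BundleSum

section DoubleVectorBundle

set_option linter.unusedSectionVars false

variable {EM HM M : Type*} [NormedAddCommGroup EM] [NormedSpace ℝ EM] [TopologicalSpace HM]
  {IM : ModelWithCorners ℝ EM HM} [TopologicalSpace M] [ChartedSpace HM M] [IsManifold IM ∞ M]
  {FA : Type*} [NormedAddCommGroup FA] [NormedSpace ℝ FA] [FiniteDimensional ℝ FA]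
  {A : M → Type*} [TopologicalSpace (TotalSpace FA A)]
  [∀ x, TopologicalSpace (A x)] [∀ x, AddCommGroup (A x)] [∀ x, Module ℝ (A x)]
  [FiberBundle FA A] [VectorBundle ℝ FA A] [ContMDiffVectorBundle ∞ FA A IM]
  {FE : Type*} [NormedAddCommGroup FE] [NormedSpace ℝ FE] [FiniteDimensional ℝ FE]
  {E : M → Type*} [TopologicalSpace (TotalSpace FE E)]
  [∀ x, TopologicalSpace (E x)] [∀ x, AddCommGroup (E x)] [∀ x, Module ℝ (E x)]
  [FiberBundle FE E] [VectorBundle ℝ FE E] [ContMDiffVectorBundle ∞ FE E IM]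
  {FD : Type*} [NormedAddCommGroup FD] [NormedSpace ℝ FD] [FiniteDimensional ℝ FD]
  {D : TotalSpace FE E → Type*} [TopologicalSpace (TotalSpace FD D)]
  [∀ x, TopologicalSpace (D x)] [∀ x, AddCommGroup (D x)] [∀ x, Module ℝ (D x)]
  [FiberBundle FD D] [VectorBundle ℝ FD D]
  [ContMDiffVectorBundle ∞ FD D (IM.prod 𝓘(ℝ, FE))]
  {FD' : Type*} [NormedAddCommGroup FD'] [NormedSpace ℝ FD'] [FiniteDimensional ℝ FD']
  {D' : TotalSpace FA A → Type*} [TopologicalSpace (TotalSpace FD' D')]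
  [∀ x, TopologicalSpace (D' x)] [∀ x, AddCommGroup (D' x)] [∀ x, Module ℝ (D' x)]
  [FiberBundle FD' D'] [VectorBundle ℝ FD' D']
  [ContMDiffVectorBundle ∞ FD' D' (IM.prod 𝓘(ℝ, FA))]

namespace DoubleVectorBundle

variable (𝒟 : DoubleVectorBundle IM FA A FE E FD D FD' D')

lemma p_zero (e : TotalSpace FE E) : 𝒟.p ⟨e, 0⟩ = ⟨e.proj, 0⟩ := (𝒟.kernel e).zero_mem

lemma p_coreIncl {m : M} (c : 𝒟.Core m) : 𝒟.p (𝒟.coreIncl c) = ⟨m, 0⟩ := c.2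

lemma contMDiff_p : ContMDiff ((IM.prod 𝓘(ℝ, FE)).prod 𝓘(ℝ, FD)) (IM.prod 𝓘(ℝ, FA)) ∞ 𝒟.p :=
  (contMDiff_proj D').comp 𝒟.toA.contMDiff

/-- The projection `p` on the fibres of `D → E`. -/
def pₗ (e : TotalSpace FE E) : D e →ₗ[ℝ] A e.proj := 𝒟.linear_p.choose e

lemma p_mk (e : TotalSpace FE E) (x : D e) : 𝒟.p ⟨e, x⟩ = ⟨e.proj, 𝒟.pₗ e x⟩ :=
  𝒟.linear_p.choose_spec e x

lemma mem_kernel_iff (e : TotalSpace FE E) (x : D e) : x ∈ 𝒟.kernel e ↔ 𝒟.pₗ e x = 0 := by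
  change 𝒟.p ⟨e, x⟩ = ⟨e.proj, 0⟩ ↔ _
  rw [p_mk, TotalSpace.mk_inj]

lemma kernel_eq_ker (e : TotalSpace FE E) : 𝒟.kernel e = LinearMap.ker (𝒟.pₗ e) := by
  ext x
  rw [mem_kernel_iff, LinearMap.mem_ker]

/-- The preimage of `a` is the zero vector of the fibre of D → A over `a`: by linearity p_D sends it
to 0_m. -/
lemma pₗ_zero_surjective (m : M) : Function.Surjective (𝒟.pₗ ⟨m, 0⟩) := by
  intro a
  obtain ⟨L, hL⟩ := 𝒟.linear_pD
  obtain ⟨x, hx⟩ := exists_mk_of_proj_eq (u := 𝒟.toA.symm ⟨⟨m, a⟩, 0⟩) (b := ⟨m, 0⟩)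
    ((hL ⟨m, a⟩ 0).trans (by rw [map_zero]))
  refine ⟨x, TotalSpace.mk_inj.1 ((𝒟.p_mk ⟨m, 0⟩ x).symm.trans ?_)⟩
  rw [← hx, p, Diffeomorph.apply_symm_apply]

variable {𝒟} in
lemma mem_kernel_of_isSumA {e : TotalSpace FE E} {c : 𝒟.Core e.proj} {x : D e}
    (h : 𝒟.IsSumA ⟨e, 0⟩ (𝒟.coreIncl c) ⟨e, x⟩) : x ∈ 𝒟.kernel e := by
  obtain ⟨a, y, z, h₁, -, h₃⟩ := h
  exact (congrArg TotalSpace.proj h₃).trans ((congrArg TotalSpace.proj h₁).symm.trans (𝒟.p_zero e))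

/-- Both summands lie over 0 in A, so they can be added there; p_D of the sum is e + 0 = e, so the
sum is a vector of D_e. -/
lemma exists_isSumA (e : TotalSpace FE E) (c : 𝒟.Core e.proj) :
    ∃ x : D e, 𝒟.IsSumA ⟨e, 0⟩ (𝒟.coreIncl c) ⟨e, x⟩ := by
  obtain ⟨y, hy⟩ := exists_mk_of_proj_eq (𝒟.p_zero e)
  obtain ⟨z, hz⟩ := exists_mk_of_proj_eq (𝒟.p_coreIncl c)
  obtain ⟨L, hL⟩ := 𝒟.linear_pD
  beta_reduce at hL
  have hLy : (⟨e.proj, L ⟨e.proj, 0⟩ y⟩ : TotalSpace FE E) = ⟨e.proj, e.snd⟩ := by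
    rw [← hL ⟨e.proj, 0⟩ y, ← hy, Diffeomorph.symm_apply_apply]
  have hLz : (⟨e.proj, L ⟨e.proj, 0⟩ z⟩ : TotalSpace FE E) = ⟨e.proj, 0⟩ := by
    rw [← hL ⟨e.proj, 0⟩ z, ← hz, Diffeomorph.symm_apply_apply]
    rfl
  obtain ⟨x, hx⟩ := exists_mk_of_proj_eq (u := 𝒟.toA.symm ⟨⟨e.proj, 0⟩, y + z⟩) (b := e) (by
    refine (hL _ _).trans ?_
    rw [map_add, TotalSpace.mk_inj.1 hLy, TotalSpace.mk_inj.1 hLz, add_zero])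
  refine ⟨x, ⟨e.proj, 0⟩, y, z, hy, hz, ?_⟩
  rw [← hx, Diffeomorph.apply_symm_apply]

/-- The witness is the difference of `x` and 0_e in the fibre of D → A; it lies over e - e = 0 in E,
hence in the core. -/
lemma exists_core_of_mem_kernel {e : TotalSpace FE E} {x : D e} (hx : x ∈ 𝒟.kernel e) :
    ∃ c : 𝒟.Core e.proj, 𝒟.IsSumA ⟨e, 0⟩ (𝒟.coreIncl c) ⟨e, x⟩ := by
  obtain ⟨y, hy⟩ := exists_mk_of_proj_eq (𝒟.p_zero e)
  obtain ⟨z, hz⟩ := exists_mk_of_proj_eq (show (𝒟.toA ⟨e, x⟩).proj = _ from hx)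
  obtain ⟨L, hL⟩ := 𝒟.linear_pD
  beta_reduce at hL
  have hLy : (⟨e.proj, L ⟨e.proj, 0⟩ y⟩ : TotalSpace FE E) = ⟨e.proj, e.snd⟩ := by
    rw [← hL ⟨e.proj, 0⟩ y, ← hy, Diffeomorph.symm_apply_apply]
  have hLz : (⟨e.proj, L ⟨e.proj, 0⟩ z⟩ : TotalSpace FE E) = ⟨e.proj, e.snd⟩ := by
    rw [← hL ⟨e.proj, 0⟩ z, ← hz, Diffeomorph.symm_apply_apply]
  obtain ⟨c, hc⟩ := exists_mk_of_proj_eq (u := 𝒟.toA.symm ⟨⟨e.proj, 0⟩, z - y⟩)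
    (b := (⟨e.proj, 0⟩ : TotalSpace FE E)) (by
      refine (hL _ _).trans ?_
      rw [map_sub, TotalSpace.mk_inj.1 hLy, TotalSpace.mk_inj.1 hLz, sub_self])
  have hc' : 𝒟.toA ⟨⟨e.proj, 0⟩, c⟩ = ⟨⟨e.proj, 0⟩, z - y⟩ := by
    rw [← hc, Diffeomorph.apply_symm_apply]
  refine ⟨⟨c, congrArg TotalSpace.proj hc'⟩, ⟨e.proj, 0⟩, y, z - y, hy, hc', ?_⟩
  rw [hz, add_sub_cancel]

/-- The element `0_e +_A c` of `D_e`. -/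
def addCore (e : TotalSpace FE E) (c : 𝒟.Core e.proj) : D e := (𝒟.exists_isSumA e c).choose

lemma isSumA_addCore (e : TotalSpace FE E) (c : 𝒟.Core e.proj) :
    𝒟.IsSumA ⟨e, 0⟩ (𝒟.coreIncl c) ⟨e, 𝒟.addCore e c⟩ := (𝒟.exists_isSumA e c).choose_spec

variable {𝒟} in
lemma eq_addCore {e : TotalSpace FE E} {c : 𝒟.Core e.proj} {x : D e}
    (h : 𝒟.IsSumA ⟨e, 0⟩ (𝒟.coreIncl c) ⟨e, x⟩) : x = 𝒟.addCore e c :=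
  TotalSpace.mk_inj.1 (𝒟.toA.injective (IsBundleSum.unique h (𝒟.isSumA_addCore e c)))

/-- The interchange law for 0_e, 0_e, c, c': the sum in D_e of the two translates is 0_e + 0_e = 0_e
translated by c + c'. -/
lemma addCore_add (e : TotalSpace FE E) (c c' : 𝒟.Core e.proj) :
    𝒟.addCore e (c + c') = 𝒟.addCore e c + 𝒟.addCore e c' := by
  refine (eq_addCore (𝒟.interchange ⟨e, 0⟩ ⟨e, 0⟩ (𝒟.coreIncl c) (𝒟.coreIncl c') ⟨e, 0⟩
    (𝒟.coreIncl (c + c')) ⟨e, 𝒟.addCore e c⟩ ⟨e, 𝒟.addCore e c'⟩ _ ?_ ?_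
    (𝒟.isSumA_addCore e c) (𝒟.isSumA_addCore e c') (isBundleSum_mk _ _))).symm
  · simpa using isBundleSum_mk (F := FD) (0 : D e) 0
  · exact isBundleSum_mk (F := FD) (V := D) c.1 c'.1

lemma addCore_injective (e : TotalSpace FE E) : Function.Injective (𝒟.addCore e) := by
  intro c c' h
  have h₁ := 𝒟.isSumA_addCore e c
  rw [h] at h₁
  exact Subtype.ext (TotalSpace.mk_inj.1
    (𝒟.toA.injective (IsBundleSum.cancel h₁ (𝒟.isSumA_addCore e c'))))

lemma mk_addCore (e : TotalSpace FE E) (c : 𝒟.Core e.proj) :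
    (⟨e, 𝒟.addCore e c⟩ : TotalSpace FD D) =
      𝒟.toA.symm (fibreAdd (𝒟.toA ⟨e, 0⟩) (𝒟.toA (𝒟.coreIncl c))) := by
  rw [← (𝒟.isSumA_addCore e c).eq_fibreAdd, Diffeomorph.symm_apply_apply]

/-! ### The isomorphism of p_E^*C onto ker p. -/

namespace CoreBundle

variable {𝒟} (𝒞 : 𝒟.CoreBundle)

lemma contMDiff_incl :
    ContMDiff (IM.prod 𝓘(ℝ, 𝒞.Model)) ((IM.prod 𝓘(ℝ, FE)).prod 𝓘(ℝ, FD)) ∞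
      (fun c : TotalSpace 𝒞.Model 𝒞.Fibre => 𝒟.coreIncl (show 𝒟.Core c.proj from c.snd)) :=
  letI : TopologicalSpace (TotalSpace (EuclideanSpace ℝ (Fin 𝒞.rank)) 𝒟.Core) :=
    𝒞.topologicalSpace
  letI : FiberBundle (EuclideanSpace ℝ (Fin 𝒞.rank)) 𝒟.Core := 𝒞.fiberBundle
  𝒞.contMDiff_coreIncl

lemma contMDiff_addCore :
    ContMDiff ((IM.prod 𝓘(ℝ, FE)).prod 𝓘(ℝ, 𝒞.Model)) ((IM.prod 𝓘(ℝ, FE)).prod 𝓘(ℝ, FD)) ∞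
      (fun v : TotalSpace 𝒞.Model 𝒞.Pullback =>
        (⟨v.proj, 𝒟.addCore v.proj v.snd⟩ : TotalSpace FD D)) := by
  have h₁ := contMDiff_proj (IB := IM.prod 𝓘(ℝ, FE)) (F := 𝒞.Model) (n := ∞) 𝒞.Pullback
  have h₂ := ((contMDiff_pullback_iff (smoothProj IM FE E)).1
    (contMDiff_id (M := TotalSpace 𝒞.Model 𝒞.Pullback)
      (I := (IM.prod 𝓘(ℝ, FE)).prod 𝓘(ℝ, 𝒞.Model)))).2
  have h₃ := 𝒟.toA.contMDiff.comp (𝒞.contMDiff_incl.comp h₂)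
  have h₄ := 𝒟.toA.contMDiff.comp ((contMDiff_zeroSection ℝ D).comp h₁)
  refine (𝒟.toA.symm.contMDiff.comp (h₄.fibreAdd h₃ ?_)).congr fun v => 𝒟.mk_addCore _ _
  intro v
  exact (𝒟.p_coreIncl _).trans (𝒟.p_zero v.proj).symm

/-- The axiom on scalars concerns the scalar multiplication of D → A, not that of D → E. Here
homogeneity comes from additivity: `t ↦ 0_e +_A t c` is additive and continuous in coordinates,
hence real linear. -/
lemma addCore_smul (e : TotalSpace FE E) (t : ℝ) (c : 𝒞.Pullback e) :
    𝒟.addCore e (t • c) = t • 𝒟.addCore e c := by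
  have h₂ := mem_baseSet_trivializationAt FD D e
  have hl := (trivializationAt FD D e).linear ℝ h₂
  have hz : 𝒟.addCore e 0 = 0 := by simpa using 𝒟.addCore_add e 0 0
  let g : ℝ →+ FD :=
    { toFun := fun t => (trivializationAt FD D e ⟨e, 𝒟.addCore e (t • c)⟩).2
      map_zero' := by
        rw [zero_smul]
        refine (congrArg (fun y => (trivializationAt FD D e ⟨e, y⟩).2) hz).trans ?_
        have := hl.2 0 0
        rwa [zero_smul, zero_smul] at this
      map_add' := fun s t => by
        rw [add_smul]
        refine (congrArg (fun y => (trivializationAt FD D e ⟨e, y⟩).2)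
          (𝒟.addCore_add e _ _)).trans (hl.1 _ _) }
  have hg : Continuous g := by
    have h₁ : ContMDiff 𝓘(ℝ, ℝ) ((IM.prod 𝓘(ℝ, FE)).prod 𝓘(ℝ, 𝒞.Model)) ∞
        (fun t : ℝ => (⟨e, t • c⟩ : TotalSpace 𝒞.Model 𝒞.Pullback)) :=
      contMDiff_id.fibreSMul (f := fun _ => ⟨e, c⟩) contMDiff_const
    have h₃ := 𝒞.contMDiff_addCore.comp h₁
    exact (fun t : ℝ => (contMDiffAt_totalSpace.1 (h₃ t)).2.continuousAt) |>
      continuous_iff_continuousAt.2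
  have key := map_smul (g.toRealLinearMap hg) t 1
  rw [smul_eq_mul, mul_one] at key
  refine ((trivializationAt FD D e).continuousLinearEquivAt ℝ e h₂).injective ?_
  rw [map_smul]
  refine Eq.trans key ?_
  change t • (trivializationAt FD D e ⟨e, 𝒟.addCore e ((1 : ℝ) • c)⟩).2 = _
  rw [one_smul]
  rfl

/-- The isomorphism `(c, e) ↦ 0_e +_A c` of `p_E^* C` onto the kernel of `p`, as a morphism
into `D`. -/
def inclusion :
    SmoothBundleHom (IM.prod 𝓘(ℝ, FE)) 𝒞.Model 𝒞.Pullback FD D where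
  toFun e :=
    { toFun := fun c => 𝒟.addCore e c
      map_add' := 𝒟.addCore_add e
      map_smul' := 𝒞.addCore_smul e }
  contMDiff_toFun := 𝒞.contMDiff_addCore

lemma inclusion_injective (e : TotalSpace FE E) : Function.Injective (𝒞.inclusion e) :=
  𝒟.addCore_injective e

lemma range_inclusion (e : TotalSpace FE E) : LinearMap.range (𝒞.inclusion e) = 𝒟.kernel e := by
  ext x
  constructor
  · rintro ⟨c, rfl⟩
    exact mem_kernel_of_isSumA (𝒟.isSumA_addCore e c)
  · intro hx
    obtain ⟨c, hc⟩ := 𝒟.exists_core_of_mem_kernel hx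
    exact ⟨c, (eq_addCore hc).symm⟩

end CoreBundle

end DoubleVectorBundle

/-! ### The core bundle and the core anchor -/

namespace DoubleVectorBundle

variable (𝒟 : DoubleVectorBundle IM FA A FE E FD D FD' D')

variable (IM FE E) in
/-- The zero section of `E` as a smooth map. -/
def zeroMap : C^∞⟮IM, M; IM.prod 𝓘(ℝ, FE), TotalSpace FE E⟯ :=
  ⟨fun m => ⟨m, 0⟩, contMDiff_zeroSection ℝ E⟩

instance (m : M) : AddCommGroup ((⇑(zeroMap IM FE E) *ᵖ D) m) :=
  inferInstanceAs (AddCommGroup (D ⟨m, 0⟩))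

/-- The projection `p` over the zero section of `E`. -/
def pOverZero : SmoothBundleHom IM FD (⇑(zeroMap IM FE E) *ᵖ D) FA A where
  toFun m := 𝒟.pₗ ⟨m, 0⟩
  contMDiff_toFun := by
    have h := ((contMDiff_pullback_iff (zeroMap IM FE E)).1
      (contMDiff_id (M := TotalSpace FD (⇑(zeroMap IM FE E) *ᵖ D)) (I := IM.prod 𝓘(ℝ, FD)))).2
    exact (𝒟.contMDiff_p.comp h).congr fun v => (𝒟.p_mk ⟨v.proj, 0⟩ v.snd).symm

/-- The inclusion of the core into `D` over the zero section of `E`. -/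
def coreInclₗ (m : M) : 𝒟.Core m →ₗ[ℝ] (⇑(zeroMap IM FE E) *ᵖ D) m :=
  (𝒟.kernel ⟨m, 0⟩).subtype

/-- The core is the kernel of p over the zero section of E, where p is a surjective morphism to A
over the identity of M. -/
theorem nonempty_coreBundle : Nonempty 𝒟.CoreBundle := by
  obtain ⟨r, t, fb, vb, cb, h⟩ := exists_kernelBundle (K := 𝒟.Core) 𝒟.pOverZero
    𝒟.pₗ_zero_surjective 𝒟.coreInclₗ (fun m => Subtype.val_injective)
    (fun m => Topology.IsInducing.subtypeVal)
    (fun m => ((𝒟.kernel ⟨m, 0⟩).range_subtype).trans (𝒟.kernel_eq_ker _))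
  exact ⟨{ rank := r, contMDiff_coreIncl := ((contMDiff_pullback_iff (zeroMap IM FE E)).1 h).2 }⟩

end DoubleVectorBundle

/-! ### The core anchor and the anchor on ker p. -/

namespace VBAlgebroid

variable (𝒟 : VBAlgebroid IM FA A FE E FD D FD' D') (𝒞 : 𝒟.CoreBundle)

/-- The projection of ρ_D(c) to TM is ρ_A(p(c)) = ρ_A(0) = 0, so ρ_D(c) is vertical. -/
lemma exists_anchor_core {m : M} (c : 𝒟.Core m) :
    ∃ w : E m, 𝒟.algD.anchor ⟨m, 0⟩ c.1 = vertical IM FE 0 w := by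
  refine exists_vertical ?_
  have h := 𝒟.anchor_proj (𝒟.coreIncl c)
  rw [𝒟.p_coreIncl c] at h
  have h' := (TotalSpace.mk_inj (b := m)).1 h
  rwa [map_zero] at h'

/-- The core anchor on the fibres. -/
def coreAnchorₗ (m : M) : 𝒟.Core m →ₗ[ℝ] E m where
  toFun c := (𝒟.exists_anchor_core c).choose
  map_add' c c' := by
    refine vertical_injective (I := IM) (F := FE) 0 ?_
    refine (𝒟.exists_anchor_core (c + c')).choose_spec.symm.trans ?_
    refine (map_add (𝒟.algD.anchor ⟨m, 0⟩) c.1 c'.1).trans ?_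
    refine Eq.trans ?_ (map_add (verticalₗ IM FE (0 : E m)) _ _).symm
    exact congrArg₂ (· + ·) (𝒟.exists_anchor_core c).choose_spec
      (𝒟.exists_anchor_core c').choose_spec
  map_smul' t c := by
    refine vertical_injective (I := IM) (F := FE) 0 ?_
    refine (𝒟.exists_anchor_core (t • c)).choose_spec.symm.trans ?_
    refine (map_smul (𝒟.algD.anchor ⟨m, 0⟩) t c.1).trans ?_
    refine Eq.trans ?_ (map_smul (verticalₗ IM FE (0 : E m)) t _).symm
    exact congrArg (t • ·) (𝒟.exists_anchor_core c).choose_spec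

lemma anchor_core {m : M} (c : 𝒟.Core m) :
    𝒟.algD.anchor ⟨m, 0⟩ c.1 = vertical IM FE 0 (𝒟.coreAnchorₗ m c) :=
  (𝒟.exists_anchor_core c).choose_spec

variable {𝒟} in
/-- The core anchor `∂ : C → E`. -/
def coreAnchor : SmoothBundleHom IM 𝒞.Model 𝒞.Fibre FE E where
  toFun := 𝒟.coreAnchorₗ
  contMDiff_toFun := by
    have h₁ : ContMDiff (IM.prod 𝓘(ℝ, 𝒞.Model)) (IM.prod 𝓘(ℝ, FE)) ∞
        (fun v : TotalSpace 𝒞.Model 𝒞.Fibre => (⟨v.proj, 0⟩ : TotalSpace FE E)) :=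
      (contMDiff_zeroSection ℝ E).comp (contMDiff_proj 𝒞.Fibre)
    -- Smoothness of ∂ is inherited from its vertical lift along the zero section, which is ρ_D on
    -- the core.
    refine (contMDiff_vertical_iff h₁).1 ?_
    refine (𝒟.algD.contMDiff_anchor.comp 𝒞.contMDiff_incl).congr fun v => ?_
    exact (congrArg (TotalSpace.mk _) (𝒟.anchor_core v.snd)).symm

theorem isCoreAnchor_coreAnchor : 𝒟.IsCoreAnchor 𝒞 (coreAnchor 𝒞) := fun _ c =>
  (congrArg (TotalSpace.mk _) (𝒟.anchor_core c)).trans (verticalLift_eq (I := IM) (F := FE) _ _).symm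

/-- The vector of T(E ⊕ E) that realizes the sum has zero first component, so it projects to 0 in TM
and is vertical, of direction (p, q). The two components force p = 0 and q = w, and addition maps it
to the vertical vector of `w` at e + 0. -/
lemma isTangentSum_zero_vertical {e : TotalSpace FE E} {w : E e.proj}
    {v : TangentBundle (IM.prod 𝓘(ℝ, FE)) (TotalSpace FE E)}
    (h : IsTangentSum IM ⟨e, 0⟩ ⟨⟨e.proj, 0⟩, vertical IM FE 0 w⟩ v) :
    v = ⟨e, vertical IM FE e.snd w⟩ := by
  obtain ⟨⟨⟨m, a, b⟩, u⟩, h₁, h₂, rfl⟩ := h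
  obtain rfl : (⟨m, a⟩ : TotalSpace FE E) = e := congrArg TotalSpace.proj h₁
  obtain rfl : b = 0 := TotalSpace.mk_inj.1 (congrArg TotalSpace.proj h₂)
  let f₁ : SmoothBundleHom IM (FE × FE) (E ×ᵇ E) FE E := SmoothBundleHom.fst
  let f₂ : SmoothBundleHom IM (FE × FE) (E ×ᵇ E) FE E := SmoothBundleHom.snd
  have h₁' : mfderiv (IM.prod 𝓘(ℝ, FE × FE)) (IM.prod 𝓘(ℝ, FE)) f₁.toMap ⟨m, a, 0⟩ u = 0 :=
    TotalSpace.mk_inj.1 h₁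
  have h₂' : mfderiv (IM.prod 𝓘(ℝ, FE × FE)) (IM.prod 𝓘(ℝ, FE)) f₂.toMap ⟨m, a, 0⟩ u =
      vertical IM FE 0 w := TotalSpace.mk_inj.1 h₂
  have hu : mfderiv (IM.prod 𝓘(ℝ, FE × FE)) IM
      (fun z : TotalSpace (FE × FE) (E ×ᵇ E) => z.proj) ⟨m, a, 0⟩ u = 0 := by
    have h₃ := mfderiv_comp_apply (I' := IM.prod 𝓘(ℝ, FE)) (I'' := IM)
      (⟨m, a, 0⟩ : TotalSpace (FE × FE) (E ×ᵇ E)) (g := fun z : TotalSpace FE E => z.proj)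
      (f := f₁.toMap)
      ((contMDiff_proj E (n := 1)).mdifferentiable (by simp) _)
      (f₁.contMDiff_toFun.mdifferentiable (by simp) _) u
    rw [h₁', map_zero] at h₃
    exact h₃
  obtain ⟨⟨p, q⟩, rfl⟩ := exists_vertical hu
  rw [f₁.mfderiv_toMap_vertical] at h₁'
  rw [f₂.mfderiv_toMap_vertical] at h₂'
  obtain rfl : q = w := vertical_injective _ h₂'
  obtain rfl : p = 0 := vertical_injective a (h₁'.trans (map_zero (verticalₗ IM FE a)).symm)
  have h₃ := (f₁.add f₂).mfderiv_toMap_vertical (x := m) (a, 0) (0, q)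
  refine (congrArg (TotalSpace.mk _) h₃).trans ?_
  have e₁ : (f₁.add f₂) m (a, 0) = a := add_zero a
  have e₂ : (f₁.add f₂) m (0, q) = q := zero_add q
  rw [e₂]
  change (⟨⟨m, (f₁.add f₂) m (a, 0)⟩, vertical IM FE ((f₁.add f₂) m (a, 0)) q⟩ :
    TangentBundle (IM.prod 𝓘(ℝ, FE)) (TotalSpace FE E)) = _
  rw [e₁]

/-- Additivity of ρ_D over TE → TM turns 0_e +_A c into the sum of the zero vector at `e` and the
vertical lift of ∂c at 0, which is the vertical lift of ∂c at `e`. -/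
theorem anchor_inclusion (e : TotalSpace FE E) (c : 𝒞.Pullback e) :
    𝒟.algD.anchor e (𝒞.inclusion e c) = vertical IM FE e.snd (coreAnchor 𝒞 e.proj c) := by
  have h := 𝒟.anchor_add _ _ _ (𝒟.isSumA_addCore e c)
  have h₀ : 𝒟.algD.anchorMap ⟨e, 0⟩ = ⟨e, 0⟩ := congrArg (TotalSpace.mk e) (map_zero _)
  have h₁ : 𝒟.algD.anchorMap (𝒟.coreIncl (m := e.proj) c) =
    ⟨⟨e.proj, 0⟩, vertical IM FE 0 (coreAnchor 𝒞 e.proj c)⟩ :=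
    congrArg (TotalSpace.mk _) (𝒟.anchor_core (m := e.proj) c)
  rw [h₀, h₁] at h
  exact TotalSpace.mk_inj.1 (isTangentSum_zero_vertical h)

end VBAlgebroid

/-! ### The Lie algebroid of the kernel -/

namespace DoubleVectorBundle.CoreBundle

variable {𝒟 : DoubleVectorBundle IM FA A FE E FD D FD' D'} (𝒞 : 𝒟.CoreBundle)

/-- The section of `p_E^* C` with value `f(e) c(m)` at `e ∈ E_m`. -/
def smulCore (f : C^∞⟮IM.prod 𝓘(ℝ, FE), TotalSpace FE E; 𝓘(ℝ, ℝ), ℝ⟯)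
    (c : Cₛ^∞⟮IM; 𝒞.Model, 𝒞.Fibre⟯) : Cₛ^∞⟮IM.prod 𝓘(ℝ, FE); 𝒞.Model, 𝒞.Pullback⟯ where
  toFun e := f e • (c e.proj : 𝒞.Fibre e.proj)
  contMDiff_toFun := by
    refine (contMDiff_pullback_iff (smoothProj IM FE E)).2 ⟨contMDiff_id, ?_⟩
    exact f.contMDiff.fibreSMul (f := fun e : TotalSpace FE E =>
      (⟨e.proj, c e.proj⟩ : TotalSpace 𝒞.Model 𝒞.Fibre))
      (c.contMDiff.comp (contMDiff_proj E))

/-- The cutoff enters squared: one factor extends the coefficients by zero, the other the local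
frame. -/
lemma smul_eq_sum_frame {m₀ m : M} {ι : Type*} [Fintype ι] (b : Module.Basis ι ℝ 𝒞.Model)
    (v : 𝒞.Fibre m) {s : ℝ} (hs : m ∉ (trivializationAt 𝒞.Model 𝒞.Fibre m₀).baseSet → s = 0) :
    (s * s) • v = ∑ i, (s * b.repr (trivializationAt 𝒞.Model 𝒞.Fibre m₀ ⟨m, v⟩).2 i) •
      (s • (trivializationAt 𝒞.Model 𝒞.Fibre m₀).symm m (b i)) := by
  by_cases hm : m ∈ (trivializationAt 𝒞.Model 𝒞.Fibre m₀).baseSet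
  · have h₁ : v = (trivializationAt 𝒞.Model 𝒞.Fibre m₀).symmₗ ℝ m
        (trivializationAt 𝒞.Model 𝒞.Fibre m₀ ⟨m, v⟩).2 := by
      rw [Trivialization.coe_symmₗ _ hm, Trivialization.symm_apply_apply_mk _ hm]
    conv_lhs => rw [h₁, ← b.sum_repr (trivializationAt 𝒞.Model 𝒞.Fibre m₀ ⟨m, v⟩).2, map_sum,
      Finset.smul_sum]
    refine Finset.sum_congr rfl fun i _ => ?_
    rw [map_smul, Trivialization.coe_symmₗ _ hm, smul_smul, smul_smul]
    congr 1
    ring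
  · simp only [hs hm, zero_mul, zero_smul, Finset.sum_const_zero]

/-- Near a point, sections of `p_E^* C` are linear combinations of pull-backs of sections of `C`. -/
lemma exists_coreFrame [T2Space M] [FiniteDimensional ℝ EM] (e₀ : TotalSpace FE E) :
    ∃ (k : ℕ) (c : Fin k → Cₛ^∞⟮IM; 𝒞.Model, 𝒞.Fibre⟯)
      (χ : C^∞⟮IM.prod 𝓘(ℝ, FE), TotalSpace FE E; 𝓘(ℝ, ℝ), ℝ⟯), χ e₀ = 1 ∧
      ∀ X : Cₛ^∞⟮IM.prod 𝓘(ℝ, FE); 𝒞.Model, 𝒞.Pullback⟯,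
        ∃ f : Fin k → C^∞⟮IM.prod 𝓘(ℝ, FE), TotalSpace FE E; 𝓘(ℝ, ℝ), ℝ⟯,
          ∀ e, χ e • X e = (∑ i, 𝒞.smulCore (f i) (c i)) e := by
  set t := trivializationAt 𝒞.Model 𝒞.Fibre e₀.proj
  obtain ⟨ψ, -, hψ⟩ := (SmoothBumpFunction.nhds_basis_tsupport (I := IM) e₀.proj).mem_iff.1
    (t.open_baseSet.mem_nhds (mem_baseSet_trivializationAt 𝒞.Model 𝒞.Fibre e₀.proj))
  have hψs : ContMDiff IM 𝓘(ℝ, ℝ) ∞ ψ := ψ.contMDiff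
  have hψ₀ : ∀ m ∉ t.baseSet, ψ m = 0 := fun m hm =>
    image_eq_zero_of_notMem_tsupport fun h => hm (hψ h)
  let b := Module.finBasis ℝ 𝒞.Model
  let c : Fin (Module.finrank ℝ 𝒞.Model) → Cₛ^∞⟮IM; 𝒞.Model, 𝒞.Fibre⟯ := fun i =>
    ⟨(ψ : M → ℝ) • fun m => t.symm m (b i), ContMDiffOn.smul_section_of_tsupport hψs.contMDiffOn
      t.open_baseSet hψ (contMDiffOn_trivializationAt_symm (V₁ := 𝒞.Fibre) e₀.proj (b i))⟩
  refine ⟨_, c, ⟨fun e => ψ e.proj * ψ e.proj, ?_⟩, ?_, fun X => ?_⟩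
  · exact (hψs.comp (contMDiff_proj E)).mul (hψs.comp (contMDiff_proj E))
  · change ψ e₀.proj * ψ e₀.proj = 1
    rw [ψ.eq_one, mul_one]
  let x : TotalSpace FE E → TotalSpace 𝒞.Model 𝒞.Fibre := fun e => ⟨e.proj, X e⟩
  have hx : ContMDiff (IM.prod 𝓘(ℝ, FE)) (IM.prod 𝓘(ℝ, 𝒞.Model)) ∞ x :=
    ((contMDiff_pullback_iff (smoothProj IM FE E)).1 X.contMDiff).2
  let l : Fin (Module.finrank ℝ 𝒞.Model) → 𝒞.Model →L[ℝ] ℝ := fun i =>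
    LinearMap.toContinuousLinearMap (b.coord i)
  refine ⟨fun i => ⟨fun e => ψ e.proj * l i (t (x e)).2, ?_⟩, fun e => ?_⟩
  · have h₁ : ContMDiff (IM.prod 𝓘(ℝ, FE)) 𝓘(ℝ, ℝ) ∞ (fun e : TotalSpace FE E => ψ e.proj) :=
      hψs.comp (contMDiff_proj E)
    -- The fibre coordinate is smooth only over the base set of `t`, but the support of the product
    -- lies over the support of ψ, inside that set.
    refine contMDiff_of_tsupport fun e he => ?_
    have he' : e.proj ∈ t.baseSet := by
      refine hψ ?_
      have hcl : IsClosed ((fun e : TotalSpace FE E => e.proj) ⁻¹' tsupport ψ) :=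
        (isClosed_tsupport _).preimage (FiberBundle.continuous_proj FE E)
      refine closure_minimal ?_ hcl he
      intro e' h'
      refine subset_closure fun h₀ => h' ?_
      change ψ e'.proj * _ = 0
      rw [h₀, zero_mul]
    have h₂ : ContMDiffAt (IM.prod 𝓘(ℝ, FE)) 𝓘(ℝ, 𝒞.Model) ∞ (fun e => (t (x e)).2) e :=
      ((Trivialization.contMDiffAt_iff (e := t) ((Trivialization.mem_source _).2 he')).1 (hx e)).2
    exact (h₁ e).mul ((l i).contMDiff.contMDiffAt.comp e h₂)
  · refine Eq.trans ?_ (congrFun (map_sum (ContMDiffSection.coeAddHom (IM.prod 𝓘(ℝ, FE))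
      𝒞.Model ∞ 𝒞.Pullback) _ Finset.univ) e).symm
    refine Eq.trans ?_ (Finset.sum_apply e Finset.univ _).symm
    exact 𝒞.smul_eq_sum_frame b (X e) (hψ₀ e.proj)

/-- A skew-symmetric form on the sections of `p_E^* C` that is tensorial at a point and vanishes
on the pull-backs of sections of `C` is zero. -/
theorem tensor_eq_zero [T2Space M] [FiniteDimensional ℝ EM] {W : Type*} [AddCommGroup W] [Module ℝ W]
    (e₀ : TotalSpace FE E)
    (T : Cₛ^∞⟮IM.prod 𝓘(ℝ, FE); 𝒞.Model, 𝒞.Pullback⟯ →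
      Cₛ^∞⟮IM.prod 𝓘(ℝ, FE); 𝒞.Model, 𝒞.Pullback⟯ → W)
    (hadd : ∀ X Y Y', T X (Y + Y') = T X Y + T X Y') (hswap : ∀ X Y, T X Y = -T Y X)
    (hsmul : ∀ (f : C^∞⟮IM.prod 𝓘(ℝ, FE), TotalSpace FE E; 𝓘(ℝ, ℝ), ℝ⟯) X Y fY,
      (∀ e, fY e = f e • Y e) → T X fY = f e₀ • T X Y)
    (hcore : ∀ (c c' : Cₛ^∞⟮IM; 𝒞.Model, 𝒞.Fibre⟯) (X Y : Cₛ^∞⟮IM.prod 𝓘(ℝ, FE); 𝒞.Model, 𝒞.Pullback⟯),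
      (∀ e : TotalSpace FE E, (X e : 𝒞.Fibre e.proj) = c e.proj) → (∀ e : TotalSpace FE E, (Y e : 𝒞.Fibre e.proj) = c' e.proj) →
      T X Y = 0) (X Y) : T X Y = 0 := by
  obtain ⟨k, c, χ, hχ, hX⟩ := 𝒞.exists_coreFrame e₀
  have h1 : ∀ i (e : TotalSpace FE E), (𝒞.smulCore 1 (c i) e : 𝒞.Fibre e.proj) = c i e.proj :=
    fun i e => one_smul ℝ (c i e.proj)
  have hf : ∀ f i e, 𝒞.smulCore f (c i) e = f e • 𝒞.smulCore 1 (c i) e := fun f i e =>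
    congrArg (f e • ·) (h1 i e).symm
  have hsum : ∀ (X) (Z : Fin k → _), T X (∑ i, Z i) = ∑ i, T X (Z i) := fun X Z =>
    map_sum (AddMonoidHom.mk' (T X) (hadd X)) Z Finset.univ
  have key : ∀ X Y, (∀ i, T X (𝒞.smulCore 1 (c i)) = 0) → T X Y = 0 := by
    intro X Y h
    obtain ⟨f, hf'⟩ := hX Y
    -- Since χ(e₀) = 1, the section `Y` may be replaced by χY, a global combination of pull-backs.
    have h₁ := hsmul χ X Y (∑ i, 𝒞.smulCore (f i) (c i)) fun e => (hf' e).symm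
    rw [hχ, one_smul, hsum] at h₁
    rw [← h₁]
    refine Finset.sum_eq_zero fun i _ => ?_
    rw [hsmul (f i) X (𝒞.smulCore 1 (c i)) _ (hf (f i) i), h, smul_zero]
  refine key X Y fun i => ?_
  -- Skew-symmetry moves the remaining arbitrary section to the second slot, where `key` reduces it
  -- to the frame as well.
  rw [hswap, key _ X fun j => hcore (c i) (c j) _ _ (h1 i) (h1 j), neg_zero]

end DoubleVectorBundle.CoreBundle

/-! ### Closure of ker p under the bracket. -/

namespace VBAlgebroid

variable (𝒟 : VBAlgebroid IM FA A FE E FD D FD' D') (𝒞 : 𝒟.CoreBundle)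

lemma isCoreSection_inclusion {X : Cₛ^∞⟮IM.prod 𝓘(ℝ, FE); 𝒞.Model, 𝒞.Pullback⟯}
    {c : Cₛ^∞⟮IM; 𝒞.Model, 𝒞.Fibre⟯} (h : ∀ e : TotalSpace FE E, (X e : 𝒞.Fibre e.proj) = c e.proj) :
    𝒟.IsCoreSection (𝒞.inclusion.mapSection X) := by
  refine ⟨c, 𝒞.contMDiff_incl.comp c.contMDiff, fun e => ?_⟩
  have := 𝒟.isSumA_addCore e (X e)
  rw [h] at this
  have h₂ : 𝒞.inclusion.mapSection X e = 𝒟.addCore e (c e.proj) := congrArg (𝒟.addCore e) (h e)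
  rwa [h₂]

/-- The image under p of a bracket of kernel sections is tensorial, because p kills the derivative
term of the Leibniz rule; it vanishes on core sections, which commute. -/
lemma bracket_inclusion_mem_range [T2Space M] [FiniteDimensional ℝ EM]
    (X Y : Cₛ^∞⟮IM.prod 𝓘(ℝ, FE); 𝒞.Model, 𝒞.Pullback⟯) (e : TotalSpace FE E) :
    𝒟.algD.bracket (𝒞.inclusion.mapSection X) (𝒞.inclusion.mapSection Y) e ∈
      LinearMap.range (𝒞.inclusion e) := by
  rw [𝒞.range_inclusion, DoubleVectorBundle.mem_kernel_iff]
  refine 𝒞.tensor_eq_zero e (fun X Y => 𝒟.pₗ e (𝒟.algD.bracket (𝒞.inclusion.mapSection X)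
    (𝒞.inclusion.mapSection Y) e)) (fun X Y Y' => ?_) (fun X Y => ?_) (fun f X Y fY h => ?_)
    (fun c c' X Y hX hY => ?_) X Y
  · rw [SmoothBundleHom.mapSection_add, map_add]
    exact map_add (𝒟.pₗ e) _ _
  · rw [LieAlgebroid.bracket_swap]
    exact map_neg (𝒟.pₗ e) _
  · rw [𝒟.algD.leibniz f _ (𝒞.inclusion.mapSection Y) _ (fun e => by
      rw [SmoothBundleHom.mapSection_apply, h, map_smul, SmoothBundleHom.mapSection_apply])]
    have h₀ : 𝒟.pₗ e (𝒞.inclusion.mapSection Y e) = 0 := by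
      rw [← DoubleVectorBundle.mem_kernel_iff, ← 𝒞.range_inclusion]
      exact ⟨Y e, rfl⟩
    rw [map_add, map_smul, map_smul, h₀, smul_zero, add_zero]
  · rw [𝒟.bracket_core_core _ _ (𝒟.isCoreSection_inclusion 𝒞 hX)
      (𝒟.isCoreSection_inclusion 𝒞 hY)]
    exact map_zero (𝒟.pₗ e)

/-- The kernel of `p` is a Lie subalgebroid. -/
theorem exists_kernelAlgebroid [T2Space M] [FiniteDimensional ℝ EM] :
    ∃ 𝒦 : LieAlgebroid (IM.prod 𝓘(ℝ, FE)) 𝒞.Model 𝒞.Pullback,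
      𝒦.IsMorphism 𝒟.algD 𝒞.inclusion :=
  𝒟.algD.exists_of_injective 𝒞.inclusion_injective (𝒟.bracket_inclusion_mem_range 𝒞)

lemma isKernelAlgebroid {𝒦 : LieAlgebroid (IM.prod 𝓘(ℝ, FE)) 𝒞.Model 𝒞.Pullback}
    (h : 𝒦.IsMorphism 𝒟.algD 𝒞.inclusion) : 𝒟.IsKernelAlgebroid 𝒞 𝒦 :=
  ⟨𝒞.inclusion, 𝒟.isSumA_addCore, 𝒞.inclusion_injective, 𝒞.range_inclusion, h⟩

end VBAlgebroid

/-! ### The integration of the kernel -/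

namespace VBAlgebroid

variable (𝒟 : VBAlgebroid IM FA A FE E FD D FD' D') (𝒞 : 𝒟.CoreBundle)

set_option maxHeartbeats 800000 in
/-- The groupoid `C ⊕ E ⇉ E` integrates the kernel of `p`. -/
theorem integrates_kernelAlgebroid [FiniteDimensional ℝ EM] [IM.Boundaryless] [T2Space M]
    {𝒦 : LieAlgebroid (IM.prod 𝓘(ℝ, FE)) 𝒞.Model 𝒞.Pullback}
    (h : 𝒦.IsMorphism 𝒟.algD 𝒞.inclusion) :
    (coreAnchor 𝒞).complexGroupoid.Integrates 𝒦 := by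
  set d := coreAnchor 𝒞
  have hanchor : ∀ (e : TotalSpace FE E) (c : 𝒞.Pullback e),
      𝒦.anchor e c = vertical IM FE e.snd (d e.proj c) := fun e c =>
    (h.1 e c).symm.trans (𝒟.anchor_inclusion 𝒞 e c)
  have hsm : ∀ X : Cₛ^∞⟮IM.prod 𝓘(ℝ, FE); 𝒞.Model, 𝒞.Pullback⟯,
      ContMDiff (IM.prod 𝓘(ℝ, FE)) (IM.prod 𝓘(ℝ, 𝒞.Model)) ∞
        (fun e : TotalSpace FE E => (⟨e.proj, X e⟩ : TotalSpace 𝒞.Model 𝒞.Fibre)) := fun X =>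
    ((contMDiff_pullback_iff (smoothProj IM FE E)).1 X.contMDiff).2
  refine ⟨d.unitVertical, ?_, d.unitVertical_injective, d.range_unitVertical, fun e c => ?_, ?_⟩
  · have hid := (contMDiff_pullback_iff (smoothProj IM FE E)).1
      (contMDiff_id (M := TotalSpace 𝒞.Model 𝒞.Pullback)
        (I := (IM.prod 𝓘(ℝ, FE)).prod 𝓘(ℝ, 𝒞.Model)))
    exact d.contMDiff_unitVertical (e := fun v : TotalSpace 𝒞.Model 𝒞.Pullback => v.proj)
      (c := fun v => v.snd) hid.1 hid.2
  · exact (d.tangentMap_tgt_unitVertical e c).trans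
      (congrArg (TotalSpace.mk e) (hanchor e c)).symm
  intro X Y g
  have hR : ∀ X : Cₛ^∞⟮IM.prod 𝓘(ℝ, FE); 𝒞.Model, 𝒞.Pullback⟯,
      d.complexGroupoid.rightInvariantField (V := 𝒞.Pullback) d.unitVertical X = d.rightLift X :=
    fun X =>
    funext fun g => d.mfderivWithin_mul_unitVertical g _
  rw [hR, hR, hR, ← sub_eq_zero]
  -- The defect between the two brackets at `g` is tensorial at the target of `g`, the point where
  -- right-invariant fields evaluate their sections.
  refine 𝒞.tensor_eq_zero (d.complexTgt.toMap g) (fun X Y =>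
    VectorField.mlieBracket (IM.prod 𝓘(ℝ, 𝒞.Model × FE)) (d.rightLift X) (d.rightLift Y) g -
      d.rightLift (𝒦.bracket X Y) g) (fun X Y Y' => ?_) (fun X Y => ?_) (fun f X Y fY hfY => ?_)
    (fun c c' X Y hX hY => ?_) X Y
  · have h₁ := d.mlieBracket_rightLift_add (d.rightLift X) (hsm Y) (hsm Y') g
    have h₂ := congrFun (d.rightLift_add (𝒦.bracket X Y) (𝒦.bracket X Y')) g
    have h₃ : d.rightLift (𝒦.bracket X (Y + Y')) g =
        d.rightLift (𝒦.bracket X Y) g + d.rightLift (𝒦.bracket X Y') g := by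
      rw [map_add]
      exact h₂
    rw [h₃]
    exact (congrArg (· - _) h₁).trans (add_sub_add_comm _ _ _ _)
  · have h₁ : d.rightLift (𝒦.bracket Y X) g = -d.rightLift (𝒦.bracket X Y) g := by
      have h₂ := congrFun (d.rightLift_smul (fun _ => -1) (𝒦.bracket X Y)) g
      rw [𝒦.bracket_swap Y X]
      refine Eq.trans (congrArg (fun Z => d.rightLift Z g) ?_) (h₂.trans (neg_one_smul ℝ _))
      funext e
      exact (neg_one_smul ℝ _).symm
    rw [h₁, VectorField.mlieBracket_swap_apply]
    abel
  · have h₁ := d.mlieBracket_rightLift_smul f.contMDiff X (hsm Y) g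
    have h₂ : d.rightLift fY = d.rightLift fun e => f e • Y e :=
      congrArg d.rightLift (funext hfY)
    have h₃ : d.rightLift (𝒦.bracket X fY) g =
        f (d.complexTgt.toMap g) • d.rightLift (𝒦.bracket X Y) g +
          dirDeriv (IM.prod 𝓘(ℝ, FE)) f (d.complexTgt.toMap g)
            (𝒦.anchor _ (X (d.complexTgt.toMap g))) • d.rightLift Y g := by
      let r : TotalSpace FE E → ℝ := fun e => dirDeriv (IM.prod 𝓘(ℝ, FE)) f e (𝒦.anchor e (X e))
      have h₄ : d.rightLift (𝒦.bracket X fY) =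
          d.rightLift fun e => f e • 𝒦.bracket X Y e + r e • Y e :=
        congrArg d.rightLift (funext (𝒦.leibniz f X Y fY hfY))
      rw [h₄]
      have h₅ := congrFun (d.rightLift_add (fun e => f e • 𝒦.bracket X Y e) fun e => r e • Y e) g
      exact h₅.trans (congrArg₂ (fun u v : TangentSpace (IM.prod 𝓘(ℝ, 𝒞.Model × FE)) g => u + v)
        (congrFun (d.rightLift_smul f (𝒦.bracket X Y)) g) (congrFun (d.rightLift_smul r Y) g))
    -- After `hanchor` the derivative terms of the two Leibniz rules are the same and cancel.
    rw [h₂, h₃, hanchor]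
    refine (congrArg (· - _) h₁).trans ?_
    rw [smul_sub, add_comm (dirDeriv _ _ _ _ • _)]
    exact add_sub_add_right_eq_sub _ _ _
  · have h₁ : d.rightLift X = d.rightLift fun e => c e.proj := congrArg d.rightLift (funext hX)
    have h₂ : d.rightLift Y = d.rightLift fun e => c' e.proj := congrArg d.rightLift (funext hY)
    -- Both sections are pull-backs, so their images in D are core sections and commute; injectivity
    -- of the inclusion brings this back to `𝒦`.
    have h₃ : 𝒦.bracket X Y = 0 := by
      refine SmoothBundleHom.mapSection_injective 𝒞.inclusion_injective ?_
      rw [h.2, 𝒟.bracket_core_core _ _ (𝒟.isCoreSection_inclusion 𝒞 hX)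
        (𝒟.isCoreSection_inclusion 𝒞 hY)]
      ext e
      exact (map_zero (𝒞.inclusion e)).symm
    have h₄ : d.rightLift (𝒦.bracket X Y) g = 0 := by
      rw [h₃]
      exact congrFun d.rightLift_zero g
    rw [h₁, h₂, h₄, sub_zero]
    exact d.mlieBracket_rightLift_proj _ _ g

end VBAlgebroid

end DoubleVectorBundle

end

/-- The kernel `K ≅ p_E^* C` of the extension `D → A` defined by a VB-algebroid `(D; A, E; M)` with
core `C` and core anchor `∂ : C → E` is integrated by a source-simply connected Lie groupoid, whose
underlying category is the 2-vector bundle `C ⊕ E ⇉ E` of the complex `∂ : C → E`. -/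
theorem proposition3
    {EM HM M : Type*} [NormedAddCommGroup EM] [NormedSpace ℝ EM] [FiniteDimensional ℝ EM]
    [TopologicalSpace HM] (IM : ModelWithCorners ℝ EM HM) [IM.Boundaryless]
    [TopologicalSpace M] [T2Space M] [SecondCountableTopology M]
    [ChartedSpace HM M] [IsManifold IM ∞ M]
    (FA : Type*) [NormedAddCommGroup FA] [NormedSpace ℝ FA] [FiniteDimensional ℝ FA]
    (A : M → Type*) [TopologicalSpace (TotalSpace FA A)]
    [∀ x, TopologicalSpace (A x)] [∀ x, AddCommGroup (A x)] [∀ x, Module ℝ (A x)]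
    [FiberBundle FA A] [VectorBundle ℝ FA A] [ContMDiffVectorBundle ∞ FA A IM]
    (FE : Type*) [NormedAddCommGroup FE] [NormedSpace ℝ FE] [FiniteDimensional ℝ FE]
    (E : M → Type*) [TopologicalSpace (TotalSpace FE E)]
    [∀ x, TopologicalSpace (E x)] [∀ x, AddCommGroup (E x)] [∀ x, Module ℝ (E x)]
    [FiberBundle FE E] [VectorBundle ℝ FE E] [ContMDiffVectorBundle ∞ FE E IM]
    (FD : Type*) [NormedAddCommGroup FD] [NormedSpace ℝ FD] [FiniteDimensional ℝ FD]
    (D : TotalSpace FE E → Type*) [TopologicalSpace (TotalSpace FD D)]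
    [∀ x, TopologicalSpace (D x)] [∀ x, AddCommGroup (D x)] [∀ x, Module ℝ (D x)]
    [FiberBundle FD D] [VectorBundle ℝ FD D]
    [ContMDiffVectorBundle ∞ FD D (IM.prod 𝓘(ℝ, FE))]
    (FD' : Type*) [NormedAddCommGroup FD'] [NormedSpace ℝ FD'] [FiniteDimensional ℝ FD']
    (D' : TotalSpace FA A → Type*) [TopologicalSpace (TotalSpace FD' D')]
    [∀ x, TopologicalSpace (D' x)] [∀ x, AddCommGroup (D' x)] [∀ x, Module ℝ (D' x)]
    [FiberBundle FD' D'] [VectorBundle ℝ FD' D']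
    [ContMDiffVectorBundle ∞ FD' D' (IM.prod 𝓘(ℝ, FA))]
    (𝒟 : VBAlgebroid IM FA A FE E FD D FD' D') :
    Nonempty 𝒟.CoreBundle ∧
    ∀ 𝒞 : 𝒟.CoreBundle,
      ∃ d : SmoothBundleHom IM 𝒞.Model 𝒞.Fibre FE E, 𝒟.IsCoreAnchor 𝒞 d ∧
      ∃ 𝒦 : LieAlgebroid (IM.prod 𝓘(ℝ, FE)) 𝒞.Model 𝒞.Pullback, 𝒟.IsKernelAlgebroid 𝒞 𝒦 ∧
      ∃ 𝒢 : LieGroupoid (IM.prod 𝓘(ℝ, 𝒞.Model × FE)) (IM.prod 𝓘(ℝ, FE))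
          (TotalSpace (𝒞.Model × FE) (𝒞.Fibre ×ᵇ E)) (TotalSpace FE E),
        (TwoVectorBundle.ofComplex d).HasComplex d ∧
        (TwoVectorBundle.ofComplex d).Underlies 𝒢 ∧
        𝒢.SourceSimplyConnected ∧ 𝒢.Integrates 𝒦 := by
  refine ⟨𝒟.nonempty_coreBundle, fun 𝒞 => ?_⟩
  obtain ⟨𝒦, h𝒦⟩ := 𝒟.exists_kernelAlgebroid 𝒞
  exact ⟨VBAlgebroid.coreAnchor 𝒞, 𝒟.isCoreAnchor_coreAnchor 𝒞, 𝒦, 𝒟.isKernelAlgebroid 𝒞 h𝒦,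
    (VBAlgebroid.coreAnchor 𝒞).complexGroupoid, (VBAlgebroid.coreAnchor 𝒞).hasComplex_ofComplex,
    (VBAlgebroid.coreAnchor 𝒞).underlies_complexGroupoid,
    (VBAlgebroid.coreAnchor 𝒞).complexGroupoid_sourceSimplyConnected,
    𝒟.integrates_kernelAlgebroid 𝒞 h𝒦⟩
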